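/- Let $D_0\subset\mathbb{R}^3$ be a nonempty bounded connected open set with $C^1$ boundary, let $L\in\mathbb{R}$, write $\mathcal R[\varphi](x_1,x_2,x_3)=\varphi(-x_1,x_2,x_3)$, and let $D=D_1\cup D_2$ be the symmetric dimer with $D_1=D_0+(-L,0,0)$ and $D_2=\mathcal R(D_0)+(L,0,0)$, where $\mathcal R(D_0)$ is the reflection of $D_0$ in $\{x_1=0\}$. Assume that $D$ also has $C^1$ boundary (for instance, that $\overline{D_1}$ and $\overline{D_2}$ are disjoint). All functions are complex-valued, $\langle f,g\rangle_D=\int_D\overline f g\,dx$, and for $\omega\in\mathbb{C}$ $$\mathcal K_D^\omega[f](x)=\int_D\frac{e^{i\omega|x-y|}}{4\pi|x-y|}f(y)\,dy,\qquad \mathcal K_D=\mathcal K_D^{0},\qquad N(u)=u+|u|^2u .$$ For $\tau>0$, a number $\omega\in\mathbb{C}$ is a nonlinear dielectric resonance with resonant state $u$ if $0\not\equiv u\in H^2(D)$ and $u=\tau\omega^2\mathcal K_D^\omega[N(u)]$ on $D$. (1) Let $\lambda$ be a simple eigenvalue of $\mathcal K_D$ on $L^2(D)$ with eigenfunction $\varphi$,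 $\|\varphi\|_{L^2(D)}=1$. Then $\mathcal R[\varphi]=\varphi$ or $\mathcal R[\varphi]=-\varphi$ (a.e. on $D$). (2) $\mathcal K_D$ has a largest eigenvalue $\lambda_0$. It is simple and has a normalized eigenfunction $\varphi_0$, continuous on $\overline D$, with $\varphi_0>0$ on $D$ and $\mathcal R[\varphi_0]=\varphi_0$ on $D$. (3) Let $(\lambda,\varphi)$ be as in (1). For $\delta,\rho\in\mathbb{R}$ put $U_\delta=\{(a,\tau): a>0,\ \tau>0,\ a+\tau^{-1}<\delta\}$, and say that a pair $(\omega,v)$ is $\rho$-near at contrast $\tau$ if $|\sqrt\tau\,\omega-\lambda^{-1/2}|<\rho$ and $\|v\|_{H^2(D)}<\rho$. A family $(\omega(a,\tau),u(a,\tau))_{(a,\tau)\in U_\delta}$ is called a small-amplitude branch attached to $(\lambda,\varphi)$, with parameters $\delta,\rho$, if - for every $(a,\tau)\in U_\delta$, $\omega(a,\tau)$ is a nonlinear dielectric resonance at contrast $\tau$ with resonant state $u(a,\tau)=a\varphi+h(a,\tau)$, where $\langle\varphi,h(a,\tau)\rangle_D=0$, and $(\omega(a,\tau),u(a,\tau))$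 is $\rho$-near at contrast $\tau$; - it is unique up to phase: if $(a,\tau)\in U_\delta$ and $\omega'$ is a resonance at contrast $\tau$ with resonant state $v$ such that $(\omega',v)$ is $\rho$-near at contrast $\tau$ and $|\langle\varphi,v\rangle_D|=a$, then $\omega'=\omega(a,\tau)$ and $v=e^{i\theta}u(a,\tau)$ for some $\theta\in\mathbb{R}$; - $\sqrt\tau\,\omega(a,\tau)\to\lambda^{-1/2}$ and $\|u(a,\tau)\|_{H^2(D)}\to0$ as $a\to0^+$ and $\tau\to\infty$. Then such a branch exists for some $\delta>0$ and $\rho>0$. Moreover, for all $\delta,\rho$ and every such branch, $u(a,\tau)$ has the same symmetry as $\varphi$ for all $(a,\tau)\in U_\delta$: if $\mathcal R[\varphi]=\varphi$ then $\mathcal R[u(a,\tau)]=u(a,\tau)$, and if $\mathcal R[\varphi]=-\varphi$ then $\mathcal R[u(a,\tau)]=-u(a,\tau)$. -/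

import Mathlib

noncomputable section

namespace DimerResonance

open MeasureTheory Filter Topology
open scoped SchwartzMap ComplexConjugate

/-- Three-dimensional Euclidean space. -/
abbrev E3 : Type := EuclideanSpace ℝ (Fin 3)

/-! ### Geometry -/

/-- Reflection in the plane `x₁ = 0`; the reflection of a function `u` is `u ∘ reflect`. -/
def reflect (x : E3) : E3 := !₂[-x 0, x 1, x 2]

/-- The vector `(s, 0, 0)`. -/
def shift (s : ℝ) : E3 := !₂[s, 0, 0]

/-- An open set with `C¹` boundary: near each boundary point it is the strict sublevel set `{f < 0}`
of a `C¹` function with `f = 0` and `df ≠ 0` at that point. -/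
def HasC1Boundary (D : Set E3) : Prop :=
  ∀ x ∈ frontier D, ∃ f : E3 → ℝ, ContDiffAt ℝ 1 f x ∧ f x = 0 ∧ fderiv ℝ f x ≠ 0 ∧
    ∀ᶠ y in 𝓝 x, (y ∈ D ↔ f y < 0)

/-- A single particle: a nonempty bounded connected open set with `C¹` boundary. -/
structure IsParticle (D₀ : Set E3) : Prop where
  isOpen : IsOpen D₀
  isBounded : Bornology.IsBounded D₀
  isConnected : IsConnected D₀
  boundary : HasC1Boundary D₀

/-- The symmetric dimer `(D₀ + (-L,0,0)) ∪ (R(D₀) + (L,0,0))`. -/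
def dimer (D₀ : Set E3) (L : ℝ) : Set E3 :=
  (fun x => x + shift (-L)) '' D₀ ∪ (fun x => x + shift L) '' (reflect '' D₀)

/-- `u` is even (symmetric) on `D`, as an almost-everywhere class. -/
def IsEvenOn (D : Set E3) (u : E3 → ℂ) : Prop :=
  (fun x => u (reflect x)) =ᵐ[volume.restrict D] u

/-- `u` is odd (antisymmetric) on `D`, as an almost-everywhere class. -/
def IsOddOn (D : Set E3) (u : E3 → ℂ) : Prop :=
  (fun x => u (reflect x)) =ᵐ[volume.restrict D] fun x => -u x

/-! ### Function spaces -/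

/-- The inner product of `L²(D)`, conjugate-linear in the first argument. -/
def l2Inner (D : Set E3) (f g : E3 → ℂ) : ℂ := ∫ x in D, conj (f x) * g x

/-- `H²(D)`: restrictions to `D` of elements of `H²(ℝ³)`. -/
def MemH2 (D : Set E3) (u : E3 → ℂ) : Prop :=
  ∃ v : Lp ℂ 2 (volume : Measure E3),
    TemperedDistribution.MemSobolev 2 2 (v : 𝓢'(E3, ℂ)) ∧ v =ᵐ[volume.restrict D] u

/-- The norm of `H²(D)`: the infimum of the `H²(ℝ³)` norms of all extensions, where the norm of
`v ∈ H²(ℝ³)` is the `L²` norm of its Bessel potential of order two. -/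
def h2Norm (D : Set E3) (u : E3 → ℂ) : ℝ :=
  sInf {r : ℝ | ∃ v f : Lp ℂ 2 (volume : Measure E3), v =ᵐ[volume.restrict D] u ∧
    TemperedDistribution.besselPotential E3 ℂ 2 (v : 𝓢'(E3, ℂ)) = (f : 𝓢'(E3, ℂ)) ∧ r = ‖f‖}

/-! ### Newtonian potential and its eigenvalues -/

/-- The Newtonian potential `K_D[f](x) = ∫_D f(y) / (4π|x - y|) dy`. -/
def newtonPotential (D : Set E3) (f : E3 → ℂ) (x : E3) : ℂ :=
  ∫ y in D, ((1 / (4 * Real.pi * ‖x - y‖) : ℝ) : ℂ) * f y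

/-- `φ` is an `L²(D)`-normalized eigenfunction of the Newtonian potential for `lam`. -/
structure IsNormalizedEigenfunction (D : Set E3) (lam : ℝ) (φ : E3 → ℂ) : Prop where
  memLp : MemLp φ 2 (volume.restrict D)
  norm_eq_one : ∫ x in D, ‖φ x‖ ^ 2 = 1
  eigen : newtonPotential D φ =ᵐ[volume.restrict D] fun x => (lam : ℂ) * φ x

/-- `lam` is an eigenvalue of the Newtonian potential on `L²(D)`. -/
def IsEigenvalue (D : Set E3) (lam : ℝ) : Prop :=
  ∃ φ, IsNormalizedEigenfunction D lam φ

/-- `lam` is a simple eigenvalue: its eigenspace in `L²(D)` is one-dimensional over `ℂ`. -/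
def IsSimpleEigenvalue (D : Set E3) (lam : ℝ) : Prop :=
  IsEigenvalue D lam ∧ ∀ φ ψ, IsNormalizedEigenfunction D lam φ →
    IsNormalizedEigenfunction D lam ψ → ∃ c : ℂ, ψ =ᵐ[volume.restrict D] fun x => c * φ x

/-! ### Nonlinear resonances -/

/-- The outgoing Green function of `-(Δ + ω²)` in `ℝ³`. -/
def green (ω : ℂ) (x : E3) : ℂ :=
  Complex.exp (Complex.I * ω * (‖x‖ : ℂ)) / (4 * (Real.pi : ℂ) * (‖x‖ : ℂ))

/-- The volume potential `K_D^ω`. -/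
def volumePotential (D : Set E3) (ω : ℂ) (f : E3 → ℂ) (x : E3) : ℂ :=
  ∫ y in D, green ω (x - y) * f y

/-- The Kerr nonlinearity `N(z) = z + |z|² z`. -/
def kerr (z : ℂ) : ℂ := z + ((‖z‖ ^ 2 : ℝ) : ℂ) * z

/-- `ω` is a nonlinear dielectric resonance at contrast `τ`, with resonant state `u`: a nontrivial
`u ∈ H²(D)` with `u = τ ω² K_D^ω[N(u)]`. -/
structure IsResonantState (D : Set E3) (τ : ℝ) (ω : ℂ) (u : E3 → ℂ) : Prop where
  memH2 : MemH2 D u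
  nontrivial : ¬ u =ᵐ[volume.restrict D] fun _ => (0 : ℂ)
  lippmannSchwinger : u =ᵐ[volume.restrict D]
    fun x => (τ : ℂ) * ω ^ 2 * volumePotential D ω (fun y => kerr (u y)) x

/-- The parameters `(a, τ)` with `a > 0`, `τ > 0` and `a + 1/τ < δ`. -/
def paramRegion (δ : ℝ) : Set (ℝ × ℝ) := {p | 0 < p.1 ∧ 0 < p.2 ∧ p.1 + p.2⁻¹ < δ}

/-- The pair (scaled frequency `√τ ω`, state `v`) is `ρ`-close to `(1/√lam, 0)` in `ℂ × H²(D)`. -/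
def IsNear (D : Set E3) (lam ρ τ : ℝ) (ω : ℂ) (v : E3 → ℂ) : Prop :=
  ‖((√τ : ℝ) : ℂ) * ω - (((√lam)⁻¹ : ℝ) : ℂ)‖ < ρ ∧ h2Norm D v < ρ

/-- `(ω(a,τ), u(a,τ))`, for `(a, τ)` in the region of size `δ`, is the small-amplitude branch of
nonlinear resonances and resonant states attached to the eigenpair `(lam, φ)`: writing
`u = a φ + h`, one has `⟨φ, h⟩ = 0` (that is, `⟨φ, u⟩ = a` since `φ` is normalized); the scaled
frequency tends to `1/√lam` and `u` tends to `0` in `H²(D)` as `a → 0`, `τ → ∞`; and the pair is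
unique near `(1/√lam, 0)` up to the symmetry `u ↦ e^{iθ} u`. -/
structure IsResonantBranch (D : Set E3) (lam : ℝ) (φ : E3 → ℂ) (δ ρ : ℝ)
    (ω : ℝ → ℝ → ℂ) (u : ℝ → ℝ → E3 → ℂ) : Prop where
  resonant : ∀ a τ, (a, τ) ∈ paramRegion δ → IsResonantState D τ (ω a τ) (u a τ)
  amplitude : ∀ a τ, (a, τ) ∈ paramRegion δ → l2Inner D φ (u a τ) = (a : ℂ)
  near : ∀ a τ, (a, τ) ∈ paramRegion δ → IsNear D lam ρ τ (ω a τ) (u a τ)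
  unique : ∀ a τ, (a, τ) ∈ paramRegion δ → ∀ (ω' : ℂ) (v : E3 → ℂ),
    IsResonantState D τ ω' v → IsNear D lam ρ τ ω' v → ‖l2Inner D φ v‖ = a →
      ω' = ω a τ ∧ ∃ θ : ℝ,
        v =ᵐ[volume.restrict D] fun x => Complex.exp (Complex.I * (θ : ℂ)) * u a τ x
  tendsto_frequency : Tendsto (fun p : ℝ × ℝ => ((√p.2 : ℝ) : ℂ) * ω p.1 p.2)
    (𝓝[>] 0 ×ˢ atTop) (𝓝 (((√lam)⁻¹ : ℝ) : ℂ))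
  tendsto_state : Tendsto (fun p : ℝ × ℝ => h2Norm D (u p.1 p.2)) (𝓝[>] 0 ×ˢ atTop) (𝓝 0)

end DimerResonance

end

noncomputable section

namespace DimerResonance

open MeasureTheory Filter Topology
open scoped SchwartzMap ComplexConjugate ENNReal NNReal FourierTransform

/-! All symmetry statements rest on one fact: the kernel of the potential depends only on |x - y|
and D is invariant under the reflection R, so the potential commutes with R
(`volumePotential_comp_reflect`). On a one-dimensional eigenspace R acts as a scalar c, and R² = 1
forces c = ±1.

For the ground state, K_D is compact, symmetric and strictly positive (`re_inner_potentialCLM_pos`),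
so its norm is its largest eigenvalue (`hasEigenvalue_norm`). Since the kernel is positive, the
modulus of a top eigenfunction is again one (`potentialCLM_modulus`), and equality in the triangle
inequality makes the phase of a top eigenfunction constant (`exists_ae_phase`). A function of
constant phase orthogonal to a positive one vanishes, whence simplicity; and a positive function
cannot be odd.

For the branch, put u = aU, κ = √τ ω, ε = 1/√τ, t = a². The problem becomes ⟨φ, U⟩ = 1, U = κ²
K^{εκ}[U + t|U|²U], solved by (λ^{-1/2}, φ) at ε = t = 0. Its linearization there is the identity
plus a compact operator, and is injective because λ is simple and K symmetric
(`exists_linearization_equiv`). The cubic term is not complex differentiable and does not act on L²,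
so it is truncated to a globally Lipschitz map, and the inverse function theorem for maps close to a
linear one is used (`exists_unique_bifurcation`). The potential maps L² to L^∞, which gives an a
priori bound under which the truncation is inactive (`ae_norm_le_of_eq_smul`). Competitors in the
uniqueness claim are only known to be small in H²; by Sobolev their cubic term is then relatively
small, and `norm_sub_le_of_eq_smul` forces the normalized state close to φ. The symmetry of an
arbitrary branch uses its uniqueness alone: the reflected state is a competitor with the same
amplitude.

The analytic input is the Fourier transform of kernels F(|x|)/(4π|x|), which reduces to a sine
integral of F (`mul_fourier_radialKernel`). It yields both the H² bounds for potentials, whose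
kernel may be cut off at large distance since D is bounded, and the positivity of K_D. -/

/-- The Hilbert space `L²(D)`. -/
abbrev L2 (D : Set E3) : Type := Lp ℂ 2 (volume.restrict D)

/-! ### Convolution operators on `L²(D)` with square-integrable kernels -/

/-- Convolution with the kernel `g` over `D`. -/
def convOn (D : Set E3) (g f : E3 → ℂ) (x : E3) : ℂ := ∫ y in D, g (x - y) * f y

theorem convOn_congr {D : Set E3} (g : E3 → ℂ) {f f' : E3 → ℂ}
    (h : f =ᵐ[volume.restrict D] f') (x : E3) : convOn D g f x = convOn D g f' x := by
  refine integral_congr_ae ?_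
  filter_upwards [h] with y hy
  rw [hy]

/-- The function `y ↦ conj (g (x - y))` as an element of `L²(D)`. -/
def kernelRow (D : Set E3) (g : Lp ℂ 2 (volume : Measure E3)) (x : E3) : L2 D :=
  LpToLpRestrictCLM E3 ℂ ℂ volume 2 D (Lp.compMeasurePreserving (fun y => x - y)
    (Measure.measurePreserving_sub_left volume x) (star g))

theorem kernelRow_ae (D : Set E3) {g : E3 → ℂ} (hg : MemLp g 2 volume) (x : E3) :
    kernelRow D (hg.toLp g) x =ᵐ[volume.restrict D] fun y => conj (g (x - y)) := by
  have hmp := Measure.measurePreserving_sub_left (volume : Measure E3) x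
  have h1 := LpToLpRestrictCLM_coeFn ℂ D (Lp.compMeasurePreserving (fun y => x - y)
    hmp (star (hg.toLp g)))
  have h2 := Lp.coeFn_compMeasurePreserving (star (hg.toLp g)) hmp
  have h3 : ⇑(star (hg.toLp g) : Lp ℂ 2 (volume : Measure E3)) =ᵐ[volume] fun y => conj (g y) := by
    filter_upwards [Lp.coeFn_star (hg.toLp g), hg.coeFn_toLp] with y h h'
    rw [h, Pi.star_apply, h']
    rfl
  have h4 := hmp.quasiMeasurePreserving.ae_eq_comp h3
  filter_upwards [h1, ae_restrict_of_ae h2, ae_restrict_of_ae h4] with y e1 e2 e4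
  rw [kernelRow, e1, e2, e4]
  rfl

theorem norm_kernelRow_le (D : Set E3) (g : Lp ℂ 2 (volume : Measure E3)) (x : E3) :
    ‖kernelRow D g x‖ ≤ ‖g‖ := by
  refine (norm_Lp_toLp_restrict_le D _).trans ?_
  rw [Lp.norm_compMeasurePreserving]
  refine Lp.norm_le_norm_of_ae_le ?_
  filter_upwards [Lp.coeFn_star g] with y hy
  rw [hy, Pi.star_apply, norm_star]

/-- Continuity of translations in L². It makes potentials continuous functions and the rows over the
closure of D a compact set. -/
theorem continuous_kernelRow (D : Set E3) (g : Lp ℂ 2 (volume : Measure E3)) :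
    Continuous (kernelRow D g) := by
  refine (LpToLpRestrictCLM E3 ℂ ℂ volume 2 D).continuous.comp ?_
  let G : C(E3, C(E3, E3)) := ContinuousMap.curry ⟨fun p : E3 × E3 => p.1 - p.2, by fun_prop⟩
  exact (continuous_const (y := star g)).compMeasurePreservingLp G.continuous
    (fun x => Measure.measurePreserving_sub_left volume x) (by norm_num)

/-- Pointwise values are pairings with a row of norm at most ‖g‖. Boundedness, continuity and
compactness of the operator all come from this. -/
theorem convOn_eq_inner (D : Set E3) {g : E3 → ℂ} (hg : MemLp g 2 volume) (f : L2 D) (x : E3) :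
    convOn D g f x = inner ℂ (kernelRow D (hg.toLp g) x) f := by
  rw [L2.inner_def, convOn]
  refine integral_congr_ae ?_
  filter_upwards [kernelRow_ae D hg x] with y hy
  rw [hy]
  simp [mul_comm]

theorem norm_convOn_le (D : Set E3) {g : E3 → ℂ} (hg : MemLp g 2 volume) (f : L2 D) (x : E3) :
    ‖convOn D g f x‖ ≤ ‖hg.toLp g‖ * ‖f‖ := by
  rw [convOn_eq_inner D hg]
  exact (norm_inner_le_norm _ _).trans (by gcongr; exact norm_kernelRow_le D _ x)

theorem continuous_convOn (D : Set E3) {g : E3 → ℂ} (hg : MemLp g 2 volume) (f : L2 D) :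
    Continuous (convOn D g f) := by
  rw [funext (convOn_eq_inner D hg f)]
  exact (continuous_kernelRow D _).inner continuous_const

theorem integrable_convOn (D : Set E3) {g : E3 → ℂ} (hg : MemLp g 2 volume) {f : E3 → ℂ}
    (hf : MemLp f 2 (volume.restrict D)) (x : E3) :
    Integrable (fun y => g (x - y) * f y) (volume.restrict D) := by
  have h1 : MemLp (fun y => g (x - y)) 2 (volume.restrict D) :=
    (hg.comp_measurePreserving (Measure.measurePreserving_sub_left volume x)).restrict D
  exact h1.integrable_mul hf

/-- This is `norm_convOn_le` for |g| and |f|; it supplies the absolute integrability needed for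
Fubini. -/
theorem integral_norm_convOn_le (D : Set E3) {g : E3 → ℂ} (hg : MemLp g 2 volume) (f : L2 D) (x : E3) :
    ∫ y in D, ‖g (x - y) * f y‖ ≤ ‖hg.toLp g‖ * ‖f‖ := by
  have hgn : MemLp (fun x => ((‖g x‖ : ℝ) : ℂ)) 2 volume := hg.norm.ofReal
  have hfn : MemLp (fun x => ((‖f x‖ : ℝ) : ℂ)) 2 (volume.restrict D) := (Lp.memLp f).norm.ofReal
  have h1 := norm_convOn_le D hgn (hfn.toLp _) x
  have h2 : ‖hgn.toLp _‖ = ‖hg.toLp g‖ := by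
    rw [Lp.norm_toLp, Lp.norm_toLp]
    congr 1
    exact eLpNorm_congr_norm_ae (ae_of_all _ fun x => by simp)
  have h3 : ‖hfn.toLp _‖ = ‖f‖ := by
    rw [Lp.norm_toLp, Lp.norm_def]
    congr 1
    exact eLpNorm_congr_norm_ae (ae_of_all _ fun x => by simp)
  rw [h2, h3, convOn_congr _ hfn.coeFn_toLp, convOn] at h1
  refine le_trans ?_ h1
  have h4 : ∫ y in D, ((‖g (x - y)‖ : ℝ) : ℂ) * ((‖f y‖ : ℝ) : ℂ) =
      ((∫ y in D, ‖g (x - y) * f y‖ : ℝ) : ℂ) := by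
    rw [← integral_complex_ofReal]
    simp only [norm_mul, Complex.ofReal_mul]
  rw [h4, Complex.norm_real]
  exact le_abs_self _

/-! ### Boundedness, compactness and symmetry of the convolution operators. -/

section Operator

variable {D : Set E3} [IsFiniteMeasure (volume.restrict D)]

theorem memLp_convOn {g : E3 → ℂ} (hg : MemLp g 2 volume) (f : L2 D) (p : ℝ≥0∞) :
    MemLp (convOn D g f) p (volume.restrict D) :=
  MemLp.of_bound (continuous_convOn D hg f).aestronglyMeasurable (‖hg.toLp g‖ * ‖f‖)
    (ae_of_all _ (norm_convOn_le D hg f))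

/-- The square root of the volume of `D`. -/
def volSqrt (D : Set E3) [IsFiniteMeasure (volume.restrict D)] : ℝ :=
  (measureUnivNNReal (volume.restrict D) : ℝ) ^ (2 : ℝ≥0∞).toReal⁻¹

theorem volSqrt_nonneg : 0 ≤ volSqrt D := Real.rpow_nonneg NNReal.zero_le_coe _

theorem norm_toLp_le_of_bound {f : E3 → ℂ} (hf : MemLp f 2 (volume.restrict D)) {C : ℝ}
    (hC : 0 ≤ C) (h : ∀ᵐ x ∂volume.restrict D, ‖f x‖ ≤ C) :
    ‖hf.toLp f‖ ≤ volSqrt D * C := by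
  refine (Lp.norm_le_of_ae_bound hC ?_).trans_eq ?_
  · filter_upwards [h, hf.coeFn_toLp] with x hx hx'
    rwa [hx']
  · simp [volSqrt]

/-- The bounded operator on `L²(D)` given by convolution with `g ∈ L²(ℝ³)`. -/
def convCLM (D : Set E3) [IsFiniteMeasure (volume.restrict D)] (g : E3 → ℂ)
    (hg : MemLp g 2 volume) : L2 D →L[ℂ] L2 D :=
  LinearMap.mkContinuous
    { toFun := fun f => (memLp_convOn hg f 2).toLp (convOn D g f)
      map_add' := fun f f' => by
        rw [← MemLp.toLp_add]
        refine MemLp.toLp_congr _ _ (ae_of_all _ fun x => ?_)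
        simp only [Pi.add_apply, convOn_eq_inner D hg, inner_add_right]
      map_smul' := fun c f => by
        rw [RingHom.id_apply, ← MemLp.toLp_const_smul]
        refine MemLp.toLp_congr _ _ (ae_of_all _ fun x => ?_)
        simp only [Pi.smul_apply, convOn_eq_inner D hg, inner_smul_right, smul_eq_mul] }
    (volSqrt D * ‖hg.toLp g‖) fun f => by
      rw [mul_assoc]
      exact norm_toLp_le_of_bound (memLp_convOn hg f 2) (by positivity) (ae_of_all _ (norm_convOn_le D hg f))

theorem convCLM_ae {g : E3 → ℂ} (hg : MemLp g 2 volume) (f : L2 D) :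
    convCLM D g hg f =ᵐ[volume.restrict D] convOn D g f :=
  (memLp_convOn hg f 2).coeFn_toLp

theorem norm_convCLM_le {g : E3 → ℂ} (hg : MemLp g 2 volume) :
    ‖convCLM D g hg‖ ≤ volSqrt D * ‖hg.toLp g‖ :=
  LinearMap.mkContinuous_norm_le _ (mul_nonneg volSqrt_nonneg (norm_nonneg _)) _

theorem convCLM_sub {g g' : E3 → ℂ} (hg : MemLp g 2 volume) (hg' : MemLp g' 2 volume) :
    convCLM D g hg - convCLM D g' hg' = convCLM D (g - g') (hg.sub hg') := by
  ext1 f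
  refine Lp.ext ?_
  filter_upwards [Lp.coeFn_sub (convCLM D g hg f) (convCLM D g' hg' f), convCLM_ae hg f,
    convCLM_ae hg' f, convCLM_ae (hg.sub hg') f] with x h1 h2 h3 h4
  rw [sub_apply, h1, Pi.sub_apply, h2, h3, h4, convOn, convOn, convOn,
    ← integral_sub (integrable_convOn D hg (Lp.memLp f) x)
      (integrable_convOn D hg' (Lp.memLp f) x)]
  simp only [Pi.sub_apply, sub_mul]

/-- The rows form a relatively compact set, so finitely many of them are an arbitrarily fine net.
Projecting the argument onto their span gives a finite-rank operator that is close in norm. -/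
theorem isCompactOperator_convCLM (hD : Bornology.IsBounded D) (hDm : MeasurableSet D)
    {g : E3 → ℂ} (hg : MemLp g 2 volume) : IsCompactOperator (convCLM D g hg) := by
  have hcl : IsClosed {f : L2 D →L[ℂ] L2 D | IsCompactOperator f} :=
    isClosed_setOfPred_isCompactOperator
  have hK : IsCompact (kernelRow D (hg.toLp g) '' closure D) :=
    hD.isCompact_closure.image (continuous_kernelRow D _)
  refine hcl.closure_subset (Metric.mem_closure_iff.2 fun ε hε => ?_)
  obtain ⟨t, -, htf, htc⟩ := hK.finite_cover_balls (e := ε / (2 * (volSqrt D + 1)))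
    (by have := volSqrt_nonneg (D := D); positivity)
  let V : Submodule ℂ (L2 D) := Submodule.span ℂ t
  have : FiniteDimensional ℂ V := FiniteDimensional.span_of_finite ℂ htf
  have hP : IsCompactOperator V.starProjection := by
    have h1 : IsCompactOperator (_root_.id : V → V) :=
      (isCompactOperator_id_iff_finiteDimensional (𝕜 := ℂ)).2 inferInstance
    exact IsCompactOperator.clm_comp (h1.comp_clm V.orthogonalProjectionOnto) V.subtypeL
  refine ⟨convCLM D g hg ∘L V.starProjection, hP.clm_comp (convCLM D g hg), ?_⟩
  rw [dist_eq_norm]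
  have hv := volSqrt_nonneg (D := D)
  have hle : ‖convCLM D g hg - convCLM D g hg ∘L V.starProjection‖ ≤
      volSqrt D * (ε / (2 * (volSqrt D + 1))) := by
    refine ContinuousLinearMap.opNorm_le_bound _ (by positivity) fun f => ?_
    have hsub : (convCLM D g hg - convCLM D g hg ∘L V.starProjection) f =
        convCLM D g hg (f - V.starProjection f) := by simp
    rw [hsub, mul_assoc]
    refine norm_toLp_le_of_bound (memLp_convOn hg _ 2) (by positivity) ?_
    filter_upwards [ae_restrict_mem hDm] with x hx
    -- The projection is self-adjoint, so it can be moved onto the row; the row's distance to V is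
    -- at most its distance to the nearest point of the net.
    rw [convOn_eq_inner D hg, inner_sub_right, ← Submodule.inner_starProjection_left_eq_right,
      ← inner_sub_left]
    refine (norm_inner_le_norm _ _).trans ?_
    gcongr
    obtain ⟨v, hv, hxv⟩ := Set.mem_iUnion₂.1 (htc (Set.mem_image_of_mem _ (subset_closure hx)))
    rw [Submodule.starProjection_minimal]
    refine (ciInf_le ⟨0, ?_⟩ (⟨v, Submodule.subset_span hv⟩ : V)).trans ?_
    · rintro _ ⟨y, rfl⟩
      exact norm_nonneg _
    · rw [Metric.mem_ball, dist_eq_norm] at hxv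
      exact hxv.le
  refine hle.trans_lt ?_
  rw [mul_div_assoc', div_lt_iff₀ (by positivity)]
  nlinarith

theorem inner_convCLM {g : E3 → ℂ} (hg : MemLp g 2 volume) (u f : L2 D) :
    inner ℂ u (convCLM D g hg f) =
      ∫ x in D, conj (u x) * convOn D g f x := by
  rw [L2.inner_def]
  refine integral_congr_ae ?_
  filter_upwards [convCLM_ae hg f] with x hx
  rw [hx]
  simp [mul_comm]

theorem integrable_prod_convOn {g : E3 → ℂ} (hg : MemLp g 2 volume) (u f : L2 D) :
    Integrable (fun p : E3 × E3 => conj (u p.1) * (g (p.1 - p.2) * f p.2))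
      ((volume.restrict D).prod (volume.restrict D)) := by
  have hac : (volume.restrict D).prod (volume.restrict D) ≪
      (volume : Measure E3).prod (volume : Measure E3) :=
    Measure.restrict_le_self.absolutelyContinuous.prod
      Measure.restrict_le_self.absolutelyContinuous
  have hm1 : AEStronglyMeasurable (fun p : E3 × E3 => g (p.1 - p.2))
      ((volume.restrict D).prod (volume.restrict D)) :=
    (hg.1.comp_quasiMeasurePreserving
      (quasiMeasurePreserving_sub_of_right_invariant volume volume)).mono_ac hac
  have hu : AEStronglyMeasurable (fun p : E3 × E3 => conj (u p.1))
      ((volume.restrict D).prod (volume.restrict D)) :=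
    (RCLike.continuous_conj.comp_aestronglyMeasurable (Lp.aestronglyMeasurable u)).comp_fst
  have hf : AEStronglyMeasurable (fun p : E3 × E3 => f p.2)
      ((volume.restrict D).prod (volume.restrict D)) := (Lp.aestronglyMeasurable f).comp_snd
  have hm : AEStronglyMeasurable (fun p : E3 × E3 => conj (u p.1) * (g (p.1 - p.2) * f p.2))
      ((volume.restrict D).prod (volume.restrict D)) := hu.mul (hm1.mul hf)
  have h1 : ∀ x, Integrable (fun y => conj (u x) * (g (x - y) * f y)) (volume.restrict D) :=
    fun x => (integrable_convOn D hg (Lp.memLp f) x).const_mul _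
  have h2 : Integrable (fun x => ∫ y, ‖conj (u x) * (g (x - y) * f y)‖ ∂volume.restrict D)
      (volume.restrict D) := by
    have hu1 : Integrable (fun x => ‖u x‖ * (‖hg.toLp g‖ * ‖f‖)) (volume.restrict D) :=
      ((Lp.memLp u).integrable (by norm_num)).norm.mul_const _
    refine hu1.mono' hm.norm.integral_prod_right' (ae_of_all _ fun x => ?_)
    have h0 : ∫ y in D, ‖conj (u x) * (g (x - y) * f y)‖ =
        ‖u x‖ * ∫ y in D, ‖g (x - y) * f y‖ := by
      rw [← integral_const_mul]
      refine integral_congr_ae (ae_of_all _ fun y => ?_)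
      dsimp only
      rw [norm_mul, RCLike.norm_conj]
    rw [Real.norm_of_nonneg (integral_nonneg fun _ => norm_nonneg _)]
    refine h0.le.trans ?_
    gcongr
    exact integral_norm_convOn_le D hg f x
  exact (integrable_prod_iff hm).2 ⟨ae_of_all _ h1, h2⟩

theorem inner_convCLM_prod {g : E3 → ℂ} (hg : MemLp g 2 volume) (u f : L2 D) :
    inner ℂ u (convCLM D g hg f) =
      ∫ p, conj (u p.1) * (g (p.1 - p.2) * f p.2)
        ∂((volume.restrict D).prod (volume.restrict D)) := by
  rw [inner_convCLM, integral_prod _ (integrable_prod_convOn hg u f)]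
  congr 1 with x
  exact (integral_const_mul _ _).symm

/-- Fubini: exchanging the two variables replaces the kernel by its conjugate transpose. -/
theorem isSymmetric_convCLM {g : E3 → ℂ} (hg : MemLp g 2 volume)
    (hs : ∀ x, conj (g (-x)) = g x) (u f : L2 D) :
    inner ℂ (convCLM D g hg u) f = inner ℂ u (convCLM D g hg f) := by
  rw [← inner_conj_symm, inner_convCLM_prod hg f u, inner_convCLM_prod hg u f, ← integral_conj,
    ← integral_prod_swap]
  congr 1 with p
  simp only [Prod.fst_swap, Prod.snd_swap, map_mul, RCLike.conj_conj]
  rw [← hs (p.1 - p.2), neg_sub]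
  ring

end Operator

/-! ### Fourier transforms of radial kernels in `ℝ³` -/

/-- The radial kernel `F(|x|) / (4π|x|)`. -/
def radialKernel (F : ℝ → ℂ) (x : E3) : ℂ := F ‖x‖ / (4 * (Real.pi : ℂ) * (‖x‖ : ℂ))

theorem integrableOn_Ioi_of_eq_zero {h : ℝ → ℂ} {A : ℝ} (hc : Continuous h)
    (h0 : ∀ r, A ≤ r → h r = 0) (a : ℝ) : IntegrableOn h (Set.Ioi a) := by
  have h1 : IntegrableOn h (Set.Ioc a A) := (hc.integrableOn_Icc (μ := volume)).mono_set
    Set.Ioc_subset_Icc_self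
  refine h1.of_forall_sdiff_eq_zero measurableSet_Ioi fun x hx => h0 x ?_
  by_contra hlt
  exact hx.2 ⟨hx.1, (not_le.1 hlt).le⟩

theorem setIntegral_Ioi_of_eq_zero {h : ℝ → ℂ} {a A : ℝ} (haA : a ≤ A)
    (h0 : ∀ r, A ≤ r → h r = 0) : ∫ r in Set.Ioi a, h r = ∫ r in a..A, h r := by
  rw [intervalIntegral.integral_of_le haA]
  refine setIntegral_eq_of_subset_of_forall_sdiff_eq_zero measurableSet_Ioi
    (fun x hx => hx.1) fun x hx => h0 x ?_
  by_contra hlt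
  exact hx.2 ⟨hx.1, (not_le.1 hlt).le⟩

section

variable {F : ℝ → ℂ} {A : ℝ}

theorem aestronglyMeasurable_radialKernel (hF : Continuous F) :
    AEStronglyMeasurable (radialKernel F) volume := by
  have : Measurable (radialKernel F) := by
    unfold radialKernel
    exact (hF.measurable.comp measurable_norm).div
      ((Complex.measurable_ofReal.comp measurable_norm).const_mul _)
  exact this.aestronglyMeasurable

theorem integrable_radialKernel (hF : Continuous F) (h0 : ∀ r, A ≤ r → F r = 0) :
    Integrable (radialKernel F) volume := by
  have := (integrable_fun_norm_addHaar (volume : Measure E3)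
    (f := fun r : ℝ => F r / (4 * (Real.pi : ℂ) * (r : ℂ)))).2
  refine this ?_
  have h1 : IntegrableOn (fun r : ℝ => (r : ℂ) * F r / (4 * (Real.pi : ℂ))) (Set.Ioi 0) :=
    integrableOn_Ioi_of_eq_zero (A := A) (by fun_prop) (fun r hr => by simp [h0 r hr]) 0
  refine h1.congr_fun (fun r hr => ?_) measurableSet_Ioi
  have hr' : (r : ℂ) ≠ 0 := Complex.ofReal_ne_zero.2 (ne_of_gt hr)
  have hpi : (Real.pi : ℂ) ≠ 0 := Complex.ofReal_ne_zero.2 Real.pi_ne_zero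
  simp only [finrank_euclideanSpace, Fintype.card_fin, Complex.real_smul]
  push_cast
  field_simp

theorem memLp_radialKernel (hF : Continuous F) (h0 : ∀ r, A ≤ r → F r = 0) :
    MemLp (radialKernel F) 2 volume := by
  rw [memLp_two_iff_integrable_sq_norm (aestronglyMeasurable_radialKernel hF)]
  have := (integrable_fun_norm_addHaar (volume : Measure E3)
    (f := fun r : ℝ => ‖F r / (4 * (Real.pi : ℂ) * (r : ℂ))‖ ^ 2)).2
  refine this ?_
  have h1 : IntegrableOn (fun r : ℝ => ((‖F r‖ ^ 2 / (4 * Real.pi) ^ 2 : ℝ) : ℂ)) (Set.Ioi 0) :=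
    integrableOn_Ioi_of_eq_zero (A := A) (by fun_prop) (fun r hr => by simp [h0 r hr]) 0
  have h2 : IntegrableOn (fun r : ℝ => RCLike.re ((‖F r‖ ^ 2 / (4 * Real.pi) ^ 2 : ℝ) : ℂ))
      (Set.Ioi 0) := h1.re
  refine h2.congr_fun (fun r hr => ?_) measurableSet_Ioi
  have hr' : r ≠ 0 := ne_of_gt hr
  simp only [finrank_euclideanSpace, Fintype.card_fin, smul_eq_mul, norm_div, norm_mul,
    Complex.norm_real, RCLike.re_to_complex, Complex.ofReal_re, Complex.norm_ofNat,
    Real.norm_eq_abs, abs_of_pos Real.pi_pos]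
  rw [div_pow, mul_pow _ (|r|), sq_abs]
  field_simp

/-- The integral of the radial kernel over the plane at height s, with ℂ as that plane. In polar
coordinates r = √(s² + ρ²) gives r dr = ρ dρ, which cancels the singular denominator, and 2π / (4π)
leaves the factor 1/2. -/
theorem integral_fun_sq_add_sq (hF : Continuous F) (h0 : ∀ r, A ≤ r → F r = 0) {s : ℝ}
    (hs : s ≠ 0) :
    ∫ z : ℂ, F (√(s ^ 2 + ‖z‖ ^ 2)) /
      (4 * (Real.pi : ℂ) * ((√(s ^ 2 + ‖z‖ ^ 2) : ℝ) : ℂ)) =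
      (∫ r in |s|..A, F r) / 2 := by
  have hpos : ∀ ρ : ℝ, 0 < s ^ 2 + ρ ^ 2 := fun ρ => by positivity
  have hsq : ∀ ρ : ℝ, √(s ^ 2 + ρ ^ 2) ≠ 0 := fun ρ => (Real.sqrt_pos.2 (hpos ρ)).ne'
  rw [integral_fun_norm_addHaar (volume : Measure ℂ)
    (fun ρ => F (√(s ^ 2 + ρ ^ 2)) / (4 * (Real.pi : ℂ) * ((√(s ^ 2 + ρ ^ 2) : ℝ) : ℂ)))]
  have hpi : (Real.pi : ℂ) ≠ 0 := Complex.ofReal_ne_zero.2 Real.pi_ne_zero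
  have hder : ∀ ρ ∈ Set.Ioi (0 : ℝ), HasDerivAt (fun ρ : ℝ => -∫ r in √(s ^ 2 + ρ ^ 2)..A, F r)
      ((ρ / √(s ^ 2 + ρ ^ 2) : ℝ) • F (√(s ^ 2 + ρ ^ 2))) ρ := by
    intro ρ _
    have h1 : HasDerivAt (fun ρ : ℝ => √(s ^ 2 + ρ ^ 2)) (ρ / √(s ^ 2 + ρ ^ 2)) ρ := by
      have h2 : HasDerivAt (fun ρ : ℝ => s ^ 2 + ρ ^ 2) (2 * ρ) ρ := by
        simpa using (hasDerivAt_pow 2 ρ).const_add (s ^ 2)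
      convert h2.sqrt (hpos ρ).ne' using 1
      field_simp
    have h3 := intervalIntegral.integral_hasDerivAt_left
      (hF.intervalIntegrable (μ := volume) (√(s ^ 2 + ρ ^ 2)) A)
      hF.stronglyMeasurable.stronglyMeasurableAtFilter hF.continuousAt
    have h4 := (h3.scomp ρ h1).neg
    rw [smul_neg, neg_neg] at h4
    exact h4
  have hcont : Continuous fun ρ : ℝ => (ρ / √(s ^ 2 + ρ ^ 2) : ℝ) • F (√(s ^ 2 + ρ ^ 2)) := by
    have : Continuous fun ρ : ℝ => ρ / √(s ^ 2 + ρ ^ 2) :=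
      continuous_id.div (by fun_prop) hsq
    fun_prop
  have hle : ∀ ρ : ℝ, ρ ≤ √(s ^ 2 + ρ ^ 2) := fun ρ => by
    refine (le_abs_self ρ).trans ?_
    rw [← Real.sqrt_sq_eq_abs]
    exact Real.sqrt_le_sqrt (by nlinarith [sq_nonneg s])
  have hzero : ∀ r, A ≤ r → ∫ t in r..A, F t = 0 := fun r hr => by
    rw [intervalIntegral.integral_symm, intervalIntegral.integral_congr (g := fun _ => (0 : ℂ))]
    · simp
    · intro t ht
      rw [Set.uIcc_of_le hr] at ht
      exact h0 t ht.1
  -- The antiderivative in ρ is minus the tail integral of F from √(s² + ρ²), which vanishes for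
  -- large ρ.
  have hint := integral_Ioi_of_hasDerivAt_of_tendsto (a := 0) (m := 0)
    (f := fun ρ : ℝ => -∫ r in √(s ^ 2 + ρ ^ 2)..A, F r) ?_ hder
    (integrableOn_Ioi_of_eq_zero hcont (fun ρ hρ => by
      rw [h0 _ (hρ.trans (hle ρ)), smul_zero]) 0) ?_
  · have hcongr : ∫ ρ in Set.Ioi (0 : ℝ), ρ ^ (Module.finrank ℝ ℂ - 1) •
        (F (√(s ^ 2 + ρ ^ 2)) / (4 * (Real.pi : ℂ) * ((√(s ^ 2 + ρ ^ 2) : ℝ) : ℂ))) =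
        ∫ ρ in Set.Ioi (0 : ℝ), (4 * (Real.pi : ℂ))⁻¹ *
          ((ρ / √(s ^ 2 + ρ ^ 2) : ℝ) • F (√(s ^ 2 + ρ ^ 2))) := by
      refine integral_congr_ae (ae_of_all _ fun ρ => ?_)
      have : ((√(s ^ 2 + ρ ^ 2) : ℝ) : ℂ) ≠ 0 := Complex.ofReal_ne_zero.2 (hsq ρ)
      simp only [Complex.finrank_real_complex, Nat.add_one_sub_one, pow_one, Complex.real_smul]
      push_cast
      field_simp
    rw [hcongr, integral_const_mul, hint, measureReal_def, Complex.volume_ball]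
    simp [Real.sqrt_sq_eq_abs]
    field_simp
    norm_num
  · have : Continuous fun ρ : ℝ => -∫ r in √(s ^ 2 + ρ ^ 2)..A, F r := by
      have h1 : Continuous fun x : ℝ => ∫ r in A..x, F r :=
        intervalIntegral.continuous_primitive (fun a b => hF.intervalIntegrable a b) A
      simp only [intervalIntegral.integral_symm A, neg_neg]
      exact h1.comp (by fun_prop)
    exact this.continuousWithinAt
  · refine tendsto_const_nhds.congr' ?_
    filter_upwards [eventually_ge_atTop A] with ρ hρ
    rw [hzero _ (hρ.trans (hle ρ)), neg_zero]

/-- The parametrization of `ℝ³` by `ℝ × ℂ`. -/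
def cylinderEquiv : E3 ≃ᵐ ℝ × ℂ :=
  ((MeasurableEquiv.toLp 2 (Fin 3 → ℝ)).symm.trans
    (MeasurableEquiv.piFinSuccAbove (fun _ => ℝ) 0)).trans
    ((MeasurableEquiv.refl ℝ).prodCongr Complex.measurableEquivPi.symm)

theorem measurePreserving_cylinderEquiv : MeasurePreserving cylinderEquiv volume volume := by
  have h1 := EuclideanSpace.volume_preserving_symm_measurableEquiv_toLp (Fin 3)
  have h2 := volume_preserving_piFinSuccAbove (fun _ : Fin 3 => ℝ) 0
  have h3 := (MeasurePreserving.id (volume : Measure ℝ)).prod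
    Complex.volume_preserving_equiv_pi.symm
  exact h3.comp (h2.comp h1)

theorem cylinderEquiv_fst (x : E3) : (cylinderEquiv x).1 = x 0 := rfl

theorem norm_sq_cylinderEquiv (x : E3) :
    ‖x‖ = √((cylinderEquiv x).1 ^ 2 + ‖(cylinderEquiv x).2‖ ^ 2) := by
  have h1 : (cylinderEquiv x).2 = ⟨x 1, x 2⟩ := by
    have h2 : (cylinderEquiv x).2 = (x 1 : ℂ) + (x 2 : ℂ) * Complex.I :=
      Complex.measurableEquivPi_symm_apply _
    rw [h2]
    apply Complex.ext <;> simp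
  rw [EuclideanSpace.norm_eq, Fin.sum_univ_three, h1, cylinderEquiv_fst, Complex.sq_norm,
    Complex.normSq_mk]
  congr 1
  simp only [Real.norm_eq_abs, sq_abs]
  ring

theorem exists_isometry_map_axis (ξ : E3) :
    ∃ T : E3 ≃ₗᵢ[ℝ] E3, T (EuclideanSpace.single 0 ‖ξ‖) = ξ := by
  refine ⟨(ℝ ∙ (EuclideanSpace.single 0 ‖ξ‖ - ξ))ᗮ.reflection, Submodule.reflection_sub ?_⟩
  simp

/-- Rotation invariance moves ξ to the first axis. Integrating over the planes orthogonal to it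
leaves a one-dimensional transform of half the tail integral of F. -/
theorem fourier_radialKernel_eq (hA : 0 ≤ A) (hF : Continuous F) (h0 : ∀ r, A ≤ r → F r = 0)
    (ξ : E3) : 𝓕 (radialKernel F) ξ =
      ∫ s in (0 : ℝ)..A, (∫ r in s..A, F r) * (Real.cos (2 * Real.pi * ‖ξ‖ * s) : ℂ) := by
  set k : ℝ := 2 * Real.pi * ‖ξ‖ with hk
  have hrot : 𝓕 (radialKernel F) ξ = 𝓕 (radialKernel F) (EuclideanSpace.single 0 ‖ξ‖) := by
    obtain ⟨T, hT⟩ := exists_isometry_map_axis ξ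
    have h1 := Real.fourier_comp_linearIsometry T (radialKernel F) (EuclideanSpace.single 0 ‖ξ‖)
    rw [hT] at h1
    have h2 : radialKernel F ∘ T = radialKernel F := by
      ext x
      simp [radialKernel]
    rw [← h1, h2]
  let G : ℝ × ℂ → ℂ := fun p => Complex.exp ((-(k * p.1) : ℝ) * Complex.I) *
    (F (√(p.1 ^ 2 + ‖p.2‖ ^ 2)) / (4 * (Real.pi : ℂ) * ((√(p.1 ^ 2 + ‖p.2‖ ^ 2) : ℝ) : ℂ)))
  have hG : ∀ x : E3, Complex.exp (((-2 * Real.pi * inner ℝ x (EuclideanSpace.single 0 ‖ξ‖) : ℝ) : ℂ)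
      * Complex.I) • radialKernel F x = G (cylinderEquiv x) := by
    intro x
    simp only [G, smul_eq_mul]
    rw [radialKernel, norm_sq_cylinderEquiv x, cylinderEquiv_fst]
    congr 4
    rw [EuclideanSpace.inner_single_right]
    simp [hk]
    ring
  have hGint : Integrable G (volume.prod volume) := by
    have h1 : Integrable (fun x => G (cylinderEquiv x)) volume := by
      refine ((integrable_radialKernel hF h0).norm).mono' ?_ ?_
      · simp_rw [← hG]
        have h2 : Continuous fun x : E3 => Complex.exp
            (((-2 * Real.pi * inner ℝ x (EuclideanSpace.single 0 ‖ξ‖) : ℝ) : ℂ) * Complex.I) := by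
          fun_prop
        exact h2.aestronglyMeasurable.smul (aestronglyMeasurable_radialKernel hF)
      · refine ae_of_all _ fun x => ?_
        rw [← hG, norm_smul, Complex.norm_exp_ofReal_mul_I, one_mul]
    exact (measurePreserving_cylinderEquiv.integrable_comp_emb
      cylinderEquiv.measurableEmbedding).1 h1
  let P : ℝ → ℂ := fun s => ∫ r in s..A, F r
  have hPz : ∀ s, A ≤ s → P s = 0 := fun r hr => by
    simp only [P]
    rw [intervalIntegral.integral_symm, intervalIntegral.integral_congr (g := fun _ => (0 : ℂ))]
    · simp
    · intro t ht
      rw [Set.uIcc_of_le hr] at ht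
      exact h0 t ht.1
  have hstep : 𝓕 (radialKernel F) ξ =
      ∫ s : ℝ, Complex.exp ((-(k * s) : ℝ) * Complex.I) * (P |s| / 2) := by
    rw [hrot, Real.fourier_eq']
    simp_rw [hG]
    rw [measurePreserving_cylinderEquiv.integral_comp cylinderEquiv.measurableEmbedding]
    change ∫ p, G p ∂(volume.prod volume) = _
    rw [integral_prod _ hGint]
    refine integral_congr_ae ?_
    filter_upwards [Measure.ae_ne volume (0 : ℝ)] with s hs
    simp only [G]
    rw [integral_const_mul, integral_fun_sq_add_sq hF h0 hs]
  have hPc : Continuous P := by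
    have h1 : Continuous fun x : ℝ => ∫ r in A..x, F r :=
      intervalIntegral.continuous_primitive (fun a b => hF.intervalIntegrable a b) A
    simp only [P, intervalIntegral.integral_symm A]
    exact h1.neg
  have hInt : Integrable (fun s : ℝ => Complex.exp ((-(k * s) : ℝ) * Complex.I) * (P |s| / 2)) := by
    refine Continuous.integrable_of_hasCompactSupport (by fun_prop) ?_
    refine HasCompactSupport.of_support_subset_isCompact (isCompact_Icc (a := -A) (b := A)) ?_
    intro s hs
    rw [Set.mem_Icc, ← abs_le]
    by_contra hlt
    exact hs (by simp [hPz _ (not_le.1 hlt).le])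
  -- The tail integral is even in s, so averaging with the reflected integrand turns the exponential
  -- into a cosine; the two half-lines then absorb the factor 1/2.
  have hsym : ∫ s : ℝ, Complex.exp ((-(k * s) : ℝ) * Complex.I) * (P |s| / 2) =
      ∫ s : ℝ, (Real.cos (k * ‖s‖) : ℂ) * (P ‖s‖ / 2) := by
    have h1 := integral_neg_eq_self
      (fun s : ℝ => Complex.exp ((-(k * s) : ℝ) * Complex.I) * (P |s| / 2)) volume
    have h2 : ∫ s : ℝ, Complex.exp ((-(k * s) : ℝ) * Complex.I) * (P |s| / 2) =
        ((∫ s : ℝ, Complex.exp ((-(k * -s) : ℝ) * Complex.I) * (P |-s| / 2)) +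
        ∫ s : ℝ, Complex.exp ((-(k * s) : ℝ) * Complex.I) * (P |s| / 2)) / 2 := by
      rw [h1]; ring
    rw [h2, ← integral_add hInt.comp_neg hInt, ← integral_div]
    refine integral_congr_ae (ae_of_all _ fun s => ?_)
    simp only [abs_neg, Real.norm_eq_abs]
    have h3 : (Real.cos (k * |s|) : ℂ) = Complex.cos ((k * s : ℝ) : ℂ) := by
      rw [← Complex.ofReal_cos]
      congr 1
      rcases abs_choice s with h | h <;> rw [h]
      rw [mul_neg, Real.cos_neg]
    rw [h3, Complex.cos]
    push_cast
    ring_nf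
  rw [hstep, hsym, integral_fun_norm_addHaar (volume : Measure ℝ)
    (fun s => (Real.cos (k * s) : ℂ) * (P s / 2))]
  simp only [Module.finrank_self, tsub_self, pow_zero, one_smul]
  rw [setIntegral_Ioi_of_eq_zero hA (fun s hs => by rw [hPz s hs]; simp), measureReal_def,
    Real.volume_ball, ← intervalIntegral.integral_smul]
  refine intervalIntegral.integral_congr fun s _ => ?_
  simp [P]
  ring

/-- Integration by parts; the boundary terms vanish because the tail integral is zero at A and the
sine is zero at 0. Keeping 2π|ξ| on the left avoids excluding ξ = 0. -/
theorem mul_fourier_radialKernel (hA : 0 ≤ A) (hF : Continuous F) (h0 : ∀ r, A ≤ r → F r = 0)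
    (ξ : E3) : ((2 * Real.pi * ‖ξ‖ : ℝ) : ℂ) * 𝓕 (radialKernel F) ξ =
      ∫ r in (0 : ℝ)..A, F r * (Real.sin (2 * Real.pi * ‖ξ‖ * r) : ℂ) := by
  rw [fourier_radialKernel_eq hA hF h0]
  set k : ℝ := 2 * Real.pi * ‖ξ‖
  have hu : ∀ s ∈ Set.uIcc 0 A, HasDerivAt (fun s : ℝ => ∫ r in s..A, F r) (-F s) s := fun s _ =>
    intervalIntegral.integral_hasDerivAt_left (hF.intervalIntegrable (μ := volume) s A)
      hF.stronglyMeasurable.stronglyMeasurableAtFilter hF.continuousAt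
  have hv : ∀ s ∈ Set.uIcc 0 A, HasDerivAt (fun s : ℝ => (Real.sin (k * s) : ℂ))
      ((k : ℂ) * (Real.cos (k * s) : ℂ)) s := fun s _ => by
    have h1 : HasDerivAt (fun s : ℝ => Real.sin (k * s)) (Real.cos (k * s) * k) s := by
      simpa using ((hasDerivAt_id s).const_mul k).sin
    have := h1.ofReal_comp
    rw [Complex.ofReal_mul, mul_comm] at this
    exact this
  have := intervalIntegral.integral_mul_deriv_eq_deriv_mul hu hv
    (hF.neg.intervalIntegrable _ _) (Continuous.intervalIntegrable (by fun_prop) _ _)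
  simp only [intervalIntegral.integral_same, zero_mul, mul_zero, Real.sin_zero, Complex.ofReal_zero,
    sub_zero, zero_sub, neg_mul, intervalIntegral.integral_neg, neg_neg] at this
  rw [← this, ← intervalIntegral.integral_const_mul]
  refine intervalIntegral.integral_congr fun s _ => ?_
  ring

end

/-! ### Bessel potentials and the Sobolev space `H²` -/

theorem integral_fourier_mul (f g : E3 → ℂ) (hf : Integrable f) (hg : Integrable g) :
    ∫ x, 𝓕 f x * g x = ∫ x, f x * 𝓕 g x := by
  have := VectorFourier.integral_fourierIntegral_smul_eq_flip (μ := (volume : Measure E3))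
    (ν := (volume : Measure E3)) (L := innerₗ E3) Real.continuous_fourierChar
    continuous_inner hf hg
  rw [flip_innerₗ] at this
  exact this

theorem integral_fourierInv_mul (f g : E3 → ℂ) (hf : Integrable f) (hg : Integrable g) :
    ∫ x, 𝓕⁻ f x * g x = ∫ x, f x * 𝓕⁻ g x := by
  have h1 := integral_fourier_mul f (fun x => g (-x)) hf hg.comp_neg
  have h2 : ∀ x, 𝓕 (fun y => g (-y)) x = 𝓕⁻ g x := fun x => by
    have := Real.fourier_comp_linearIsometry (LinearIsometryEquiv.neg ℝ (E := E3)) g x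
    rw [Real.fourierInv_eq_fourier_neg]
    exact this
  simp only [h2] at h1
  rw [← h1, ← integral_neg_eq_self]
  refine integral_congr_ae (ae_of_all _ fun x => ?_)
  simp only [Real.fourierInv_eq_fourier_neg, neg_neg]

/-- At order two the multiplier is the polynomial 1 + |x|². In this normalization of the Fourier
transform it is the symbol of 1 - Δ/(4π²), the source of the factors 4π² below. -/
theorem besselPotential_two_apply (T : 𝓢'(E3, ℂ)) (ψ : 𝓢(E3, ℂ)) :
    ∃ h : 𝓢(E3, ℂ), TemperedDistribution.besselPotential E3 ℂ 2 T ψ = T (𝓕 h) ∧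
      ∀ x, h x = (1 + (‖x‖ : ℂ) ^ 2) * (𝓕⁻ ψ) x := by
  refine ⟨SchwartzMap.smulLeftCLM ℂ
    (fun x : E3 => ((((1 + ‖x‖ ^ 2) ^ ((2 : ℝ) / 2) : ℝ)) : ℂ)) (𝓕⁻ ψ), rfl, fun x => ?_⟩
  rw [SchwartzMap.smulLeftCLM_apply_apply (by fun_prop)]
  simp

theorem besselPotential_eq_of_fourier {v f : E3 → ℂ} (hv : MemLp v 2 volume) (hv1 : Integrable v)
    (hf : MemLp f 2 volume) (hf1 : Integrable f)
    (h : ∀ᵐ ξ, 𝓕 f ξ = (1 + (‖ξ‖ : ℂ) ^ 2) * 𝓕 v ξ) :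
    TemperedDistribution.besselPotential E3 ℂ 2 ((hv.toLp v : Lp ℂ 2 (volume : Measure E3)) :
      𝓢'(E3, ℂ)) = ((hf.toLp f : Lp ℂ 2 (volume : Measure E3)) : 𝓢'(E3, ℂ)) := by
  ext ψ
  obtain ⟨k, hk, hkx⟩ := besselPotential_two_apply (hv.toLp v : Lp ℂ 2 (volume : Measure E3)) ψ
  rw [hk, Lp.toTemperedDistribution_apply, Lp.toTemperedDistribution_apply]
  have e1 : ∫ x, (𝓕 k) x • (hv.toLp v) x = ∫ x, 𝓕 (k : E3 → ℂ) x * v x := by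
    refine integral_congr_ae ?_
    filter_upwards [hv.coeFn_toLp] with x hx
    rw [hx, SchwartzMap.fourier_coe, smul_eq_mul]
  have e2 : ∫ x, ψ x • (hf.toLp f) x = ∫ x, 𝓕 ((𝓕⁻ ψ : 𝓢(E3, ℂ)) : E3 → ℂ) x * f x := by
    refine integral_congr_ae ?_
    filter_upwards [hf.coeFn_toLp] with x hx
    rw [hx, ← SchwartzMap.fourier_coe, FourierTransform.fourier_fourierInv_eq, smul_eq_mul]
  rw [e1, e2, integral_fourier_mul _ _ k.integrable hv1,
    integral_fourier_mul _ _ (𝓕⁻ ψ).integrable hf1]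
  refine integral_congr_ae ?_
  filter_upwards [h] with ξ hξ
  rw [hξ, hkx]
  ring

/-- The multiplier `(1 + |x|²)⁻¹` as an element of `L²(ℝ³)`. -/
theorem memLp_inv_one_add_norm_sq :
    MemLp (fun x : E3 => (((1 + ‖x‖ ^ 2) ^ ((-2 : ℝ) / 2) : ℝ) : ℂ)) 2 volume := by
  have hc : Continuous fun x : E3 => (((1 + ‖x‖ ^ 2) ^ ((-2 : ℝ) / 2) : ℝ) : ℂ) := by
    have : (fun x : E3 => ((1 + ‖x‖ ^ 2) ^ ((-2 : ℝ) / 2) : ℝ)).HasTemperateGrowth := by fun_prop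
    exact Complex.continuous_ofReal.comp this.1.continuous
  rw [memLp_two_iff_integrable_sq_norm hc.aestronglyMeasurable]
  refine (integrable_rpow_neg_one_add_norm_sq (E := E3) (μ := volume) (r := 4)
    (by simp; norm_num)).congr (ae_of_all _ fun x => ?_)
  have hx : 0 ≤ 1 + ‖x‖ ^ 2 := by positivity
  dsimp only
  rw [Complex.norm_real, Real.norm_eq_abs, sq_abs,
    show (-4 : ℝ) / 2 = (-2 / 2) * 2 by norm_num, Real.rpow_mul hx, Real.rpow_two]

/-- The constant of the Sobolev embedding `H²(ℝ³) ⊂ L^∞(ℝ³)`. -/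
def sobolevConst : ℝ := ‖(memLp_inv_one_add_norm_sq.toLp _ : Lp ℂ 2 (volume : Measure E3))‖

-- Sobolev embedding: the transform of v is (1 + |x|²)⁻¹ times that of f, and the multiplier is
-- square integrable in dimension three. By Cauchy–Schwarz the transform of v is integrable, and v
-- is bounded by its L¹ norm.
open scoped ContDiff in
theorem ae_norm_le_of_besselPotential {v f : Lp ℂ 2 (volume : Measure E3)}
    (h : TemperedDistribution.besselPotential E3 ℂ 2 (v : 𝓢'(E3, ℂ)) = (f : 𝓢'(E3, ℂ))) :
    ∀ᵐ x, ‖v x‖ ≤ sobolevConst * ‖f‖ := by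
  let m : E3 → ℂ := fun x => (((1 + ‖x‖ ^ 2) ^ ((-2 : ℝ) / 2) : ℝ) : ℂ)
  have hm : MemLp m 2 volume := memLp_inv_one_add_norm_sq
  let w : E3 → ℂ := fun x => m x * (𝓕 f : Lp ℂ 2 (volume : Measure E3)) x
  have hw : Integrable w := hm.integrable_mul (Lp.memLp _)
  have hwn : ∫ x, ‖w x‖ ≤ sobolevConst * ‖f‖ := by
    have h1 : ∫ x, ‖w x‖ = ∫ x, ‖inner ℂ (hm.toLp m x) ((𝓕 f : Lp ℂ 2 volume) x)‖ := by
      refine integral_congr_ae ?_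
      filter_upwards [hm.coeFn_toLp] with x hx
      rw [hx]
      simp [w, mul_comm]
    have hmn : MemLp (fun x => ((‖m x‖ : ℝ) : ℂ)) 2 volume := hm.norm.ofReal
    have hfn : MemLp (fun x => ((‖(𝓕 f : Lp ℂ 2 (volume : Measure E3)) x‖ : ℝ) : ℂ)) 2 volume :=
      (Lp.memLp (𝓕 f : Lp ℂ 2 (volume : Measure E3))).norm.ofReal
    have h2 := norm_inner_le_norm (𝕜 := ℂ) (hmn.toLp _) (hfn.toLp _)
    have h3 : ‖hmn.toLp _‖ = sobolevConst := by
      rw [sobolevConst, Lp.norm_toLp, Lp.norm_toLp]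
      congr 1
      exact eLpNorm_congr_norm_ae (ae_of_all _ fun x => by simp [m])
    have h4 : ‖hfn.toLp _‖ = ‖f‖ := by
      rw [← Lp.norm_fourier_eq f, Lp.norm_toLp, Lp.norm_def]
      congr 1
      exact eLpNorm_congr_norm_ae (ae_of_all _ fun x => by simp)
    rw [h3, h4, L2.inner_def] at h2
    refine le_trans (le_of_eq ?_) h2
    have h5 : ∫ x, inner ℂ (hmn.toLp _ x) (hfn.toLp _ x) = ((∫ x, ‖w x‖ : ℝ) : ℂ) := by
      rw [← integral_complex_ofReal]
      refine integral_congr_ae ?_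
      filter_upwards [hmn.coeFn_toLp, hfn.coeFn_toLp] with x hx hx'
      rw [hx, hx']
      simp [w, mul_comm]
    rw [h5, Complex.norm_real, Real.norm_of_nonneg (integral_nonneg fun _ => norm_nonneg _)]
  have hmain : ∀ ψ : 𝓢(E3, ℂ), ∫ x, ψ x • v x = ∫ x, ψ x • 𝓕⁻ w x := by
    intro ψ
    rw [← Lp.toTemperedDistribution_apply,
      ← (TemperedDistribution.besselPotential_neg_apply_eq_iff 2 _ _).2 h]
    have e1 : TemperedDistribution.besselPotential E3 ℂ (-2) (f : 𝓢'(E3, ℂ)) ψ =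
        ((𝓕 f : Lp ℂ 2 (volume : Measure E3)) : 𝓢'(E3, ℂ)) (SchwartzMap.smulLeftCLM ℂ m (𝓕⁻ ψ)) := by
      rw [← Lp.fourier_toTemperedDistribution_eq]
      rfl
    rw [e1, Lp.toTemperedDistribution_apply]
    have e2 : ∫ x, ψ x • 𝓕⁻ w x = ∫ x, 𝓕⁻ (ψ : E3 → ℂ) x * w x :=
      (integral_fourierInv_mul _ _ ψ.integrable hw).symm
    rw [e2]
    refine integral_congr_ae (ae_of_all _ fun x => ?_)
    dsimp only
    rw [SchwartzMap.smulLeftCLM_apply_apply (by fun_prop), SchwartzMap.fourierInv_coe]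
    simp only [smul_eq_mul, w]
    ring
  have hcont : Continuous (𝓕⁻ w) :=
    VectorFourier.fourierIntegral_continuous Real.continuous_fourierChar
      (by simp only [LinearMap.neg_apply, innerₗ_apply_apply]; fun_prop) hw
  -- The two functions define the same distribution, as seen on compactly supported smooth
  -- functions.
  have hae : v =ᵐ[volume] 𝓕⁻ w := by
    refine ae_eq_of_integral_contDiff_smul_eq ((Lp.memLp v).locallyIntegrable (by norm_num))
      hcont.locallyIntegrable fun g hg hgc => ?_
    have hg₁ : HasCompactSupport (Complex.ofRealCLM ∘ g) := hgc.comp_left rfl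
    have hg₂ : ContDiff ℝ ∞ (Complex.ofRealCLM ∘ g) := by fun_prop
    have := hmain (hg₁.toSchwartzMap hg₂)
    simpa using this
  filter_upwards [hae] with x hx
  rw [hx]
  exact (VectorFourier.norm_fourierIntegral_le_integral_norm _ _ _ _ _).trans hwn

/-- `MemH2` makes the set of extension norms nonempty; without it `sInf` could be the default value
0 and the bound would carry no information. -/
theorem exists_extension_of_h2Norm_lt {D : Set E3} {u : E3 → ℂ} {ρ : ℝ} (hu : MemH2 D u)
    (h : h2Norm D u < ρ) : ∃ v f : Lp ℂ 2 (volume : Measure E3), v =ᵐ[volume.restrict D] u ∧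
      TemperedDistribution.besselPotential E3 ℂ 2 (v : 𝓢'(E3, ℂ)) = (f : 𝓢'(E3, ℂ)) ∧
      ‖f‖ < ρ := by
  obtain ⟨v, ⟨f, hf⟩, hv⟩ := hu
  obtain ⟨_, ⟨v', f', h1, h2, rfl⟩, hlt⟩ := exists_lt_of_csInf_lt (by exact ⟨‖f‖, v, f, hv, hf, rfl⟩) h
  exact ⟨v', f', h1, h2, hlt⟩

theorem MemH2.memLp {D : Set E3} {u : E3 → ℂ} (hu : MemH2 D u) :
    MemLp u 2 (volume.restrict D) := by
  obtain ⟨v, -, hv⟩ := hu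
  exact (memLp_congr_ae hv).1 ((Lp.memLp v).restrict D)

theorem MemH2.ae_norm_le {D : Set E3} {u : E3 → ℂ} {ρ : ℝ} (hu : MemH2 D u)
    (h : h2Norm D u < ρ) : ∀ᵐ x ∂volume.restrict D, ‖u x‖ ≤ sobolevConst * ρ := by
  obtain ⟨v, f, h1, h2, h3⟩ := exists_extension_of_h2Norm_lt hu h
  filter_upwards [h1, ae_restrict_of_ae (ae_norm_le_of_besselPotential h2)] with x hx hx'
  rw [← hx]
  exact hx'.trans (mul_le_mul_of_nonneg_left h3.le (norm_nonneg _))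

theorem h2Norm_le {D : Set E3} {u : E3 → ℂ} {v f : Lp ℂ 2 (volume : Measure E3)}
    (hv : v =ᵐ[volume.restrict D] u)
    (h : TemperedDistribution.besselPotential E3 ℂ 2 (v : 𝓢'(E3, ℂ)) = (f : 𝓢'(E3, ℂ))) :
    h2Norm D u ≤ ‖f‖ := by
  refine csInf_le ⟨0, ?_⟩ ⟨v, f, hv, h, rfl⟩
  rintro _ ⟨_, f, _, _, rfl⟩
  exact norm_nonneg f

theorem h2Norm_nonneg (D : Set E3) (u : E3 → ℂ) : 0 ≤ h2Norm D u := by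
  refine Real.sInf_nonneg ?_
  rintro _ ⟨_, f, _, _, rfl⟩
  exact norm_nonneg f

theorem MemH2.congr {D : Set E3} {u u' : E3 → ℂ} (hu : MemH2 D u)
    (h : u =ᵐ[volume.restrict D] u') : MemH2 D u' := by
  obtain ⟨v, h1, hv⟩ := hu
  exact ⟨v, h1, hv.trans h⟩

theorem h2Norm_congr {D : Set E3} {u u' : E3 → ℂ} (h : u =ᵐ[volume.restrict D] u') :
    h2Norm D u = h2Norm D u' := by
  unfold h2Norm
  congr 1
  ext r
  exact ⟨fun ⟨v, f, h1, h2⟩ => ⟨v, f, h1.trans h, h2⟩,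
    fun ⟨v, f, h1, h2⟩ => ⟨v, f, h1.trans h.symm, h2⟩⟩

section

open scoped Convolution

/-! ### `H²` regularity of potentials with radial kernels -/

/-- A `C²` function on `ℝ`, with its first two derivatives, that vanishes on `[A, ∞)`. -/
structure IsC2Profile (A : ℝ) (F F' F'' : ℝ → ℂ) : Prop where
  hasDerivAt : ∀ r, HasDerivAt F (F' r) r
  hasDerivAt' : ∀ r, HasDerivAt F' (F'' r) r
  continuous'' : Continuous F''
  eq_zero : ∀ r, A ≤ r → F r = 0
  eq_zero' : ∀ r, A ≤ r → F' r = 0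
  eq_zero'' : ∀ r, A ≤ r → F'' r = 0

/-- The profile `F - F'' / (4π²)` of the kernel `(1 - Δ / (4π²)) (F(|x|) / (4π|x|))` off the
origin. -/
def besselProfile (F F'' : ℝ → ℂ) (r : ℝ) : ℂ := F r - F'' r / (4 * (Real.pi : ℂ) ^ 2)

section

variable {F F' F'' : ℝ → ℂ} {A : ℝ}

theorem IsC2Profile.continuous (h : IsC2Profile A F F' F'') : Continuous F :=
  continuous_iff_continuousAt.2 fun r => (h.hasDerivAt r).continuousAt

theorem IsC2Profile.continuous_besselProfile (h : IsC2Profile A F F' F'') :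
    Continuous (besselProfile F F'') :=
  h.continuous.sub (h.continuous''.div_const _)

theorem IsC2Profile.besselProfile_eq_zero (h : IsC2Profile A F F' F'') (r : ℝ) (hr : A ≤ r) :
    besselProfile F F'' r = 0 := by
  simp [besselProfile, h.eq_zero r hr, h.eq_zero'' r hr]

/-- The integrand is the derivative of F' sin(kr) - kF cos(kr), which vanishes at A and leaves only
the value at the origin. -/
theorem IsC2Profile.integral_sin (h : IsC2Profile A F F' F'') (k : ℝ) :
    ∫ r in (0 : ℝ)..A, (F'' r + (k : ℂ) ^ 2 * F r) * (Real.sin (k * r) : ℂ) = k * F 0 := by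
  have hd : ∀ r ∈ Set.uIcc 0 A, HasDerivAt
      (fun r : ℝ => F' r * (Real.sin (k * r) : ℂ) - k * F r * (Real.cos (k * r) : ℂ))
      ((F'' r + (k : ℂ) ^ 2 * F r) * (Real.sin (k * r) : ℂ)) r := fun r _ => by
    have hs : HasDerivAt (fun s : ℝ => Real.sin (k * s)) (Real.cos (k * r) * k) r := by
      simpa using ((hasDerivAt_id r).const_mul k).sin
    have hc : HasDerivAt (fun s : ℝ => Real.cos (k * s)) (-Real.sin (k * r) * k) r := by
      simpa using ((hasDerivAt_id r).const_mul k).cos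
    refine (((h.hasDerivAt' r).mul hs.ofReal_comp).sub
      (((h.hasDerivAt r).const_mul (k : ℂ)).mul hc.ofReal_comp)).congr_deriv ?_
    push_cast
    ring
  rw [intervalIntegral.integral_eq_sub_of_hasDerivAt hd]
  · simp [h.eq_zero A le_rfl, h.eq_zero' A le_rfl]
  · have := h.continuous
    have := h.continuous''
    exact Continuous.intervalIntegrable (by fun_prop) _ _

/-- In Fourier form, 1 - Δ/(4π²) sends the kernel of F to the kernel of F - F''/(4π²) plus a point
mass F(0)/(4π²) at the origin. The proof cancels 2π|ξ|, hence ξ ≠ 0. -/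
theorem IsC2Profile.fourier_eq (hA : 0 ≤ A) (h : IsC2Profile A F F' F'') {ξ : E3} (hξ : ξ ≠ 0) :
    (1 + (‖ξ‖ : ℂ) ^ 2) * 𝓕 (radialKernel F) ξ =
      F 0 / (4 * (Real.pi : ℂ) ^ 2) + 𝓕 (radialKernel (besselProfile F F'')) ξ := by
  have h1 := mul_fourier_radialKernel hA h.continuous h.eq_zero ξ
  have h2 := mul_fourier_radialKernel hA h.continuous_besselProfile h.besselProfile_eq_zero ξ
  have h3 := h.integral_sin (2 * Real.pi * ‖ξ‖)
  have hpi : (Real.pi : ℂ) ≠ 0 := Complex.ofReal_ne_zero.2 Real.pi_ne_zero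
  have hn : (‖ξ‖ : ℂ) ≠ 0 := Complex.ofReal_ne_zero.2 (norm_ne_zero_iff.2 hξ)
  set k : ℝ := 2 * Real.pi * ‖ξ‖ with hk
  have hk0 : (k : ℂ) ≠ 0 := by rw [hk]; push_cast; simp [hpi, hn]
  have hFi : IntervalIntegrable (fun r => F r * (Real.sin (k * r) : ℂ)) volume 0 A := by
    have := h.continuous
    exact Continuous.intervalIntegrable (by fun_prop) _ _
  have hF2i : IntervalIntegrable (fun r => F'' r * (Real.sin (k * r) : ℂ)) volume 0 A := by
    have := h.continuous''
    exact Continuous.intervalIntegrable (by fun_prop) _ _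
  have e1 : ∫ r in (0 : ℝ)..A, (F'' r + (k : ℂ) ^ 2 * F r) * (Real.sin (k * r) : ℂ) =
      (∫ r in (0 : ℝ)..A, F'' r * (Real.sin (k * r) : ℂ)) +
        (k : ℂ) ^ 2 * ∫ r in (0 : ℝ)..A, F r * (Real.sin (k * r) : ℂ) := by
    rw [← intervalIntegral.integral_const_mul,
      ← intervalIntegral.integral_add hF2i (hFi.const_mul _)]
    refine intervalIntegral.integral_congr fun r _ => ?_
    ring
  have e2 : ∫ r in (0 : ℝ)..A, besselProfile F F'' r * (Real.sin (k * r) : ℂ) =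
      (∫ r in (0 : ℝ)..A, F r * (Real.sin (k * r) : ℂ)) -
        (4 * (Real.pi : ℂ) ^ 2)⁻¹ * ∫ r in (0 : ℝ)..A, F'' r * (Real.sin (k * r) : ℂ) := by
    rw [← intervalIntegral.integral_const_mul,
      ← intervalIntegral.integral_sub hFi (hF2i.const_mul _)]
    refine intervalIntegral.integral_congr fun r _ => ?_
    simp only [besselProfile]
    ring
  rw [e1, ← h1] at h3
  rw [e2, ← h1] at h2
  have hkk : (k : ℂ) ^ 2 = 4 * (Real.pi : ℂ) ^ 2 * (‖ξ‖ : ℂ) ^ 2 := by rw [hk]; push_cast; ring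
  refine mul_left_cancel₀ hk0 ?_
  rw [mul_add, h2, eq_sub_of_add_eq h3, hkk]
  field_simp
  ring

end

instance isFiniteMeasure_restrict_closedBall (x : E3) (R : ℝ) :
    IsFiniteMeasure (volume.restrict (Metric.closedBall x R)) :=
  ⟨by simpa using measure_closedBall_lt_top (μ := (volume : Measure E3)) (x := x) (r := R)⟩

theorem memLp_of_bound_of_eq_zero {B : Set E3} [IsFiniteMeasure (volume.restrict B)]
    (hB : MeasurableSet B) {q : E3 → ℂ} (hm : AEStronglyMeasurable q volume) {C : ℝ} (hC : 0 ≤ C)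
    (h0 : ∀ x, x ∉ B → q x = 0) (hb : ∀ x, ‖q x‖ ≤ C) :
    ∃ hq : MemLp q 2 volume, ‖hq.toLp q‖ ≤ volSqrt B * C := by
  have hBq : MemLp q 2 (volume.restrict B) := MemLp.of_bound hm.restrict C (ae_of_all _ hb)
  have hind : B.indicator q = q := Set.indicator_eq_self.2 fun x hx => by
    by_contra hxB
    exact hx (h0 x hxB)
  have hq : MemLp q 2 volume := by
    rw [← hind]
    exact (memLp_indicator_iff_restrict hB).2 hBq
  refine ⟨hq, ?_⟩
  have h1 := norm_toLp_le_of_bound hBq hC (ae_of_all _ hb)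
  rw [Lp.norm_toLp] at h1 ⊢
  rwa [← eLpNorm_indicator_eq_eLpNorm_restrict hB, hind] at h1

section

variable {D : Set E3}

theorem memLp_indicator (hDm : MeasurableSet D) (f : L2 D) : MemLp (D.indicator f) 2 volume :=
  (memLp_indicator_iff_restrict hDm).2 (Lp.memLp f)

theorem norm_toLp_indicator (hDm : MeasurableSet D) (f : L2 D) :
    ‖(memLp_indicator hDm f).toLp _‖ = ‖f‖ := by
  rw [Lp.norm_toLp, eLpNorm_indicator_eq_eLpNorm_restrict hDm, Lp.norm_def]

theorem integrable_indicator_L2 [IsFiniteMeasure (volume.restrict D)] (hDm : MeasurableSet D)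
    (f : L2 D) : Integrable (D.indicator f) volume :=
  (integrable_indicator_iff hDm).2 ((Lp.memLp f).integrable (by norm_num))

theorem convOn_eq_convolution (hDm : MeasurableSet D) (g f : E3 → ℂ) :
    convOn D g f = (D.indicator f) ⋆[ContinuousLinearMap.mul ℂ ℂ, volume] g := by
  ext x
  rw [convolution_def, convOn, ← integral_indicator hDm]
  congr 1 with y
  by_cases hy : y ∈ D <;> simp [hy, mul_comm]

theorem convOn_radialKernel_eq_zero {R A : ℝ}
    (hDR : D ⊆ Metric.closedBall 0 R)
    {F : ℝ → ℂ} (h0 : ∀ r, A ≤ r → F r = 0) (f : E3 → ℂ) (x : E3)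
    (hx : x ∉ Metric.closedBall (0 : E3) (R + A)) : convOn D (radialKernel F) f x = 0 := by
  rw [convOn]
  refine setIntegral_eq_zero_of_forall_eq_zero fun y hy => ?_
  have h1 := hDR hy
  rw [mem_closedBall_zero_iff] at h1 hx
  have h2 : A ≤ ‖x - y‖ := by
    have := norm_sub_norm_le x y
    linarith
  simp [radialKernel, h0 _ h2]

variable {F F' F'' : ℝ → ℂ} {A : ℝ}

theorem exists_memLp_convOn_radialKernel [IsFiniteMeasure (volume.restrict D)]
    {R : ℝ} (hDR : D ⊆ Metric.closedBall 0 R) (hF : Continuous F)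
    (h0 : ∀ r, A ≤ r → F r = 0) (f : L2 D) :
    ∃ hq : MemLp (convOn D (radialKernel F) f) 2 volume,
      ‖hq.toLp _‖ ≤ volSqrt (Metric.closedBall (0 : E3) (R + A)) *
        (‖(memLp_radialKernel hF h0).toLp _‖ * ‖f‖) :=
  memLp_of_bound_of_eq_zero measurableSet_closedBall
    (continuous_convOn D (memLp_radialKernel hF h0) f).aestronglyMeasurable (by positivity)
    (convOn_radialKernel_eq_zero hDR h0 f) (norm_convOn_le D _ f)

theorem fourier_convOn [IsFiniteMeasure (volume.restrict D)] (hDm : MeasurableSet D) (hF : Continuous F)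
    (h0 : ∀ r, A ≤ r → F r = 0) (f : L2 D) (ξ : E3) :
    𝓕 (convOn D (radialKernel F) f) ξ = 𝓕 (D.indicator f) ξ * 𝓕 (radialKernel F) ξ := by
  rw [convOn_eq_convolution hDm, Real.fourier_mul_convolution_eq (integrable_indicator_L2 hDm f)
    (integrable_radialKernel hF h0)]

theorem integrable_convOn_radialKernel [IsFiniteMeasure (volume.restrict D)]
    (hDm : MeasurableSet D) (hF : Continuous F)
    (h0 : ∀ r, A ≤ r → F r = 0) (f : L2 D) : Integrable (convOn D (radialKernel F) f) volume := by
  rw [convOn_eq_convolution hDm]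
  exact (integrable_indicator_L2 hDm f).integrable_convolution _ (integrable_radialKernel hF h0)

/-- The extension is the convolution itself, taken on all of ℝ³. By `IsC2Profile.fourier_eq` its
Bessel potential is a multiple of f extended by zero, coming from the point mass, plus another
convolution of the same type. -/
theorem exists_besselPotential_convOn [IsFiniteMeasure (volume.restrict D)]
    (hDm : MeasurableSet D) {R : ℝ} (hDR : D ⊆ Metric.closedBall 0 R) (hA : 0 ≤ A)
    (h : IsC2Profile A F F' F'') (f : L2 D) :
    ∃ v g : Lp ℂ 2 (volume : Measure E3),
      v =ᵐ[volume.restrict D] convOn D (radialKernel F) f ∧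
      TemperedDistribution.besselPotential E3 ℂ 2 (v : 𝓢'(E3, ℂ)) = (g : 𝓢'(E3, ℂ)) ∧
      ‖g‖ ≤ (‖F 0‖ + volSqrt (Metric.closedBall (0 : E3) (R + A)) *
        ‖(memLp_radialKernel h.continuous_besselProfile h.besselProfile_eq_zero).toLp _‖) * ‖f‖ := by
  obtain ⟨hv, -⟩ := exists_memLp_convOn_radialKernel hDR h.continuous h.eq_zero f
  obtain ⟨hw, hwn⟩ := exists_memLp_convOn_radialKernel hDR h.continuous_besselProfile
    h.besselProfile_eq_zero f
  set c : ℂ := F 0 / (4 * (Real.pi : ℂ) ^ 2) with hc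
  have hcf : MemLp (fun x => c * D.indicator f x) 2 volume := (memLp_indicator hDm f).const_mul c
  have hcfi : Integrable (fun x => c * D.indicator f x) volume :=
    (integrable_indicator_L2 hDm f).const_mul c
  have hwi := integrable_convOn_radialKernel hDm h.continuous_besselProfile
    h.besselProfile_eq_zero f
  refine ⟨hv.toLp _, (hcf.add hw).toLp _, ae_restrict_of_ae hv.coeFn_toLp,
    besselPotential_eq_of_fourier hv
      (integrable_convOn_radialKernel hDm h.continuous h.eq_zero f) (hcf.add hw)
      (hcfi.add hwi) ?_, ?_⟩
  · filter_upwards [Measure.ae_ne volume (0 : E3)] with ξ hξ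
    have e1 : 𝓕 ((fun x => c * D.indicator f x) + convOn D (radialKernel (besselProfile F F'')) f) ξ
        = c * 𝓕 (D.indicator f) ξ + 𝓕 (convOn D (radialKernel (besselProfile F F'')) f) ξ := by
      have h1 := congrFun (VectorFourier.fourierIntegral_add (L := innerₗ E3)
        Real.continuous_fourierChar continuous_inner hcfi hwi) ξ
      have h2 := congrFun (VectorFourier.fourierIntegral_const_smul Real.fourierChar
        (volume : Measure E3) (innerₗ E3) (D.indicator f) c) ξ
      exact h1.trans (congrArg₂ (· + ·) h2 rfl)
    rw [e1, fourier_convOn hDm h.continuous h.eq_zero, fourier_convOn hDm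
      h.continuous_besselProfile h.besselProfile_eq_zero, mul_left_comm, h.fourier_eq hA hξ]
    ring
  · rw [MemLp.toLp_add hcf hw]
    refine (norm_add_le _ _).trans ?_
    rw [add_mul, mul_assoc]
    refine add_le_add ?_ hwn
    have e2 : hcf.toLp _ = c • (memLp_indicator hDm f).toLp _ := rfl
    rw [e2, norm_smul, norm_toLp_indicator hDm]
    gcongr
    rw [hc, norm_div]
    refine div_le_self (norm_nonneg _) ?_
    simp only [norm_mul, norm_pow, Complex.norm_real, Real.norm_eq_abs, sq_abs, Complex.norm_ofNat]
    nlinarith [Real.pi_gt_three]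

end

/-! ### Reflection -/

/-- The reflection as a linear isometry. -/
def reflectIso : E3 ≃ₗᵢ[ℝ] E3 where
  toFun := reflect
  invFun := reflect
  map_add' x y := by ext i; fin_cases i <;> simp [reflect]; ring
  map_smul' c x := by ext i; fin_cases i <;> simp [reflect]
  left_inv x := by ext i; fin_cases i <;> simp [reflect]
  right_inv x := by ext i; fin_cases i <;> simp [reflect]
  norm_map' x := by simp [EuclideanSpace.norm_eq, Fin.sum_univ_three, reflect]

theorem reflectIso_apply (x : E3) : reflectIso x = reflect x := rfl

theorem reflect_reflect (x : E3) : reflect (reflect x) = x := reflectIso.left_inv x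

theorem norm_reflect_sub (x y : E3) : ‖reflect x - y‖ = ‖x - reflect y‖ := by
  have : reflect x - y = reflectIso (x - reflect y) := by
    rw [map_sub, reflectIso_apply, reflectIso_apply, reflect_reflect]
  rw [this, LinearIsometryEquiv.norm_map]

theorem measurePreserving_reflect : MeasurePreserving reflect (volume : Measure E3) volume :=
  reflectIso.measurePreserving

theorem measurableEmbedding_reflect : MeasurableEmbedding reflect :=
  reflectIso.toHomeomorph.measurableEmbedding

theorem reflect_mem_dimer {D₀ : Set E3} {L : ℝ} {x : E3} (hx : x ∈ dimer D₀ L) :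
    reflect x ∈ dimer D₀ L := by
  rcases hx with ⟨y, hy, rfl⟩ | ⟨_, ⟨y, hy, rfl⟩, rfl⟩
  · refine Or.inr ⟨reflect y, ⟨y, hy, rfl⟩, ?_⟩
    ext i; fin_cases i <;> simp [reflect, shift]; ring
  · refine Or.inl ⟨y, hy, ?_⟩
    ext i; fin_cases i <;> simp [reflect, shift]; ring

/-- A set that is invariant under the reflection. -/
def IsReflectInvariant (D : Set E3) : Prop := ∀ x ∈ D, reflect x ∈ D

theorem IsReflectInvariant.preimage {D : Set E3} (hD : IsReflectInvariant D) :
    reflect ⁻¹' D = D :=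
  Set.Subset.antisymm (fun x hx => by simpa [reflect_reflect] using hD _ hx) hD

theorem IsReflectInvariant.measurePreserving {D : Set E3} (hD : IsReflectInvariant D) :
    MeasurePreserving reflect (volume.restrict D) (volume.restrict D) := by
  have := measurePreserving_reflect.restrict_preimage_emb measurableEmbedding_reflect D
  rwa [hD.preimage] at this

theorem IsReflectInvariant.ae_comp {D : Set E3} (hD : IsReflectInvariant D) {u v : E3 → ℂ}
    (h : u =ᵐ[volume.restrict D] v) :
    (fun x => u (reflect x)) =ᵐ[volume.restrict D] fun x => v (reflect x) :=
  hD.measurePreserving.quasiMeasurePreserving.ae_eq_comp h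

theorem IsReflectInvariant.setIntegral_comp {D : Set E3} (hD : IsReflectInvariant D)
    (f : E3 → ℂ) : ∫ x in D, f (reflect x) = ∫ x in D, f x :=
  hD.measurePreserving.integral_comp measurableEmbedding_reflect f

/-- The Fourier transform commutes with linear isometries and the multiplier 1 + |ξ|² is radial.
Hence composition with the reflection preserves H² norms. -/
theorem besselPotential_comp_reflect {v f : Lp ℂ 2 (volume : Measure E3)}
    (h : TemperedDistribution.besselPotential E3 ℂ 2 (v : 𝓢'(E3, ℂ)) = (f : 𝓢'(E3, ℂ))) :
    TemperedDistribution.besselPotential E3 ℂ 2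
      ((Lp.compMeasurePreserving reflect measurePreserving_reflect v : Lp ℂ 2 (volume : Measure E3)) :
        𝓢'(E3, ℂ)) =
      ((Lp.compMeasurePreserving reflect measurePreserving_reflect f : Lp ℂ 2 (volume : Measure E3)) :
        𝓢'(E3, ℂ)) := by
  have hswap : ∀ (a : E3 → ℂ) (w : Lp ℂ 2 (volume : Measure E3)),
      ∫ x, a x • (Lp.compMeasurePreserving reflect measurePreserving_reflect w :
        Lp ℂ 2 (volume : Measure E3)) x = ∫ x, a (reflect x) • w x := by
    intro a w
    rw [← measurePreserving_reflect.integral_comp measurableEmbedding_reflect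
      (fun x => a (reflect x) • w x)]
    refine integral_congr_ae ?_
    filter_upwards [Lp.coeFn_compMeasurePreserving w measurePreserving_reflect] with x hx
    rw [hx, reflect_reflect]
    rfl
  ext ψ
  let ψ' : 𝓢(E3, ℂ) :=
    SchwartzMap.compCLMOfContinuousLinearEquiv ℂ reflectIso.toContinuousLinearEquiv ψ
  have hψ' : (ψ' : E3 → ℂ) = ψ ∘ reflectIso := rfl
  obtain ⟨k, hk, hkx⟩ := besselPotential_two_apply
    (Lp.compMeasurePreserving reflect measurePreserving_reflect v : Lp ℂ 2 (volume : Measure E3)) ψ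
  obtain ⟨k', hk', hkx'⟩ := besselPotential_two_apply (v : 𝓢'(E3, ℂ)) ψ'
  have hkk : (k' : E3 → ℂ) = k ∘ reflectIso := by
    ext x
    rw [hkx', Function.comp_apply, hkx, LinearIsometryEquiv.norm_map, SchwartzMap.fourierInv_coe,
      SchwartzMap.fourierInv_coe, hψ', Real.fourierInv_comp_linearIsometry]
  rw [hk, Lp.toTemperedDistribution_apply, Lp.toTemperedDistribution_apply, hswap, hswap]
  have e1 : ∫ x, ψ (reflect x) • f x = (f : 𝓢'(E3, ℂ)) ψ' := by
    rw [Lp.toTemperedDistribution_apply]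
    rfl
  rw [e1, ← h, hk', Lp.toTemperedDistribution_apply]
  refine integral_congr_ae (ae_of_all _ fun x => ?_)
  dsimp only
  rw [SchwartzMap.fourier_coe, SchwartzMap.fourier_coe, hkk, Real.fourier_comp_linearIsometry,
    reflectIso_apply]

theorem IsReflectInvariant.exists_extension_comp {D : Set E3} (hD : IsReflectInvariant D)
    {u : E3 → ℂ} {v f : Lp ℂ 2 (volume : Measure E3)} (hv : v =ᵐ[volume.restrict D] u)
    (h : TemperedDistribution.besselPotential E3 ℂ 2 (v : 𝓢'(E3, ℂ)) = (f : 𝓢'(E3, ℂ))) :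
    ∃ v' f' : Lp ℂ 2 (volume : Measure E3),
      v' =ᵐ[volume.restrict D] (fun x => u (reflect x)) ∧
      TemperedDistribution.besselPotential E3 ℂ 2 (v' : 𝓢'(E3, ℂ)) = (f' : 𝓢'(E3, ℂ)) ∧
      ‖f'‖ = ‖f‖ := by
  refine ⟨Lp.compMeasurePreserving reflect measurePreserving_reflect v,
    Lp.compMeasurePreserving reflect measurePreserving_reflect f, ?_,
    besselPotential_comp_reflect h, Lp.norm_compMeasurePreserving _ _⟩
  filter_upwards [ae_restrict_of_ae (Lp.coeFn_compMeasurePreserving v measurePreserving_reflect),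
    hD.ae_comp hv] with x hx hx'
  rw [hx, Function.comp_apply, hx']

theorem IsReflectInvariant.memH2_comp {D : Set E3} (hD : IsReflectInvariant D) {u : E3 → ℂ}
    (hu : MemH2 D u) : MemH2 D fun x => u (reflect x) := by
  obtain ⟨v, ⟨f, hf⟩, hv⟩ := hu
  obtain ⟨v', f', h1, h2, -⟩ := hD.exists_extension_comp hv hf
  exact ⟨v', ⟨f', h2⟩, h1⟩

theorem IsReflectInvariant.h2Norm_comp_lt {D : Set E3} (hD : IsReflectInvariant D) {u : E3 → ℂ}
    (hu : MemH2 D u) {ρ : ℝ} (h : h2Norm D u < ρ) : h2Norm D (fun x => u (reflect x)) < ρ := by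
  obtain ⟨v, f, h1, h2, h3⟩ := exists_extension_of_h2Norm_lt hu h
  obtain ⟨v', f', h1', h2', h3'⟩ := hD.exists_extension_comp h1 h2
  exact (h2Norm_le h1' h2').trans_lt (h3'.trans_lt h3)

end

/-! ### Truncated Helmholtz kernels -/

/-- A smooth cutoff that equals one on `[-(2|R| + 1), 2|R| + 1]` . -/
def cutoffBump (R : ℝ) : ContDiffBump (0 : ℝ) where
  -- Points of a ball of radius R are at distance at most 2|R|, so the cutoff is invisible between
  -- points of D; adding 1 keeps the radius positive when R = 0.
  rIn := 2 * |R| + 1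
  rOut := 2 * |R| + 2
  rIn_pos := by positivity
  rIn_lt_rOut := by linarith

/-- A radius beyond which the cutoff and its derivatives vanish. -/
def cutoffRadius (R : ℝ) : ℝ := 2 * |R| + 3

theorem cutoffRadius_pos (R : ℝ) : 0 < cutoffRadius R := by unfold cutoffRadius; positivity

theorem cutoffBump_eventuallyEq {R r : ℝ} (hr : cutoffRadius R ≤ r) :
    cutoffBump R =ᶠ[𝓝 r] fun _ => (0 : ℝ) := by
  -- The cutoff radius exceeds the outer radius of the bump by one, so the bump vanishes on a whole
  -- neighbourhood of r, and its derivatives vanish at r as well.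
  have : Set.Ioi (2 * |R| + 2) ∈ 𝓝 r := Ioi_mem_nhds (by unfold cutoffRadius at hr; linarith)
  filter_upwards [this] with s hs
  refine (cutoffBump R).zero_of_le_dist ?_
  rw [dist_zero_right, Real.norm_eq_abs]
  exact (le_of_lt hs).trans (le_abs_self s)

/-- The profile `exp(i ω r) χ(r)` of the truncated Helmholtz kernel. -/
def helmholtzProfile (R : ℝ) (ω : ℂ) (r : ℝ) : ℂ :=
  Complex.exp (Complex.I * ω * r) * (cutoffBump R r : ℂ)

/-- The derivative of the profile. -/
def helmholtzProfile' (R : ℝ) (ω : ℂ) (r : ℝ) : ℂ :=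
  Complex.exp (Complex.I * ω * r) *
    (Complex.I * ω * (cutoffBump R r : ℂ) + ((deriv (cutoffBump R : ℝ → ℝ) r : ℝ) : ℂ))

/-- The second derivative of the profile. -/
def helmholtzProfile'' (R : ℝ) (ω : ℂ) (r : ℝ) : ℂ :=
  Complex.exp (Complex.I * ω * r) *
    ((Complex.I * ω) ^ 2 * (cutoffBump R r : ℂ) + 2 * (Complex.I * ω) * ((deriv (cutoffBump R : ℝ → ℝ) r : ℝ) : ℂ)
      + ((deriv (deriv (cutoffBump R : ℝ → ℝ)) r : ℝ) : ℂ))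

theorem contDiff_cutoffBump (R : ℝ) : ContDiff ℝ 2 (cutoffBump R) := (cutoffBump R).contDiff

theorem contDiff_deriv_cutoffBump (R : ℝ) : ContDiff ℝ 1 (deriv (cutoffBump R)) :=
  ((contDiff_succ_iff_deriv (n := 1)).1 (contDiff_cutoffBump R)).2.2

theorem continuous_deriv_deriv_cutoffBump (R : ℝ) : Continuous (deriv (deriv (cutoffBump R))) :=
  (contDiff_deriv_cutoffBump R).continuous_deriv le_rfl

theorem isC2Profile_helmholtz (R : ℝ) (ω : ℂ) : IsC2Profile (cutoffRadius R)
    (helmholtzProfile R ω) (helmholtzProfile' R ω) (helmholtzProfile'' R ω) := by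
  have he : ∀ r : ℝ, HasDerivAt (fun r : ℝ => Complex.exp (Complex.I * ω * r))
      (Complex.exp (Complex.I * ω * r) * (Complex.I * ω)) r := fun r => by
    have h1 : HasDerivAt (fun r : ℝ => Complex.I * ω * (r : ℂ)) (Complex.I * ω) r := by
      simpa using (hasDerivAt_id r).ofReal_comp.const_mul (Complex.I * ω)
    exact h1.cexp
  have h0 : ∀ r, HasDerivAt (cutoffBump R) (deriv (cutoffBump R) r) r := fun r =>
    ((contDiff_cutoffBump R).differentiable (by norm_num) r).hasDerivAt
  have h1 : ∀ r, HasDerivAt (deriv (cutoffBump R)) (deriv (deriv (cutoffBump R)) r) r := fun r =>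
    ((contDiff_deriv_cutoffBump R).differentiable (by norm_num) r).hasDerivAt
  have hz0 : ∀ r, cutoffRadius R ≤ r → cutoffBump R r = 0 := fun r hr =>
    (cutoffBump_eventuallyEq hr).eq_of_nhds
  have hz1 : ∀ r, cutoffRadius R ≤ r → deriv (cutoffBump R) r = 0 := fun r hr => by
    rw [(cutoffBump_eventuallyEq hr).deriv_eq, deriv_const]
  have hz2 : ∀ r, cutoffRadius R ≤ r → deriv (deriv (cutoffBump R)) r = 0 := fun r hr => by
    rw [(cutoffBump_eventuallyEq hr).deriv.deriv_eq]
    simp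
  refine ⟨fun r => ?_, fun r => ?_, ?_, fun r hr => ?_, fun r hr => ?_, fun r hr => ?_⟩
  · refine ((he r).mul (h0 r).ofReal_comp).congr_deriv ?_
    rw [helmholtzProfile']
    ring
  · refine ((he r).mul (((h0 r).ofReal_comp.const_mul (Complex.I * ω)).add
      (h1 r).ofReal_comp)).congr_deriv ?_
    rw [helmholtzProfile'']
    simp only [Pi.add_apply]
    ring
  · have c0 := (contDiff_cutoffBump R).continuous
    have c1 := (contDiff_deriv_cutoffBump R).continuous
    have c2 := continuous_deriv_deriv_cutoffBump R
    unfold helmholtzProfile''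
    fun_prop
  · simp [helmholtzProfile, hz0 r hr]
  · simp [helmholtzProfile', hz0 r hr, hz1 r hr]
  · simp [helmholtzProfile'', hz0 r hr, hz1 r hr, hz2 r hr]

theorem exists_bound_cutoffBump (R : ℝ) : ∃ M : ℝ, 0 ≤ M ∧ ∀ r, |cutoffBump R r| ≤ M ∧
    |deriv (cutoffBump R) r| ≤ M ∧ |deriv (deriv (cutoffBump R)) r| ≤ M := by
  have hs := (cutoffBump R).hasCompactSupport
  obtain ⟨M0, h0⟩ := hs.exists_bound_of_continuous (contDiff_cutoffBump R).continuous
  obtain ⟨M1, h1⟩ := hs.deriv.exists_bound_of_continuous (contDiff_deriv_cutoffBump R).continuous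
  obtain ⟨M2, h2⟩ :=
    hs.deriv.deriv.exists_bound_of_continuous (continuous_deriv_deriv_cutoffBump R)
  refine ⟨max M0 (max M1 M2), (norm_nonneg _).trans ((h0 0).trans (le_max_left _ _)), fun r => ?_⟩
  exact ⟨(h0 r).trans (le_max_left _ _),
    (h1 r).trans ((le_max_left _ _).trans (le_max_right _ _)),
    (h2 r).trans ((le_max_right _ _).trans (le_max_right _ _))⟩

theorem norm_exp_I_mul_le {ω : ℂ} (hω : ‖ω‖ ≤ 1) {r A : ℝ} (hr : 0 ≤ r) (hrA : r ≤ A) :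
    ‖Complex.exp (Complex.I * ω * r)‖ ≤ Real.exp A := by
  refine (Complex.norm_exp_le_exp_norm _).trans (Real.exp_le_exp.2 ?_)
  rw [norm_mul, norm_mul, Complex.norm_I, one_mul, Complex.norm_real, Real.norm_of_nonneg hr]
  nlinarith [norm_nonneg ω]

theorem exists_bound_besselProfile (R : ℝ) : ∃ M : ℝ, 0 ≤ M ∧ ∀ ω : ℂ, ‖ω‖ ≤ 1 → ∀ r, 0 ≤ r →
    ‖besselProfile (helmholtzProfile R ω) (helmholtzProfile'' R ω) r‖ ≤ M := by
  obtain ⟨M, hM, hb⟩ := exists_bound_cutoffBump R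
  -- The 5 is 1 for the profile and 1 + 2 + 1 for the three terms of its second derivative; the
  -- divisor 4π² ≥ 1 is dropped.
  refine ⟨Real.exp (cutoffRadius R) * (5 * M), by positivity, fun ω hω r hr => ?_⟩
  rcases le_total (cutoffRadius R) r with h | h
  · rw [(isC2Profile_helmholtz R ω).besselProfile_eq_zero r h, norm_zero]
    positivity
  obtain ⟨b0, b1, b2⟩ := hb r
  have hE := norm_exp_I_mul_le hω hr h
  have hpi : ‖(4 * (Real.pi : ℂ) ^ 2)‖ = 4 * Real.pi ^ 2 := by
    simp [abs_of_pos Real.pi_pos]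
  have e : besselProfile (helmholtzProfile R ω) (helmholtzProfile'' R ω) r =
      Complex.exp (Complex.I * ω * r) * ((cutoffBump R r : ℂ) -
        ((Complex.I * ω) ^ 2 * (cutoffBump R r : ℂ) +
          2 * (Complex.I * ω) * ((deriv (cutoffBump R : ℝ → ℝ) r : ℝ) : ℂ)
      + ((deriv (deriv (cutoffBump R : ℝ → ℝ)) r : ℝ) : ℂ)) / (4 * (Real.pi : ℂ) ^ 2)) := by
    rw [besselProfile, helmholtzProfile, helmholtzProfile'']
    ring
  rw [e, norm_mul]
  refine mul_le_mul hE ?_ (norm_nonneg _) (by positivity)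
  refine (norm_sub_le _ _).trans ?_
  have h3 : ‖((Complex.I * ω) ^ 2 * (cutoffBump R r : ℂ) +
      2 * (Complex.I * ω) * ((deriv (cutoffBump R : ℝ → ℝ) r : ℝ) : ℂ)
      + ((deriv (deriv (cutoffBump R : ℝ → ℝ)) r : ℝ) : ℂ)) / (4 * (Real.pi : ℂ) ^ 2)‖ ≤ 4 * M := by
    rw [norm_div, hpi]
    refine (div_le_self (norm_nonneg _) (by nlinarith [Real.pi_gt_three])).trans ?_
    refine (norm_add_le _ _).trans ((add_le_add_left (norm_add_le _ _) _).trans ?_)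
    simp only [norm_mul, norm_pow, Complex.norm_I, Complex.norm_real, Real.norm_eq_abs,
      Complex.norm_ofNat, one_mul]
    have hω2 : ‖ω‖ ^ 2 ≤ 1 := pow_le_one₀ (norm_nonneg _) hω
    have t1 : ‖ω‖ ^ 2 * |cutoffBump R r| ≤ 1 * M :=
      mul_le_mul hω2 b0 (abs_nonneg _) zero_le_one
    have t2 : ‖ω‖ * |deriv (cutoffBump R) r| ≤ 1 * M :=
      mul_le_mul hω b1 (abs_nonneg _) zero_le_one
    linarith
  rw [Complex.norm_real, Real.norm_eq_abs]
  linarith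

/-- A continuous function equal to one on `(-∞, A]` and to zero on `[A + 1, ∞)`. -/
def plateau (A r : ℝ) : ℂ := ((max 0 (min 1 (A + 1 - r)) : ℝ) : ℂ)

theorem continuous_plateau (A : ℝ) : Continuous (plateau A) := by unfold plateau; fun_prop

theorem plateau_eq_zero {A r : ℝ} (h : A + 1 ≤ r) : plateau A r = 0 := by
  rw [plateau, max_eq_left ((min_le_right _ _).trans (by linarith)), Complex.ofReal_zero]

theorem plateau_eq_one {A r : ℝ} (h : r ≤ A) : plateau A r = 1 := by
  rw [plateau, min_eq_left (by linarith), max_eq_right zero_le_one, Complex.ofReal_one]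

/-- The `L²` norm of the kernel with profile `plateau A`. -/
def plateauNorm (A : ℝ) : ℝ :=
  ‖(memLp_radialKernel (continuous_plateau A) (fun _ => plateau_eq_zero)).toLp _‖

/-- Comparison with one fixed kernel: sup bounds on profiles that are uniform in ω become L² bounds
on kernels that are uniform in ω. -/
theorem norm_toLp_radialKernel_le {F : ℝ → ℂ} {A M : ℝ} (hF : Continuous F)
    (h0 : ∀ r, A ≤ r → F r = 0) (hM : 0 ≤ M) (hb : ∀ r, 0 ≤ r → ‖F r‖ ≤ M) :
    ‖(memLp_radialKernel hF h0).toLp _‖ ≤ M * plateauNorm A := by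
  refine Lp.norm_le_mul_norm_of_ae_le_mul ?_
  filter_upwards [(memLp_radialKernel hF h0).coeFn_toLp, (memLp_radialKernel (continuous_plateau A)
    (fun _ => plateau_eq_zero)).coeFn_toLp] with x hx hx'
  rw [hx, hx', radialKernel, radialKernel, norm_div, norm_div, ← mul_div_assoc]
  gcongr
  rcases le_total A ‖x‖ with h | h
  · rw [h0 _ h, norm_zero]
    positivity
  · rw [plateau_eq_one h, norm_one, mul_one]
    exact hb _ (norm_nonneg _)

/-- The truncated Helmholtz kernel. -/
def helmholtzKernel (R : ℝ) (ω : ℂ) : E3 → ℂ := radialKernel (helmholtzProfile R ω)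

theorem memLp_helmholtzKernel (R : ℝ) (ω : ℂ) : MemLp (helmholtzKernel R ω) 2 volume :=
  memLp_radialKernel (isC2Profile_helmholtz R ω).continuous (isC2Profile_helmholtz R ω).eq_zero

theorem norm_exp_sub_exp_le {z w : ℂ} {A : ℝ} (hz : ‖z‖ ≤ A) (hw : ‖w‖ ≤ A) :
    ‖Complex.exp z - Complex.exp w‖ ≤ Real.exp A * ‖z - w‖ := by
  refine (convex_closedBall (0 : ℂ) A).norm_image_sub_le_of_norm_deriv_le
    (fun x _ => Complex.differentiable_exp x) (fun x hx => ?_)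
    (mem_closedBall_zero_iff.2 hw) (mem_closedBall_zero_iff.2 hz)
  rw [Complex.deriv_exp]
  exact (Complex.norm_exp_le_exp_norm _).trans
    (Real.exp_le_exp.2 (mem_closedBall_zero_iff.1 hx))

theorem norm_helmholtzProfile_sub_le (R : ℝ) {ω ω' : ℂ} (hω : ‖ω‖ ≤ 1) (hω' : ‖ω'‖ ≤ 1) {r : ℝ}
    (hr : 0 ≤ r) : ‖helmholtzProfile R ω r - helmholtzProfile R ω' r‖ ≤
      Real.exp (cutoffRadius R) * cutoffRadius R * ‖ω - ω'‖ := by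
  have hA := cutoffRadius_pos R
  rcases le_total (cutoffRadius R) r with h | h
  · rw [(isC2Profile_helmholtz R ω).eq_zero r h, (isC2Profile_helmholtz R ω').eq_zero r h, sub_zero,
      norm_zero]
    positivity
  have hb : ∀ η : ℂ, ‖η‖ ≤ 1 → ‖Complex.I * η * r‖ ≤ cutoffRadius R := fun η hη => by
    rw [norm_mul, norm_mul, Complex.norm_I, one_mul, Complex.norm_real, Real.norm_of_nonneg hr]
    nlinarith [norm_nonneg η]
  have h1 := norm_exp_sub_exp_le (hb ω hω) (hb ω' hω')
  rw [helmholtzProfile, helmholtzProfile, ← sub_mul, norm_mul]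
  have h2 : ‖((cutoffBump R r : ℝ) : ℂ)‖ ≤ 1 := by
    rw [Complex.norm_real, Real.norm_of_nonneg (cutoffBump R).nonneg]
    exact (cutoffBump R).le_one
  have h3 : ‖Complex.I * ω * r - Complex.I * ω' * r‖ ≤ cutoffRadius R * ‖ω - ω'‖ := by
    rw [← sub_mul, ← mul_sub, norm_mul, norm_mul, Complex.norm_I, one_mul, Complex.norm_real,
      Real.norm_of_nonneg hr, mul_comm]
    gcongr
  calc _ ≤ Real.exp (cutoffRadius R) * ‖Complex.I * ω * r - Complex.I * ω' * r‖ * 1 := by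
        gcongr
    _ ≤ Real.exp (cutoffRadius R) * (cutoffRadius R * ‖ω - ω'‖) := by rw [mul_one]; gcongr
    _ = _ := (mul_assoc _ _ _).symm

/-- Between points of D the cutoff equals one. The Green function, in general not square integrable
at infinity, may thus be replaced by a kernel in L²(ℝ³). -/
theorem volumePotential_eq_convOn {D : Set E3} {R : ℝ} (hDR : D ⊆ Metric.closedBall 0 R)
    (hDm : MeasurableSet D) (ω : ℂ) (f : E3 → ℂ) {x : E3} (hx : x ∈ D) :
    volumePotential D ω f x = convOn D (helmholtzKernel R ω) f x := by
  refine setIntegral_congr_fun hDm fun y hy => ?_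
  have h1 : ‖x - y‖ ≤ 2 * |R| + 1 := by
    have hx' := mem_closedBall_zero_iff.1 (hDR hx)
    have hy' := mem_closedBall_zero_iff.1 (hDR hy)
    have := norm_sub_le x y
    have := le_abs_self R
    linarith
  have h2 : cutoffBump R ‖x - y‖ = 1 := by
    refine (cutoffBump R).one_of_mem_closedBall ?_
    rw [mem_closedBall_zero_iff, norm_norm]
    exact h1
  simp only [green, helmholtzKernel, radialKernel, helmholtzProfile, h2, Complex.ofReal_one,
    mul_one]

/-! ### Volume potentials as operators on `L²(D)`, with bounds uniform in the frequency. -/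

section

variable {D : Set E3} [IsFiniteMeasure (volume.restrict D)]

/-- The volume potential of a bounded set as an operator on `L²(D)`. -/
def potentialCLM (D : Set E3) [IsFiniteMeasure (volume.restrict D)] (R : ℝ) (ω : ℂ) :
    L2 D →L[ℂ] L2 D :=
  convCLM D (helmholtzKernel R ω) (memLp_helmholtzKernel R ω)

theorem potentialCLM_ae {R : ℝ} (hDR : D ⊆ Metric.closedBall 0 R) (hDm : MeasurableSet D) (ω : ℂ)
    (f : L2 D) : potentialCLM D R ω f =ᵐ[volume.restrict D] volumePotential D ω f := by
  filter_upwards [convCLM_ae (memLp_helmholtzKernel R ω) f, ae_restrict_mem hDm] with x hx hxD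
  rw [volumePotential_eq_convOn hDR hDm ω f hxD]
  exact hx

theorem exists_lipschitz_potentialCLM (D : Set E3) [IsFiniteMeasure (volume.restrict D)] (R : ℝ) :
    ∃ C : ℝ, 0 ≤ C ∧ ∀ ω ω' : ℂ, ‖ω‖ ≤ 1 →
    ‖ω'‖ ≤ 1 → ‖potentialCLM D R ω - potentialCLM D R ω'‖ ≤ C * ‖ω - ω'‖ := by
  have hA := cutoffRadius_pos R
  refine ⟨volSqrt D * ((Real.exp (cutoffRadius R) * cutoffRadius R) *
    plateauNorm (cutoffRadius R)), ?_, fun ω ω' hω hω' => ?_⟩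
  · have := volSqrt_nonneg (D := D)
    have : 0 ≤ plateauNorm (cutoffRadius R) := norm_nonneg _
    positivity
  have hk : helmholtzKernel R ω - helmholtzKernel R ω' =
      radialKernel (fun r => helmholtzProfile R ω r - helmholtzProfile R ω' r) := by
    ext x
    simp only [Pi.sub_apply, helmholtzKernel, radialKernel]
    ring
  have hle := norm_toLp_radialKernel_le (A := cutoffRadius R)
    ((isC2Profile_helmholtz R ω).continuous.sub (isC2Profile_helmholtz R ω').continuous)
    (fun r hr => by
      show helmholtzProfile R ω r - helmholtzProfile R ω' r = 0
      rw [(isC2Profile_helmholtz R ω).eq_zero r hr, (isC2Profile_helmholtz R ω').eq_zero r hr,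
        sub_zero]) (by positivity)
    (fun r hr => norm_helmholtzProfile_sub_le R hω hω' hr)
  rw [potentialCLM, potentialCLM, convCLM_sub]
  refine (norm_convCLM_le _).trans ?_
  rw [mul_assoc]
  refine mul_le_mul_of_nonneg_left ?_ volSqrt_nonneg
  simp only [hk]
  refine hle.trans (le_of_eq ?_)
  ring

theorem exists_norm_helmholtzKernel_le (R : ℝ) : ∃ C : ℝ, 0 ≤ C ∧ ∀ ω : ℂ, ‖ω‖ ≤ 1 →
    ‖(memLp_helmholtzKernel R ω).toLp _‖ ≤ C := by
  have hA := cutoffRadius_pos R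
  refine ⟨Real.exp (cutoffRadius R) * plateauNorm (cutoffRadius R),
    mul_nonneg (Real.exp_nonneg _) (norm_nonneg _), fun ω hω => ?_⟩
  refine norm_toLp_radialKernel_le (isC2Profile_helmholtz R ω).continuous
    (isC2Profile_helmholtz R ω).eq_zero (Real.exp_nonneg _) fun r hr => ?_
  rcases le_total (cutoffRadius R) r with h | h
  · rw [(isC2Profile_helmholtz R ω).eq_zero r h, norm_zero]
    positivity
  rw [helmholtzProfile, norm_mul, Complex.norm_real, Real.norm_of_nonneg (cutoffBump R).nonneg]
  exact (mul_le_of_le_one_right (norm_nonneg _) (cutoffBump R).le_one).trans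
    (norm_exp_I_mul_le hω hr h)

/-- The pointwise bound by the L² norm is the smoothing that later shows the truncation of the cubic
term to be inactive. -/
theorem exists_sup_bound_potentialCLM (D : Set E3) [IsFiniteMeasure (volume.restrict D)] (R : ℝ) :
    ∃ C : ℝ, 0 ≤ C ∧ ∀ ω : ℂ, ‖ω‖ ≤ 1 → ∀ f : L2 D,
    (∀ᵐ x ∂volume.restrict D, ‖potentialCLM D R ω f x‖ ≤ C * ‖f‖) ∧
      ‖potentialCLM D R ω f‖ ≤ C * ‖f‖ := by
  obtain ⟨C, hC, h⟩ := exists_norm_helmholtzKernel_le R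
  have hv := volSqrt_nonneg (D := D)
  refine ⟨(1 + volSqrt D) * C, by positivity, fun ω hω f => ⟨?_, ?_⟩⟩
  · filter_upwards [convCLM_ae (memLp_helmholtzKernel R ω) f] with x hx
    rw [potentialCLM, hx]
    refine (norm_convOn_le D (memLp_helmholtzKernel R ω) f x).trans ?_
    gcongr
    exact (h ω hω).trans (le_mul_of_one_le_left hC (by linarith))
  · refine ((potentialCLM D R ω).le_opNorm f).trans ?_
    gcongr
    refine (norm_convCLM_le _).trans ?_
    exact mul_le_mul (by linarith) (h ω hω) (norm_nonneg _) (by positivity)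

theorem exists_h2_bound {R : ℝ} (hDR : D ⊆ Metric.closedBall 0 R) (hDm : MeasurableSet D) :
    ∃ C : ℝ, 0 ≤ C ∧ ∀ ω : ℂ, ‖ω‖ ≤ 1 → ∀ f : L2 D,
      MemH2 D (potentialCLM D R ω f) ∧ h2Norm D (potentialCLM D R ω f) ≤ C * ‖f‖ := by
  obtain ⟨M, hM, hb⟩ := exists_bound_besselProfile R
  refine ⟨1 + volSqrt (Metric.closedBall (0 : E3) (R + cutoffRadius R)) *
    (M * plateauNorm (cutoffRadius R)), ?_, fun ω hω f => ?_⟩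
  · have := volSqrt_nonneg (D := Metric.closedBall (0 : E3) (R + cutoffRadius R))
    have : 0 ≤ plateauNorm (cutoffRadius R) := norm_nonneg _
    positivity
  have h := isC2Profile_helmholtz R ω
  obtain ⟨v, g, h1, h2, h3⟩ := exists_besselPotential_convOn hDm hDR (cutoffRadius_pos R).le h f
  have hv : v =ᵐ[volume.restrict D] potentialCLM D R ω f :=
    h1.trans (convCLM_ae (memLp_helmholtzKernel R ω) f).symm
  refine ⟨⟨v, ⟨g, h2⟩, hv⟩, (h2Norm_le hv h2).trans (h3.trans ?_)⟩
  gcongr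
  · have : helmholtzProfile R ω 0 = 1 := by
      have : cutoffBump R 0 = 1 := (cutoffBump R).one_of_mem_closedBall (by
        rw [Metric.mem_closedBall, dist_self]; exact (cutoffBump R).rIn_pos.le)
      simp [helmholtzProfile, this]
    rw [this, norm_one]
  · exact volSqrt_nonneg
  · exact norm_toLp_radialKernel_le h.continuous_besselProfile h.besselProfile_eq_zero hM (hb ω hω)

end

/-! ### Positivity of the Newtonian potential -/

open scoped ContDiff in
theorem fourier_toLp_ae {f : E3 → ℂ} (hf : MemLp f 2 volume) (hf1 : Integrable f) :
    (𝓕 (hf.toLp f) : Lp ℂ 2 (volume : Measure E3)) =ᵐ[volume] 𝓕 f := by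
  have hmain : ∀ ψ : 𝓢(E3, ℂ), ∫ x, ψ x • (𝓕 (hf.toLp f) : Lp ℂ 2 (volume : Measure E3)) x =
      ∫ x, ψ x • 𝓕 f x := by
    intro ψ
    rw [← Lp.toTemperedDistribution_apply, ← Lp.fourier_toTemperedDistribution_eq]
    rw [TemperedDistribution.fourier_apply, Lp.toTemperedDistribution_apply]
    have e1 : ∫ x, (𝓕 ψ) x • (hf.toLp f) x = ∫ x, 𝓕 (ψ : E3 → ℂ) x * f x := by
      refine integral_congr_ae ?_
      filter_upwards [hf.coeFn_toLp] with x hx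
      rw [hx, SchwartzMap.fourier_coe, smul_eq_mul]
    rw [e1, integral_fourier_mul _ _ ψ.integrable hf1]
    rfl
  have hc : Continuous (𝓕 f) := VectorFourier.fourierIntegral_continuous Real.continuous_fourierChar
    continuous_inner hf1
  refine ae_eq_of_integral_contDiff_smul_eq ((Lp.memLp _).locallyIntegrable (by norm_num))
    hc.locallyIntegrable fun g hg hgs => ?_
  have hg₁ : HasCompactSupport (Complex.ofRealCLM ∘ g) := hgs.comp_left rfl
  have hg₂ : ContDiff ℝ ∞ (Complex.ofRealCLM ∘ g) := by fun_prop
  have := hmain (hg₁.toSchwartzMap hg₂)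
  simpa using this

theorem integral_sin_triangle {S k : ℝ} (hS : 0 < S) (hk : 0 < k) :
    ∫ r in (0 : ℝ)..S, (1 - r / S) * Real.sin (k * r) = (k * S - Real.sin (k * S)) / (k ^ 2 * S) := by
  have hd : ∀ r ∈ Set.uIcc 0 S, HasDerivAt
      (fun r : ℝ => -((1 - r / S) * Real.cos (k * r)) / k - Real.sin (k * r) / (k ^ 2 * S))
      ((1 - r / S) * Real.sin (k * r)) r := fun r _ => by
    have hs : HasDerivAt (fun s : ℝ => Real.sin (k * s)) (Real.cos (k * r) * k) r := by
      simpa using ((hasDerivAt_id r).const_mul k).sin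
    have hc : HasDerivAt (fun s : ℝ => Real.cos (k * s)) (-Real.sin (k * r) * k) r := by
      simpa using ((hasDerivAt_id r).const_mul k).cos
    have hl : HasDerivAt (fun s : ℝ => 1 - s / S) (-(1 / S)) r := by
      simpa using ((hasDerivAt_id r).div_const S).const_sub 1
    refine (((hl.mul hc).neg.div_const k).sub (hs.div_const (k ^ 2 * S))).congr_deriv ?_
    field_simp
    ring
  rw [intervalIntegral.integral_eq_sub_of_hasDerivAt hd
    (Continuous.intervalIntegrable (by fun_prop) _ _)]
  field_simp
  simp
  ring

/-- The triangle profile `r ↦ (1 - r / S)₊`. -/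
def triangle (S r : ℝ) : ℂ := ((max 0 (1 - r / S) : ℝ) : ℂ)

theorem continuous_triangle (S : ℝ) : Continuous (triangle S) := by unfold triangle; fun_prop

theorem triangle_eq_zero {S : ℝ} (hS : 0 < S) (r : ℝ) (hr : S ≤ r) : triangle S r = 0 := by
  have : 1 ≤ r / S := (one_le_div hS).2 hr
  rw [triangle, max_eq_left (by linarith), Complex.ofReal_zero]

theorem triangle_eq {S r : ℝ} (hS : 0 < S) (hr : r ≤ S) : triangle S r = ((1 - r / S : ℝ) : ℂ) := by
  have : r / S ≤ 1 := (div_le_one hS).2 hr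
  rw [triangle, max_eq_right (by linarith)]

/-- The sine integral of the triangle is (kS - sin kS)/(k²S), positive because sin x < x for x > 0.
-/
theorem exists_fourier_triangle {S : ℝ} (hS : 0 < S) {ξ : E3} (hξ : ξ ≠ 0) :
    ∃ m : ℝ, 0 < m ∧ 𝓕 (radialKernel (triangle S)) ξ = m := by
  have hk : 0 < 2 * Real.pi * ‖ξ‖ := by
    have := norm_pos_iff.2 hξ
    positivity
  have h := mul_fourier_radialKernel hS.le (continuous_triangle S) (triangle_eq_zero hS) ξ
  have h2 : ∫ r in (0 : ℝ)..S, triangle S r * (Real.sin (2 * Real.pi * ‖ξ‖ * r) : ℂ) =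
      ((∫ r in (0 : ℝ)..S, (1 - r / S) * Real.sin (2 * Real.pi * ‖ξ‖ * r) : ℝ) : ℂ) := by
    rw [← intervalIntegral.integral_ofReal]
    refine intervalIntegral.integral_congr fun r hr => ?_
    rw [Set.uIcc_of_le hS.le] at hr
    simp only [triangle_eq hS hr.2]
    push_cast
    ring
  rw [h2, integral_sin_triangle hS hk] at h
  set k := 2 * Real.pi * ‖ξ‖
  refine ⟨(k * S - Real.sin (k * S)) / (k ^ 2 * S) / k, ?_, ?_⟩
  · have := Real.sin_lt (mul_pos hk hS)
    have : 0 < k * S - Real.sin (k * S) := by linarith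
    positivity
  · have : (k : ℂ) ≠ 0 := Complex.ofReal_ne_zero.2 hk.ne'
    rw [Complex.ofReal_div, ← h]
    field_simp

section

variable {D : Set E3} [IsFiniteMeasure (volume.restrict D)]

theorem inner_convCLM_triangle (hDm : MeasurableSet D) {R : ℝ}
    (hDR : D ⊆ Metric.closedBall 0 R) {S : ℝ} (hS : 0 < S) (f : L2 D) :
    Integrable (fun ξ => conj (𝓕 (D.indicator f) ξ) *
      (𝓕 (D.indicator f) ξ * 𝓕 (radialKernel (triangle S)) ξ)) ∧
    inner ℂ f (convCLM D (radialKernel (triangle S))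
      (memLp_radialKernel (continuous_triangle S) (triangle_eq_zero hS)) f) =
    ∫ ξ, conj (𝓕 (D.indicator f) ξ) * (𝓕 (D.indicator f) ξ * 𝓕 (radialKernel (triangle S)) ξ) := by
  obtain ⟨hq, -⟩ := exists_memLp_convOn_radialKernel hDR (continuous_triangle S)
    (triangle_eq_zero hS) f
  have hi := integrable_convOn_radialKernel hDm (continuous_triangle S) (triangle_eq_zero hS) f
  have h1 := Lp.inner_fourier_eq ((memLp_indicator hDm f).toLp _) (hq.toLp _)
  rw [L2.inner_def, L2.inner_def] at h1
  have h4 : (fun ξ => inner ℂ ((𝓕 ((memLp_indicator hDm f).toLp _) :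
      Lp ℂ 2 (volume : Measure E3)) ξ) ((𝓕 (hq.toLp _) : Lp ℂ 2 (volume : Measure E3)) ξ)) =ᵐ[volume]
      fun ξ => conj (𝓕 (D.indicator f) ξ) *
      (𝓕 (D.indicator f) ξ * 𝓕 (radialKernel (triangle S)) ξ) := by
    filter_upwards [fourier_toLp_ae (memLp_indicator hDm f) (integrable_indicator_L2 hDm f),
      fourier_toLp_ae hq hi] with ξ h2 h3
    rw [h2, h3, fourier_convOn hDm (continuous_triangle S) (triangle_eq_zero hS)]
    simp [mul_comm]
  refine ⟨(integrable_congr h4).1 (L2.integrable_inner _ _), ?_⟩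
  rw [inner_convCLM, ← integral_indicator hDm]
  refine Eq.trans (integral_congr_ae ?_) (h1.symm.trans (integral_congr_ae h4))
  filter_upwards [(memLp_indicator hDm f).coeFn_toLp, hq.coeFn_toLp] with x hx hx'
  rw [hx, hx']
  by_cases hxD : x ∈ D <;> simp [hxD, mul_comm]

/-- By Plancherel the form is the integral of the squared modulus of the transform of f, extended by
zero, against an a.e. positive weight. If it vanished, so would that transform, and with it f. -/
theorem re_inner_convCLM_triangle_pos (hDm : MeasurableSet D) {R : ℝ}
    (hDR : D ⊆ Metric.closedBall 0 R) {S : ℝ} (hS : 0 < S) {f : L2 D} (hf : f ≠ 0) :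
    0 < (inner ℂ f (convCLM D (radialKernel (triangle S))
      (memLp_radialKernel (continuous_triangle S) (triangle_eq_zero hS)) f)).re := by
  obtain ⟨hi, he⟩ := inner_convCLM_triangle hDm hDR hS f
  have hne : ∀ᵐ ξ : E3, ξ ≠ 0 := by
    simp [ae_iff]
  have hre : ∀ᵐ ξ : E3, (conj (𝓕 (D.indicator f) ξ) * (𝓕 (D.indicator f) ξ *
      𝓕 (radialKernel (triangle S)) ξ)).re =
      ‖𝓕 (D.indicator f) ξ‖ ^ 2 * (𝓕 (radialKernel (triangle S)) ξ).re := by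
    refine ae_of_all _ fun ξ => ?_
    rw [← mul_assoc, mul_comm (conj _), Complex.mul_conj, Complex.re_ofReal_mul,
      Complex.normSq_eq_norm_sq]
  have hpos : ∀ᵐ ξ : E3, 0 < (𝓕 (radialKernel (triangle S)) ξ).re := by
    filter_upwards [hne] with ξ hξ
    obtain ⟨m, hm, h⟩ := exists_fourier_triangle hS hξ
    rwa [h, Complex.ofReal_re]
  have hnn : 0 ≤ᵐ[volume] fun ξ => (conj (𝓕 (D.indicator f) ξ) * (𝓕 (D.indicator f) ξ *
      𝓕 (radialKernel (triangle S)) ξ)).re := by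
    filter_upwards [hre, hpos] with ξ h1 h2
    rw [h1]
    exact mul_nonneg (sq_nonneg _) h2.le
  have hint : (∫ ξ, conj (𝓕 (D.indicator f) ξ) * (𝓕 (D.indicator f) ξ *
      𝓕 (radialKernel (triangle S)) ξ)).re = ∫ ξ, (conj (𝓕 (D.indicator f) ξ) *
      (𝓕 (D.indicator f) ξ * 𝓕 (radialKernel (triangle S)) ξ)).re :=
    (integral_re hi).symm
  rw [he, hint]
  refine lt_of_le_of_ne (integral_nonneg_of_ae hnn) fun h0 => hf ?_
  have h1 := (integral_eq_zero_iff_of_nonneg_ae hnn hi.re).1 h0.symm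
  have h2 : (𝓕 ((memLp_indicator hDm f).toLp _) : Lp ℂ 2 (volume : Measure E3)) = 0 := by
    refine Lp.ext ?_
    filter_upwards [fourier_toLp_ae (memLp_indicator hDm f) (integrable_indicator_L2 hDm f), h1,
      hre, hpos, Lp.coeFn_zero ℂ 2 (volume : Measure E3)] with ξ h3 h4 h5 h6 h7
    rw [h3, h7]
    rw [h5] at h4
    rcases mul_eq_zero.1 h4 with h8 | h8
    · simpa using h8
    · exact absurd h8 h6.ne'
  rw [← norm_eq_zero, ← norm_toLp_indicator hDm f, ← Lp.norm_fourier_eq, h2, norm_zero]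

/-- On D all distances are at most S, and 1/(4πr) = (1 - r/S)/(4πr) + 1/(4πS). The first kernel is
strictly positive definite; the constant one contributes |∫ f|²/(4πS) ≥ 0. -/
theorem re_inner_potentialCLM_pos (hDm : MeasurableSet D) {R : ℝ}
    (hDR : D ⊆ Metric.closedBall 0 R) {f : L2 D} (hf : f ≠ 0) :
    0 < (inner ℂ f (potentialCLM D R 0 f)).re := by
  set S : ℝ := 2 * |R| + 1 with hS'
  have hS : 0 < S := by positivity
  have hne : ∀ y : E3, ∀ᵐ x ∂volume.restrict D, x ≠ y := fun y => by
    refine ae_restrict_of_ae ?_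
    simp [ae_iff]
  have hker : ∀ x ∈ D, convOn D (helmholtzKernel R 0) f x = convOn D (radialKernel (triangle S)) f x
      + (∫ y in D, f y) / (4 * Real.pi * S) := fun x hx => by
    have hfi : Integrable f (volume.restrict D) := (Lp.memLp f).integrable (by norm_num)
    rw [← integral_div, convOn, convOn, ← integral_add (integrable_convOn D (memLp_radialKernel
      (continuous_triangle S) (triangle_eq_zero hS)) (Lp.memLp f) x) (hfi.div_const _)]
    refine integral_congr_ae ?_
    filter_upwards [hne x, ae_restrict_mem hDm] with y hyx hy
    have h1 : ‖x - y‖ ≤ S := by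
      have hx' := mem_closedBall_zero_iff.1 (hDR hx)
      have hy' := mem_closedBall_zero_iff.1 (hDR hy)
      have := norm_sub_le x y
      have := le_abs_self R
      rw [hS']
      linarith
    have h2 : cutoffBump R ‖x - y‖ = 1 := by
      refine (cutoffBump R).one_of_mem_closedBall ?_
      rw [mem_closedBall_zero_iff, norm_norm]
      exact h1
    have h3 : (‖x - y‖ : ℂ) ≠ 0 := by
      rw [Complex.ofReal_ne_zero, norm_ne_zero_iff, sub_ne_zero]
      exact hyx.symm
    have h4 : (S : ℂ) ≠ 0 := Complex.ofReal_ne_zero.2 hS.ne'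
    have h5 : (Real.pi : ℂ) ≠ 0 := Complex.ofReal_ne_zero.2 Real.pi_ne_zero
    simp only [helmholtzKernel, radialKernel, helmholtzProfile, h2, triangle_eq hS h1]
    push_cast
    simp only [mul_zero, zero_mul, Complex.exp_zero]
    field_simp
    ring
  have hconj : ∫ x in D, conj (f x) = conj (∫ x in D, f x) := integral_conj
  have hci : Integrable (fun x => conj (f x)) (volume.restrict D) :=
    (Lp.memLp f).star.integrable (by norm_num)
  have key : inner ℂ f (potentialCLM D R 0 f) = inner ℂ f (convCLM D (radialKernel (triangle S))
      (memLp_radialKernel (continuous_triangle S) (triangle_eq_zero hS)) f) +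
      ((‖∫ x in D, f x‖ ^ 2 / (4 * Real.pi * S) : ℝ) : ℂ) := by
    have e : ((‖∫ x in D, f x‖ ^ 2 / (4 * Real.pi * S) : ℝ) : ℂ) =
        ∫ x in D, conj (f x) * ((∫ y in D, f y) / (4 * Real.pi * S)) := by
      rw [integral_mul_const, hconj]
      push_cast
      rw [← Complex.conj_mul', mul_div_assoc]
    rw [e, potentialCLM, inner_convCLM, inner_convCLM, ← integral_add]
    · refine setIntegral_congr_fun hDm fun x hx => ?_
      simp only [hker x hx]
      ring
    · exact (Lp.memLp f).star.integrable_mul (memLp_convOn (memLp_radialKernel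
        (continuous_triangle S) (triangle_eq_zero hS)) f 2)
    · exact hci.mul_const _
  rw [key, Complex.add_re, Complex.ofReal_re]
  have := re_inner_convCLM_triangle_pos hDm hDR hS hf
  positivity

end

/-! ### Eigenfunctions of the Newtonian potential -/

/-- For symmetric T the norm is the supremum of |Rayleigh quotients|, and positivity removes the
absolute value. If ‖T‖ were in the resolvent set, the quotients would stay below ‖T‖ - ε; so, T
being compact, ‖T‖ is an eigenvalue. -/
theorem hasEigenvalue_norm {H : Type*} [NormedAddCommGroup H] [InnerProductSpace ℂ H]
    [CompleteSpace H] [Nontrivial H] {T : H →L[ℂ] H} (hT : IsCompactOperator T)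
    (hs : (T : H →ₗ[ℂ] H).IsSymmetric) (hp : ∀ f, f ≠ 0 → 0 < (inner ℂ f (T f)).re) :
    0 < ‖T‖ ∧ ∃ f : H, f ≠ 0 ∧ T f = (‖T‖ : ℂ) • f := by
  have hpos : 0 < ‖T‖ := by
    obtain ⟨f, hf⟩ := exists_ne (0 : H)
    refine norm_pos_iff.2 fun h0 => ?_
    have := hp f hf
    simp [h0] at this
  refine ⟨hpos, ?_⟩
  have hne : ((‖T‖ : ℝ) : ℂ) ≠ 0 := Complex.ofReal_ne_zero.2 hpos.ne'
  rcases hT.hasEigenvalue_or_mem_resolventSet hne with h | h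
  · obtain ⟨f, hf⟩ := h.exists_hasEigenvector
    exact ⟨f, hf.2, hf.apply_eq_smul⟩
  · obtain ⟨ε, hε, hle⟩ := T.rayleighQuotient_le_of_norm_mem_resolventSet (𝕜 := ℂ) h
    have h1 := T.norm_eq_iSup_rayleighQuotient hs
    have h2 : ⨆ x, |T.rayleighQuotient x| ≤ ‖T‖ - ε := by
      refine ciSup_le fun x => ?_
      rw [abs_of_nonneg]
      · exact hle x
      · refine div_nonneg ?_ (sq_nonneg _)
        rw [ContinuousLinearMap.reApplyInnerSelf_apply]
        rcases eq_or_ne x 0 with rfl | hx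
        · simp
        · exact (hp x hx).le.trans_eq (congrArg Complex.re (hs x x).symm)
    linarith

theorem newtonPotential_eq (D : Set E3) (f : E3 → ℂ) (x : E3) :
    newtonPotential D f x = volumePotential D 0 f x := by
  unfold newtonPotential volumePotential green
  simp

theorem newtonPotential_congr {D : Set E3} {f g : E3 → ℂ} (h : f =ᵐ[volume.restrict D] g) (x : E3) :
    newtonPotential D f x = newtonPotential D g x := by
  refine integral_congr_ae ?_
  filter_upwards [h] with y hy
  rw [hy]

/-- Change of variables y ↦ R y in D, since |R x - R y| = |x - y|. -/
theorem volumePotential_comp_reflect {D : Set E3} (hD : IsReflectInvariant D) (ω : ℂ) (f : E3 → ℂ)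
    (x : E3) : volumePotential D ω (fun y => f (reflect y)) x = volumePotential D ω f (reflect x) := by
  rw [volumePotential, volumePotential,
    ← hD.setIntegral_comp (fun y => green ω (reflect x - y) * f y)]
  congr 1 with y
  simp only [green, norm_reflect_sub, reflect_reflect]

theorem norm_sq_eq_setIntegral {D : Set E3} (f : L2 D) : ‖f‖ ^ 2 = ∫ x in D, ‖f x‖ ^ 2 := by
  have h := inner_self_eq_norm_sq_to_K (𝕜 := ℂ) f
  rw [L2.inner_def] at h
  have h2 : ∫ x in D, inner ℂ (f x) (f x) = ((∫ x in D, ‖f x‖ ^ 2 : ℝ) : ℂ) := by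
    rw [← integral_complex_ofReal]
    congr 1 with x
    rw [inner_self_eq_norm_sq_to_K]
    simp
  rw [h2] at h
  have h3 : ((∫ x in D, ‖f x‖ ^ 2 : ℝ) : ℂ) = ((‖f‖ ^ 2 : ℝ) : ℂ) := by
    rw [h]
    simp
  exact (Complex.ofReal_injective h3).symm

theorem norm_toLp_sq {D : Set E3} {f : E3 → ℂ} (hf : MemLp f 2 (volume.restrict D)) :
    ‖hf.toLp f‖ ^ 2 = ∫ x in D, ‖f x‖ ^ 2 := by
  rw [norm_sq_eq_setIntegral]
  refine integral_congr_ae ?_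
  filter_upwards [hf.coeFn_toLp] with x hx
  rw [hx]

theorem IsNormalizedEigenfunction.congr {D : Set E3} {lam : ℝ} {φ ψ : E3 → ℂ}
    (h : IsNormalizedEigenfunction D lam φ) (he : φ =ᵐ[volume.restrict D] ψ) :
    IsNormalizedEigenfunction D lam ψ := by
  refine ⟨(memLp_congr_ae he).1 h.memLp, ?_, ?_⟩
  · rw [← h.norm_eq_one]
    refine integral_congr_ae ?_
    filter_upwards [he] with x hx
    rw [hx]
  · filter_upwards [h.eigen, he] with x h1 h2
    rw [← newtonPotential_congr he, h1, h2]

theorem IsNormalizedEigenfunction.comp_reflect {D : Set E3} (hD : IsReflectInvariant D) {lam : ℝ}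
    {φ : E3 → ℂ} (h : IsNormalizedEigenfunction D lam φ) :
    IsNormalizedEigenfunction D lam fun x => φ (reflect x) := by
  refine ⟨h.memLp.comp_measurePreserving hD.measurePreserving, ?_, ?_⟩
  · rw [← h.norm_eq_one]
    exact hD.measurePreserving.integral_comp measurableEmbedding_reflect fun x => ‖φ x‖ ^ 2
  · filter_upwards [hD.ae_comp h.eigen] with x hx
    rw [newtonPotential_eq, volumePotential_comp_reflect hD, ← newtonPotential_eq, hx]

theorem IsNormalizedEigenfunction.not_ae_zero {D : Set E3} {lam : ℝ} {φ : E3 → ℂ}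
    (h : IsNormalizedEigenfunction D lam φ) : ¬ φ =ᵐ[volume.restrict D] fun _ => (0 : ℂ) := fun h0 => by
  have h1 : ∫ x in D, ‖φ x‖ ^ 2 = ∫ x in D, (0 : ℝ) := by
    refine integral_congr_ae ?_
    filter_upwards [h0] with x hx
    simp [hx]
  rw [h.norm_eq_one] at h1
  simp at h1

/-- A function whose reflection is a multiple of itself is even or odd. -/
theorem IsReflectInvariant.eq_one_or_eq_neg_one {D : Set E3} (hD : IsReflectInvariant D)
    {u : E3 → ℂ} {c : ℂ} (hu : ¬ u =ᵐ[volume.restrict D] fun _ => (0 : ℂ))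
    (h : (fun x => u (reflect x)) =ᵐ[volume.restrict D] fun x => c * u x) : c = 1 ∨ c = -1 := by
  by_contra! hc
  refine hu ?_
  filter_upwards [h, hD.ae_comp h] with x hx hx'
  rw [reflect_reflect, hx] at hx'
  -- Reflecting twice gives u = c² u almost everywhere.
  have h1 : (c - 1) * (c + 1) * u x = 0 := by linear_combination -hx'
  have h2 : c + 1 ≠ 0 := fun h3 => hc.2 (eq_neg_of_add_eq_zero_left h3)
  exact (mul_eq_zero.1 h1).resolve_left (mul_ne_zero (sub_ne_zero.2 hc.1) h2)

theorem isEvenOn_or_isOddOn {D : Set E3} (hD : IsReflectInvariant D) {lam : ℝ} {φ : E3 → ℂ}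
    (hs : IsSimpleEigenvalue D lam) (h : IsNormalizedEigenfunction D lam φ) :
    IsEvenOn D φ ∨ IsOddOn D φ := by
  obtain ⟨c, hc⟩ := hs.2 _ _ h (h.comp_reflect hD)
  rcases hD.eq_one_or_eq_neg_one h.not_ae_zero hc with rfl | rfl
  · exact Or.inl (by simpa [IsEvenOn] using hc)
  · exact Or.inr (by simpa [IsOddOn] using hc)

theorem IsNormalizedEigenfunction.norm_toLp {D : Set E3} {lam : ℝ} {φ : E3 → ℂ}
    (h : IsNormalizedEigenfunction D lam φ) : ‖h.memLp.toLp φ‖ = 1 := by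
  have := norm_toLp_sq h.memLp
  rw [h.norm_eq_one] at this
  nlinarith [norm_nonneg (h.memLp.toLp φ)]

/-- The modulus of an element of `L²(D)`. -/
def modulus {D : Set E3} (f : L2 D) : L2 D :=
  MemLp.toLp (fun x => ((‖f x‖ : ℝ) : ℂ)) (Lp.memLp f).norm.ofReal

theorem modulus_ae {D : Set E3} (f : L2 D) : modulus f =ᵐ[volume.restrict D] fun x => ((‖f x‖ : ℝ) : ℂ) :=
  MemLp.coeFn_toLp _

theorem norm_modulus {D : Set E3} (f : L2 D) : ‖modulus f‖ = ‖f‖ := by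
  rw [modulus, Lp.norm_toLp, Lp.norm_def]
  congr 1
  exact eLpNorm_congr_norm_ae (ae_of_all _ fun x => by simp)

/-- The kernel of the Newtonian potential. -/
def newtonKernel (x : E3) : ℝ := 1 / (4 * Real.pi * ‖x‖)

theorem newtonKernel_nonneg (x : E3) : 0 ≤ newtonKernel x := by unfold newtonKernel; positivity

theorem ae_newtonKernel_pos (D : Set E3) (x : E3) :
    ∀ᵐ y ∂volume.restrict D, 0 < newtonKernel (x - y) := by
  have : ∀ᵐ y ∂volume.restrict D, y ≠ x := ae_restrict_of_ae (by simp [ae_iff])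
  filter_upwards [this] with y hy
  have : 0 < ‖x - y‖ := norm_pos_iff.2 (sub_ne_zero.2 hy.symm)
  unfold newtonKernel
  positivity

theorem helmholtzKernel_zero_eq {D : Set E3} {R : ℝ} (hDR : D ⊆ Metric.closedBall 0 R) {x y : E3} (hx : x ∈ D)
    (hy : y ∈ D) : helmholtzKernel R 0 (x - y) = (newtonKernel (x - y) : ℂ) := by
  have h1 : ‖x - y‖ ≤ 2 * |R| + 1 := by
    have hx' := mem_closedBall_zero_iff.1 (hDR hx)
    have hy' := mem_closedBall_zero_iff.1 (hDR hy)
    have := norm_sub_le x y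
    have := le_abs_self R
    linarith
  have h2 : cutoffBump R ‖x - y‖ = 1 := by
    refine (cutoffBump R).one_of_mem_closedBall ?_
    rw [mem_closedBall_zero_iff, norm_norm]
    exact h1
  simp [helmholtzKernel, radialKernel, helmholtzProfile, h2, newtonKernel]

theorem newtonPotential_modulus {D : Set E3} (f : L2 D) (x : E3) : newtonPotential D (modulus f) x =
    ((∫ y in D, ‖(newtonKernel (x - y) : ℂ) * f y‖ : ℝ) : ℂ) := by
  rw [newtonPotential_congr (modulus_ae f), newtonPotential, ← integral_complex_ofReal]
  congr 1 with y
  rw [norm_mul, Complex.norm_real, Real.norm_of_nonneg (newtonKernel_nonneg _), Complex.ofReal_mul]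
  rfl

theorem norm_newtonPotential_le {D : Set E3} (f : L2 D) (x : E3) :
    ‖newtonPotential D f x‖ ≤ ∫ y in D, ‖(newtonKernel (x - y) : ℂ) * f y‖ :=
  norm_integral_le_integral_norm _

theorem integrable_newtonKernel_mul {D : Set E3} {R : ℝ} (hDR : D ⊆ Metric.closedBall 0 R) (hDm : MeasurableSet D)
    (f : L2 D) {x : E3} (hx : x ∈ D) :
    Integrable (fun y => (newtonKernel (x - y) : ℂ) * f y) (volume.restrict D) := by
  refine (integrable_congr ?_).1 (integrable_convOn D (memLp_helmholtzKernel R 0) (Lp.memLp f) x)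
  filter_upwards [ae_restrict_mem hDm] with y hy
  rw [helmholtzKernel_zero_eq hDR hx hy]

/-! ### The operator form of the eigenvalue problem for the Newtonian potential. -/

section

variable {D : Set E3} [IsFiniteMeasure (volume.restrict D)] {R : ℝ}

theorem isSymmetric_potentialCLM_zero (D : Set E3) [IsFiniteMeasure (volume.restrict D)] (R : ℝ) :
    (potentialCLM D R 0 : L2 D →ₗ[ℂ] L2 D).IsSymmetric := by
  refine fun u f => isSymmetric_convCLM (memLp_helmholtzKernel R 0) (fun x => ?_) u f
  simp [helmholtzKernel, radialKernel, helmholtzProfile, map_ofNat]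

theorem potentialCLM_zero_ae (hDR : D ⊆ Metric.closedBall 0 R) (hDm : MeasurableSet D)
    (f : L2 D) : potentialCLM D R 0 f =ᵐ[volume.restrict D] newtonPotential D f := by
  rw [funext (newtonPotential_eq D f)]
  exact potentialCLM_ae hDR hDm 0 f

theorem IsNormalizedEigenfunction.apply_toLp (hDR : D ⊆ Metric.closedBall 0 R)
    (hDm : MeasurableSet D) {lam : ℝ} {φ : E3 → ℂ} (h : IsNormalizedEigenfunction D lam φ) :
    potentialCLM D R 0 (h.memLp.toLp φ) = (lam : ℂ) • h.memLp.toLp φ := by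
  refine Lp.ext ?_
  filter_upwards [potentialCLM_zero_ae hDR hDm (h.memLp.toLp φ), h.memLp.coeFn_toLp, h.eigen,
    Lp.coeFn_smul (lam : ℂ) (h.memLp.toLp φ)] with x h1 h2 h3 h4
  rw [h1, h4, newtonPotential_congr h.memLp.coeFn_toLp, h3, Pi.smul_apply, h2, smul_eq_mul]

theorem isNormalizedEigenfunction_of_apply (hDR : D ⊆ Metric.closedBall 0 R)
    (hDm : MeasurableSet D) {lam : ℝ} {f : L2 D} (hn : ‖f‖ = 1)
    (h : potentialCLM D R 0 f = (lam : ℂ) • f) : IsNormalizedEigenfunction D lam f := by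
  refine ⟨Lp.memLp f, ?_, ?_⟩
  · rw [← norm_sq_eq_setIntegral, hn, one_pow]
  · filter_upwards [potentialCLM_zero_ae hDR hDm f, Lp.coeFn_smul (lam : ℂ) f] with x h1 h2
    rw [← h1, h, h2, Pi.smul_apply, smul_eq_mul]

theorem IsNormalizedEigenfunction.pos (hDR : D ⊆ Metric.closedBall 0 R)
    (hDm : MeasurableSet D) {lam : ℝ} {φ : E3 → ℂ} (h : IsNormalizedEigenfunction D lam φ) :
    0 < lam := by
  have hn := h.norm_toLp
  have h1 := re_inner_potentialCLM_pos hDm hDR (f := h.memLp.toLp φ) (fun h0 => by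
    rw [h0, norm_zero] at hn
    exact zero_ne_one hn)
  rw [h.apply_toLp hDR hDm, inner_smul_right, inner_self_eq_norm_sq_to_K, hn] at h1
  simpa using h1

theorem IsNormalizedEigenfunction.le_norm (hDR : D ⊆ Metric.closedBall 0 R)
    (hDm : MeasurableSet D) {lam : ℝ} {φ : E3 → ℂ} (h : IsNormalizedEigenfunction D lam φ) :
    lam ≤ ‖potentialCLM D R 0‖ := by
  have h1 := (potentialCLM D R 0).le_opNorm (h.memLp.toLp φ)
  rw [h.apply_toLp hDR hDm, norm_smul, h.norm_toLp, mul_one, mul_one, Complex.norm_real] at h1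
  exact (le_abs_self lam).trans h1

end

/-! ### The ground state -/

/-- Equality case of the triangle inequality: after rotating by the phase of the integral, the
nonnegative function ‖f‖ - Re(e f) has integral zero. -/
theorem exists_phase_of_norm_integral_eq {f : E3 → ℂ} {μ : Measure E3} (hf : Integrable f μ)
    (h : ‖∫ x, f x ∂μ‖ = ∫ x, ‖f x‖ ∂μ) : ∃ e : ℂ, ∀ᵐ x ∂μ, (e * f x).re = ‖f x‖ := by
  set z := ∫ x, f x ∂μ with hz
  -- If z = 0 the quotient is 0 by convention; the claim is then that f vanishes a.e., which the
  -- hypothesis gives.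
  refine ⟨conj z / ‖z‖, ?_⟩
  set e : ℂ := conj z / ‖z‖ with he
  have hez : (e * z).re = ‖z‖ := by
    rw [he, div_mul_eq_mul_div, Complex.conj_mul', ← Complex.ofReal_pow, ← Complex.ofReal_div,
      Complex.ofReal_re, sq, mul_self_div_self]
  have he1 : ‖e‖ ≤ 1 := by
    rw [he, norm_div, Complex.norm_conj, Complex.norm_real, norm_norm]
    exact div_self_le_one _
  have hle : ∀ x, (e * f x).re ≤ ‖f x‖ := fun x => by
    refine (Complex.re_le_norm _).trans ?_
    rw [norm_mul]
    exact mul_le_of_le_one_left (norm_nonneg _) he1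
  have h1 : ∫ x, (‖f x‖ - (e * f x).re) ∂μ = 0 := by
    have h2 : ∫ x, (e * f x).re ∂μ = (e * z).re := by
      rw [hz, ← integral_const_mul]
      exact integral_re (hf.const_mul e)
    have h3 : Integrable (fun x => (e * f x).re) μ := (hf.const_mul e).re
    rw [integral_sub hf.norm h3, ← h, h2, hez, sub_self]
  have h2 := (integral_eq_zero_iff_of_nonneg (fun x => sub_nonneg.2 (hle x))
    (hf.norm.sub (hf.const_mul e).re)).1 h1
  filter_upwards [h2] with x hx
  exact (sub_eq_zero.1 hx).symm

section

variable {D : Set E3} [IsFiniteMeasure (volume.restrict D)] {R : ℝ}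

theorem ae_norm_le_potentialCLM_modulus (hDR : D ⊆ Metric.closedBall 0 R) (hDm : MeasurableSet D)
    {f : L2 D} {lam : ℝ} (hl : 0 ≤ lam) (hf : potentialCLM D R 0 f = (lam : ℂ) • f) :
    ∀ᵐ x ∂volume.restrict D, ∃ r : ℝ, potentialCLM D R 0 (modulus f) x = r ∧ lam * ‖f x‖ ≤ r := by
  filter_upwards [potentialCLM_zero_ae hDR hDm f, potentialCLM_zero_ae hDR hDm (modulus f),
    Lp.coeFn_smul (lam : ℂ) f] with x h1 h2 h3
  refine ⟨_, h2.trans (newtonPotential_modulus f x), ?_⟩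
  refine le_trans (le_of_eq ?_) (norm_newtonPotential_le f x)
  rw [← h1, hf, h3, Pi.smul_apply, norm_smul, Complex.norm_real, Real.norm_of_nonneg hl]

/-- The modulus of an eigenfunction for the largest eigenvalue is again an eigenfunction. -/
theorem potentialCLM_modulus (hDR : D ⊆ Metric.closedBall 0 R) (hDm : MeasurableSet D) {f : L2 D}
    (hf : potentialCLM D R 0 f = (‖potentialCLM D R 0‖ : ℂ) • f) :
    potentialCLM D R 0 (modulus f) = (‖potentialCLM D R 0‖ : ℂ) • modulus f := by
  set K := potentialCLM D R 0
  set lam := ‖K‖ with hlam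
  have hl : 0 ≤ lam := norm_nonneg _
  -- Positivity of the kernel gives λ|f| = |Kf| ≤ K|f| pointwise; pair this with |f|.
  have hge : lam * ‖f‖ ^ 2 ≤ (inner ℂ (modulus f) (K (modulus f))).re := by
    have hi := L2.integrable_inner (𝕜 := ℂ) (modulus f) (K (modulus f))
    rw [L2.inner_def, norm_sq_eq_setIntegral, ← integral_const_mul]
    refine le_trans ?_ (le_of_eq (integral_re hi))
    refine integral_mono_ae ?_ hi.re ?_
    · exact ((Lp.memLp f).integrable_norm_pow (by norm_num)).const_mul _
    · filter_upwards [ae_norm_le_potentialCLM_modulus hDR hDm hl hf, modulus_ae f] with x hx hm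
      obtain ⟨r, hr, hle⟩ := hx
      have e : inner ℂ (modulus f x) (K (modulus f) x) = ((‖f x‖ * r : ℝ) : ℂ) := by
        rw [hr, hm]
        simp [mul_comm]
      simp only [e]
      show _ ≤ ‖f x‖ * r
      nlinarith [norm_nonneg (f x)]
  have hn : ‖K (modulus f)‖ ≤ lam * ‖f‖ := by
    have := K.le_opNorm (modulus f)
    rwa [norm_modulus] at this
  -- Expanding the square gives at most λ²‖f‖² - 2λ²‖f‖² + λ²‖f‖² = 0.
  have hsq : ‖K (modulus f) - (lam : ℂ) • modulus f‖ ^ 2 ≤ 0 := by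
    rw [@norm_sub_sq ℂ, inner_smul_right, norm_smul, norm_modulus, Complex.norm_real,
      Real.norm_of_nonneg hl, ← inner_conj_symm]
    have e : RCLike.re ((lam : ℂ) * (starRingEnd ℂ) (inner ℂ (modulus f) (K (modulus f)))) =
        lam * (inner ℂ (modulus f) (K (modulus f))).re := by
      rw [show RCLike.re ((lam : ℂ) * (starRingEnd ℂ) (inner ℂ (modulus f) (K (modulus f)))) =
        ((lam : ℂ) * (starRingEnd ℂ) (inner ℂ (modulus f) (K (modulus f)))).re from rfl,
        Complex.re_ofReal_mul, Complex.conj_re]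
    rw [e]
    have h1 := mul_le_mul_of_nonneg_left hge hl
    have h2 : ‖K (modulus f)‖ ^ 2 ≤ (lam * ‖f‖) ^ 2 := pow_le_pow_left₀ (norm_nonneg _) hn 2
    nlinarith
  have h0 : ‖K (modulus f) - (lam : ℂ) • modulus f‖ = 0 := by
    nlinarith [norm_nonneg (K (modulus f) - (lam : ℂ) • modulus f)]
  exact sub_eq_zero.1 (norm_eq_zero.1 h0)

/-- Both f and |f| are eigenfunctions, so |Kf| = K|f| almost everywhere. A single point x of D where
this holds suffices: the kernel seen from x is a.e. positive, so the equality case fixes the phase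
of f on all of D. -/
theorem exists_ae_phase (hDR : D ⊆ Metric.closedBall 0 R) (hDm : MeasurableSet D)
    (hD0 : volume D ≠ 0) {f : L2 D}
    (hf : potentialCLM D R 0 f = (‖potentialCLM D R 0‖ : ℂ) • f) :
    ∃ e : ℂ, ∀ᵐ x ∂volume.restrict D, (e * f x).re = ‖f x‖ := by
  have hex : ∃ x ∈ D, ‖newtonPotential D f x‖ = ∫ y in D, ‖(newtonKernel (x - y) : ℂ) * f y‖ := by
    have hae : ∀ᵐ x ∂volume.restrict D, x ∈ D ∧
        ‖newtonPotential D f x‖ = ∫ y in D, ‖(newtonKernel (x - y) : ℂ) * f y‖ := by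
      filter_upwards [ae_restrict_mem hDm, potentialCLM_zero_ae hDR hDm f,
        potentialCLM_zero_ae hDR hDm (modulus f), modulus_ae f,
        Lp.coeFn_smul (‖potentialCLM D R 0‖ : ℂ) f,
        Lp.coeFn_smul (‖potentialCLM D R 0‖ : ℂ) (modulus f)] with x hx h1 h2 h3 h4 h5
      refine ⟨hx, ?_⟩
      rw [potentialCLM_modulus hDR hDm hf, h5, Pi.smul_apply, h3, newtonPotential_modulus] at h2
      rw [← h1, hf, h4, Pi.smul_apply, norm_smul, Complex.norm_real, norm_norm]
      rw [smul_eq_mul, ← Complex.ofReal_mul] at h2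
      exact Complex.ofReal_injective h2
    have : NeZero (volume.restrict D) := ⟨by rwa [Ne, Measure.restrict_eq_zero]⟩
    exact hae.exists
  obtain ⟨x, hx, he⟩ := hex
  obtain ⟨e, h⟩ := exists_phase_of_norm_integral_eq (integrable_newtonKernel_mul hDR hDm f hx) he
  refine ⟨e, ?_⟩
  filter_upwards [h, ae_newtonKernel_pos D x] with y hy hk
  rw [norm_mul, Complex.norm_real, Real.norm_of_nonneg hk.le, mul_left_comm,
    Complex.re_ofReal_mul] at hy
  exact mul_left_cancel₀ hk.ne' hy

/-- The largest eigenvalue is simple, with a positive eigenfunction. -/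
theorem exists_ground_state (hDR : D ⊆ Metric.closedBall 0 R) (hDm : MeasurableSet D)
    (hDb : Bornology.IsBounded D) (hD0 : volume D ≠ 0) :
    IsGreatest {lam | IsEigenvalue D lam} ‖potentialCLM D R 0‖ ∧
      IsSimpleEigenvalue D ‖potentialCLM D R 0‖ ∧
      ∃ φ₀ : E3 → ℝ, Continuous φ₀ ∧
        IsNormalizedEigenfunction D ‖potentialCLM D R 0‖ (fun x => (φ₀ x : ℂ)) ∧
        ∀ x ∈ D, 0 < φ₀ x := by
  set K := potentialCLM D R 0 with hK
  have hnt : Nontrivial (L2 D) := by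
    have hc : MemLp (fun _ : E3 => (1 : ℂ)) 2 (volume.restrict D) := memLp_const 1
    refine ⟨hc.toLp _, 0, fun h => hD0 ?_⟩
    by_contra hD1
    have : NeZero (volume.restrict D) := ⟨by rwa [Ne, Measure.restrict_eq_zero]⟩
    have h1 : ∀ᵐ x ∂volume.restrict D, (1 : ℂ) = 0 := by
      filter_upwards [hc.coeFn_toLp, Lp.coeFn_zero ℂ 2 (volume.restrict D)] with x h2 h3
      rw [← h2, h, h3]
      rfl
    exact one_ne_zero h1.exists.choose_spec
  obtain ⟨hpos, f, hf0, hf⟩ := hasEigenvalue_norm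
    (isCompactOperator_convCLM hDb hDm (memLp_helmholtzKernel R 0))
    (isSymmetric_potentialCLM_zero D R) (fun f hf => re_inner_potentialCLM_pos hDm hDR hf)
  rw [← potentialCLM, ← hK] at hpos hf
  set lam := ‖K‖ with hlam
  obtain ⟨g, hg1, hg⟩ : ∃ g : L2 D, ‖g‖ = 1 ∧ K g = (lam : ℂ) • g := by
    refine ⟨((‖f‖⁻¹ : ℝ) : ℂ) • f, ?_, ?_⟩
    · rw [norm_smul, Complex.norm_real, norm_inv, norm_norm, inv_mul_cancel₀ (norm_ne_zero_iff.2 hf0)]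
    · rw [map_smul, hf, smul_comm]
  have hm := potentialCLM_modulus hDR hDm hg
  have hm1 : ‖modulus g‖ = 1 := by rw [norm_modulus, hg1]
  have hE := isNormalizedEigenfunction_of_apply hDR hDm hm1 hm
  -- The eigenvalue equation singles out a representative of the class: a potential divided by λ,
  -- continuous on all of ℝ³ and hence on the closure of D.
  let φ₀ : E3 → ℝ := fun x => lam⁻¹ * (convOn D (helmholtzKernel R 0) (modulus g) x).re
  have hφc : Continuous φ₀ := continuous_const.mul
    (Complex.continuous_re.comp (continuous_convOn D (memLp_helmholtzKernel R 0) (modulus g)))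
  have hφD : ∀ x ∈ D, φ₀ x = lam⁻¹ * ∫ y in D, ‖(newtonKernel (x - y) : ℂ) * g y‖ := fun x hx => by
    simp only [φ₀]
    rw [← volumePotential_eq_convOn hDR hDm 0 _ hx, ← newtonPotential_eq, newtonPotential_modulus,
      Complex.ofReal_re]
  have hφm : (modulus g : E3 → ℂ) =ᵐ[volume.restrict D] fun x => (φ₀ x : ℂ) := by
    filter_upwards [ae_restrict_mem hDm, hE.eigen] with x hx h1
    rw [hφD x hx, Complex.ofReal_mul, ← newtonPotential_modulus, h1, Complex.ofReal_inv,
      inv_mul_cancel_left₀ (Complex.ofReal_ne_zero.2 hpos.ne')]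
  have hφpos : ∀ x ∈ D, 0 < φ₀ x := fun x hx => by
    rw [hφD x hx]
    refine mul_pos (inv_pos.2 hpos) ?_
    refine lt_of_le_of_ne (integral_nonneg fun _ => norm_nonneg _) fun h0 => ?_
    have h1 := (integral_eq_zero_iff_of_nonneg (fun _ => norm_nonneg _)
      (integrable_newtonKernel_mul hDR hDm g hx).norm).1 h0.symm
    have h2 : g = 0 := by
      refine Lp.ext ?_
      filter_upwards [h1, ae_newtonKernel_pos D x, Lp.coeFn_zero ℂ 2 (volume.restrict D)]
        with y h3 h4 h5
      rw [h5]
      have h6 := norm_eq_zero.1 h3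
      exact (mul_eq_zero.1 h6).resolve_left (Complex.ofReal_ne_zero.2 h4.ne')
    rw [h2, norm_zero] at hg1
    exact zero_ne_one hg1
  -- The component χ of ψ orthogonal to the modulus of g is a top eigenfunction or zero, so it has
  -- constant phase. Orthogonality to the positive φ₀ then reads ∫ φ₀ |χ| = 0, so χ = 0.
  have hmul : ∀ ψ : L2 D, K ψ = (lam : ℂ) • ψ → ∃ c : ℂ, ψ = c • modulus g := fun ψ hψ => by
    set c : ℂ := inner ℂ (modulus g) ψ
    refine ⟨c, ?_⟩
    set χ := ψ - c • modulus g with hχ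
    have hχK : K χ = (lam : ℂ) • χ := by
      rw [hχ, map_sub, map_smul, hψ, hm, smul_sub, smul_comm c]
    have horth : inner ℂ (modulus g) χ = 0 := by
      rw [hχ, inner_sub_right, inner_smul_right, inner_self_eq_norm_sq_to_K, hm1]
      simp [c]
    obtain ⟨e, he⟩ := exists_ae_phase hDR hDm hD0 hχK
    have hi := (L2.integrable_inner (𝕜 := ℂ) (modulus g) χ).const_mul e
    have h1 : ∫ x in D, φ₀ x * ‖χ x‖ = 0 := by
      have h2 : (e * inner ℂ (modulus g) χ).re = 0 := by rw [horth]; simp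
      rw [L2.inner_def, ← integral_const_mul] at h2
      rw [← h2]
      refine Eq.trans ?_ (integral_re hi)
      refine integral_congr_ae ?_
      filter_upwards [he, hφm] with x h3 h4
      rw [← h3, h4]
      show _ = (e * (χ x * conj (φ₀ x : ℂ))).re
      rw [Complex.conj_ofReal, ← mul_assoc, mul_comm _ (φ₀ x : ℂ), Complex.re_ofReal_mul]
    have hi2 : Integrable (fun x => φ₀ x * ‖χ x‖) (volume.restrict D) := by
      refine hi.re.congr ?_
      filter_upwards [he, hφm] with x h3 h4
      rw [← h3, h4]
      show (e * (χ x * conj (φ₀ x : ℂ))).re = _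
      rw [Complex.conj_ofReal, ← mul_assoc, mul_comm _ (φ₀ x : ℂ), Complex.re_ofReal_mul]
    have hnn : 0 ≤ᵐ[volume.restrict D] fun x => φ₀ x * ‖χ x‖ := by
      filter_upwards [ae_restrict_mem hDm] with x hx
      exact mul_nonneg (hφpos x hx).le (norm_nonneg _)
    have h5 := (integral_eq_zero_iff_of_nonneg_ae hnn hi2).1 h1
    have h6 : χ = 0 := by
      refine Lp.ext ?_
      filter_upwards [h5, ae_restrict_mem hDm, Lp.coeFn_zero ℂ 2 (volume.restrict D)]
        with y h3 h4 h7
      rw [h7]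
      exact norm_eq_zero.1 ((mul_eq_zero.1 h3).resolve_left (hφpos y h4).ne')
    exact sub_eq_zero.1 h6
  refine ⟨⟨⟨_, hE⟩, fun μ ⟨φ, hφ⟩ => hφ.le_norm hDR hDm⟩, ⟨⟨_, hE⟩, fun φ ψ hφ hψ => ?_⟩, φ₀, hφc,
    hE.congr hφm, hφpos⟩
  obtain ⟨c, hc⟩ := hmul _ (hφ.apply_toLp hDR hDm)
  obtain ⟨d, hd⟩ := hmul _ (hψ.apply_toLp hDR hDm)
  have hc0 : c ≠ 0 := by
    rintro rfl
    have := hφ.norm_toLp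
    rw [hc, zero_smul, norm_zero] at this
    exact zero_ne_one this
  have he : hψ.memLp.toLp ψ = (d / c) • hφ.memLp.toLp φ := by
    rw [hc, hd, smul_smul, div_mul_cancel₀ _ hc0]
  refine ⟨d / c, ?_⟩
  filter_upwards [hφ.memLp.coeFn_toLp, hψ.memLp.coeFn_toLp,
    Lp.coeFn_smul (d / c) (hφ.memLp.toLp φ)] with x h1 h2 h3
  rw [← h2, he, h3, Pi.smul_apply, h1, smul_eq_mul]

end

/-- Oddness would give values of opposite sign at x and at its reflection, both in D. Evenness
almost everywhere becomes evenness everywhere by continuity on an open set. -/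
theorem reflect_eq_of_pos_eigenfunction {D : Set E3} (hD : IsReflectInvariant D) (hDo : IsOpen D) (hD0 : volume D ≠ 0)
    {lam : ℝ} (hs : IsSimpleEigenvalue D lam) {φ : E3 → ℝ} (hc : Continuous φ)
    (hφ : IsNormalizedEigenfunction D lam (fun x => (φ x : ℂ))) (hpos : ∀ x ∈ D, 0 < φ x) :
    ∀ x ∈ D, φ (reflect x) = φ x := by
  have hr : Continuous fun x => φ (reflect x) := hc.comp reflectIso.continuous
  rcases isEvenOn_or_isOddOn hD hs hφ with h | h
  · refine Measure.eqOn_open_of_ae_eq (μ := volume) ?_ hDo hr.continuousOn hc.continuousOn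
    filter_upwards [h] with x hx
    exact Complex.ofReal_injective hx
  · have : NeZero (volume.restrict D) := ⟨by rwa [Ne, Measure.restrict_eq_zero]⟩
    obtain ⟨x, hx, hx'⟩ := (h.and (ae_restrict_mem hDo.measurableSet)).exists
    have h1 : φ (reflect x) = -φ x := by
      dsimp only at hx
      rw [← Complex.ofReal_neg] at hx
      exact Complex.ofReal_injective hx
    have := hpos _ hx'
    have := hpos _ (hD _ hx')
    linarith

/-! ### Bifurcation from a simple eigenvalue -/

section

variable {H : Type*} [NormedAddCommGroup H] [InnerProductSpace ℂ H]

theorem norm_smul_apply_le {c : ℂ} {A : H →L[ℂ] H} {v : H} {α β γ : ℝ} (hc : ‖c‖ ≤ α)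
    (hA : ‖A‖ ≤ β) (hv : ‖v‖ ≤ γ) : ‖c • A v‖ ≤ α * (β * γ) := by
  have hα := (norm_nonneg _).trans hc
  have hβ := (norm_nonneg _).trans hA
  rw [norm_smul]
  exact mul_le_mul hc ((A.le_opNorm v).trans (mul_le_mul hA hv (norm_nonneg _) hβ))
    (norm_nonneg _) hα

/-- The linearization at `(κ₀, φ)` of the eigenvalue problem `⟨φ, U⟩ = 1`, `U = κ² K U`. -/
def linearization (K : H →L[ℂ] H) (φ : H) (κ₀ : ℂ) : ℂ × H →L[ℂ] ℂ × H :=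
  ((innerSL ℂ φ).comp (ContinuousLinearMap.snd ℂ ℂ H)).prod
    (ContinuousLinearMap.snd ℂ ℂ H - κ₀ ^ 2 • K.comp (ContinuousLinearMap.snd ℂ ℂ H) -
      (ContinuousLinearMap.fst ℂ ℂ H).smulRight ((2 * κ₀) • K φ))

theorem linearization_apply (K : H →L[ℂ] H) (φ : H) (κ₀ : ℂ) (x : ℂ × H) :
    linearization K φ κ₀ x =
      (inner ℂ φ x.2, x.2 - κ₀ ^ 2 • K x.2 - x.1 • (2 * κ₀) • K φ) := rfl

/-- The linearization differs from the identity by a compact operator, so injectivity suffices.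
Pairing the second component of a kernel vector with φ kills the terms in x.2, by symmetry of K and
⟨φ, x.2⟩ = 0, and leaves x.1 = 0. Then x.2 lies in the simple eigenspace and is orthogonal to φ,
hence zero. -/
theorem exists_linearization_equiv [CompleteSpace H] {K : H →L[ℂ] H} (hK : IsCompactOperator K)
    (hs : (K : H →ₗ[ℂ] H).IsSymmetric) {φ : H} (hφ : ‖φ‖ = 1) {lam κ₀ : ℂ}
    (hl : κ₀ ^ 2 * lam = 1) (hKφ : K φ = lam • φ)
    (hsimple : ∀ ψ, K ψ = lam • ψ → ∃ c : ℂ, ψ = c • φ) :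
    ∃ L : (ℂ × H) ≃L[ℂ] (ℂ × H), (L : ℂ × H →L[ℂ] ℂ × H) = linearization K φ κ₀ := by
  let P : ℂ × H →L[ℂ] ℂ × H := 1 - linearization K φ κ₀
  have hPc : IsCompactOperator P := by
    have h1 : P = (ContinuousLinearMap.inl ℂ ℂ H).comp (ContinuousLinearMap.fst ℂ ℂ H -
        (innerSL ℂ φ).comp (ContinuousLinearMap.snd ℂ ℂ H)) +
        (ContinuousLinearMap.inr ℂ ℂ H).comp ((κ₀ ^ 2 • K).comp (ContinuousLinearMap.snd ℂ ℂ H)) +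
        ((ContinuousLinearMap.inr ℂ ℂ H).comp ((ContinuousLinearMap.id ℂ ℂ).smulRight
          ((2 * κ₀) • K φ))).comp (ContinuousLinearMap.fst ℂ ℂ H) := by
      ext x <;> simp [P, linearization_apply]
    rw [h1]
    have c1 : IsCompactOperator (ContinuousLinearMap.inl ℂ ℂ H) :=
      isCompactOperator_of_locallyCompactSpace_rng _
    have c2 : IsCompactOperator ((ContinuousLinearMap.inr ℂ ℂ H).comp
        ((ContinuousLinearMap.id ℂ ℂ).smulRight ((2 * κ₀) • K φ))) :=
      isCompactOperator_of_locallyCompactSpace_rng _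
    refine IsCompactOperator.add (IsCompactOperator.add (c1.comp_clm _) ?_) (c2.comp_clm _)
    exact ((hK.smul (κ₀ ^ 2)).comp_clm (ContinuousLinearMap.snd ℂ ℂ H)).clm_comp
      (ContinuousLinearMap.inr ℂ ℂ H)
  have hκ : κ₀ ≠ 0 := by
    rintro rfl
    simp at hl
  have hlam : lam ≠ 0 := right_ne_zero_of_mul_eq_one hl
  have hev : ¬ Module.End.HasEigenvalue (P : (ℂ × H) →ₗ[ℂ] ℂ × H) 1 := by
    intro h
    obtain ⟨x, hx⟩ := h.exists_hasEigenvector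
    have h0 : linearization K φ κ₀ x = 0 := by
      have : x - linearization K φ κ₀ x = (1 : ℂ) • x := hx.apply_eq_smul
      simpa using this
    rw [linearization_apply, Prod.mk_eq_zero] at h0
    obtain ⟨h1, h2⟩ := h0
    have h3 : inner ℂ φ (K x.2) = 0 := by
      have := hs φ x.2
      simp only [ContinuousLinearMap.coe_coe] at this
      rw [← this, hKφ, inner_smul_left, h1, mul_zero]
    have h4 := congrArg (inner ℂ φ) h2
    simp only [inner_sub_right, inner_smul_right, hKφ, inner_zero_right, h1, h3, mul_zero,
      sub_zero, zero_sub, inner_self_eq_norm_sq_to_K, hφ] at h4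
    have h5 : x.1 = 0 := by
      simpa [hκ, hlam] using h4
    rw [h5, zero_smul, sub_zero, sub_eq_zero] at h2
    have h6 : K x.2 = lam • x.2 := by
      conv_rhs => rw [h2]
      rw [smul_smul, mul_comm, hl, one_smul]
    obtain ⟨c, hc⟩ := hsimple _ h6
    rw [hc, inner_smul_right, inner_self_eq_norm_sq_to_K, hφ] at h1
    have h7 : c = 0 := by simpa using h1
    exact hx.2 (Prod.ext h5 (by rw [hc, h7, zero_smul]; rfl))
  have hres := (hPc.hasEigenvalue_or_mem_resolventSet one_ne_zero).resolve_left hev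
  rw [spectrum.mem_resolventSet_iff, map_one] at hres
  have e : (1 : ℂ × H →L[ℂ] ℂ × H) - P = linearization K φ κ₀ := sub_sub_cancel _ _
  rw [e] at hres
  obtain ⟨u, hu⟩ := hres
  exact ⟨ContinuousLinearEquiv.unitsEquiv ℂ (ℂ × H) u, by rw [← hu]; rfl⟩

/-- The nonlinear eigenvalue problem. -/
def bifurcationMap (T : ℂ → H →L[ℂ] H) (N : H → H) (φ : H) (ε t : ℝ) (x : ℂ × H) : ℂ × H :=
  (inner ℂ φ x.2, x.2 - x.1 ^ 2 • T (ε * x.1) (x.2 + (t : ℂ) • N x.2))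

/-- The Lipschitz constant of the remainder in `bifurcationMap`. -/
def bifurcationConst (C k l : ℝ) : ℝ :=
  C * (k ^ 3 + 6 * k ^ 2) + C * l * (3 * k ^ 2 + 4 * k) + C * (4 * k + 4)

/-- The nine summands bound the nine terms of the decomposition in `norm_bifurcationMap_sub_le`. The
three groups of `bifurcationConst` collect the coefficients of ε, t and η; the mixed εt-term joins
the t-group by ε ≤ 1. -/
theorem sum_le_bifurcationConst {C k l ε t η d : ℝ} (hC : 0 ≤ C) (hk : 0 ≤ k) (hl : 0 ≤ l)
    (hε : 0 ≤ ε) (hε1 : ε ≤ 1) (ht : 0 ≤ t) (hη : 0 ≤ η) (hd : 0 ≤ d) :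
    k ^ 2 * (C * (ε * k) * d) + 2 * k * d * (C * (ε * k) * 2) + k ^ 2 * (C * (ε * d) * 2) +
      t * k ^ 2 * (C * (l * d)) + t * (2 * k * d) * (C * (l * 2)) + t * k ^ 2 * (C * (ε * d) * (l * 2))
      + 2 * k * η * (C * d) + d * (2 * η) * (C * 2) + 2 * k * d * (C * η) ≤
      bifurcationConst C k l * (η + ε + t) * d := by
  have h6 : t * k ^ 2 * (C * (ε * d) * (l * 2)) ≤ t * k ^ 2 * (C * (1 * d) * (l * 2)) := by gcongr
  have p1 : 0 ≤ C * (k ^ 3 + 6 * k ^ 2) * (η + t) * d := by positivity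
  have p2 : 0 ≤ C * l * (3 * k ^ 2 + 4 * k) * (η + ε) * d := by positivity
  have p3 : 0 ≤ C * (4 * k + 4) * (ε + t) * d := by positivity
  unfold bifurcationConst
  linarith

/-- Since N is merely Lipschitz there is no derivative to estimate; instead the map minus its linear
model is shown to have a small Lipschitz constant on a ball around (κ₀, φ). -/
theorem norm_bifurcationMap_sub_le {T : ℂ → H →L[ℂ] H} {N : H → H} {φ : H} {κ₀ : ℂ} {C k l : ℝ}
    (hlip : ∀ ω ω', ‖ω‖ ≤ 1 → ‖ω'‖ ≤ 1 → ‖T ω - T ω'‖ ≤ C * ‖ω - ω'‖)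
    (hbd : ∀ ω, ‖ω‖ ≤ 1 → ‖T ω‖ ≤ C) (hk : ‖κ₀‖ + 1 ≤ k)
    (hN : ∀ U V, ‖N U - N V‖ ≤ l * ‖U - V‖) (hN0 : N 0 = 0) (hφ : ‖φ‖ = 1) (hl : 0 ≤ l)
    {ε t η : ℝ} (hε : 0 ≤ ε) (hεk : ε * k ≤ 1) (ht : 0 ≤ t) (hη : 0 ≤ η) (hη1 : η ≤ 1)
    {x y : ℂ × H} (hx : ‖x - (κ₀, φ)‖ ≤ η) (hy : ‖y - (κ₀, φ)‖ ≤ η) :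
    ‖bifurcationMap T N φ ε t x - bifurcationMap T N φ ε t y - linearization (T 0) φ κ₀ (x - y)‖ ≤
      bifurcationConst C k l * (η + ε + t) * ‖x - y‖ := by
  obtain ⟨κ, U⟩ := x
  obtain ⟨κ', V⟩ := y
  set d := ‖((κ, U) : ℂ × H) - (κ', V)‖ with hd
  have hd0 : 0 ≤ d := norm_nonneg _
  have hd1 : ‖κ - κ'‖ ≤ d := norm_fst_le (((κ, U) : ℂ × H) - (κ', V))
  have hd2 : ‖U - V‖ ≤ d := norm_snd_le (((κ, U) : ℂ × H) - (κ', V))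
  have hκ : ‖κ - κ₀‖ ≤ η := (norm_fst_le (((κ, U) : ℂ × H) - (κ₀, φ))).trans hx
  have hκ' : ‖κ' - κ₀‖ ≤ η := (norm_fst_le (((κ', V) : ℂ × H) - (κ₀, φ))).trans hy
  have hV : ‖V - φ‖ ≤ η := (norm_snd_le (((κ', V) : ℂ × H) - (κ₀, φ))).trans hy
  have hC : 0 ≤ C := (norm_nonneg _).trans (hbd 0 (by simp))
  have hk1 : 1 ≤ k := le_trans (by linarith [norm_nonneg κ₀]) hk
  have bd : ∀ z, ‖z - κ₀‖ ≤ η → ‖z‖ ≤ k := fun z hz => by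
    have := norm_le_norm_add_norm_sub' z κ₀
    linarith
  have bκ := bd κ hκ
  have bκ' := bd κ' hκ'
  have hV2 : ‖V‖ ≤ 2 := by
    have := norm_le_norm_add_norm_sub' V φ
    linarith
  have hω : ∀ z : ℂ, ‖z‖ ≤ k → ‖(ε : ℂ) * z‖ ≤ 1 := fun z hz => by
    rw [norm_mul, Complex.norm_real, Real.norm_of_nonneg hε]
    exact (mul_le_mul_of_nonneg_left hz hε).trans hεk
  set A := T (ε * κ) with hA
  set A' := T (ε * κ') with hA'
  set K := T 0 with hK
  have bA : ‖A‖ ≤ C := hbd _ (hω κ bκ)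
  have bK : ‖K‖ ≤ C := hbd _ (by simp)
  have bAK : ‖A - K‖ ≤ C * (ε * k) := by
    refine (hlip _ _ (hω κ bκ) (by simp)).trans ?_
    rw [sub_zero, norm_mul, Complex.norm_real, Real.norm_of_nonneg hε]
    gcongr
  have bAA : ‖A - A'‖ ≤ C * (ε * d) := by
    refine (hlip _ _ (hω κ bκ) (hω κ' bκ')).trans ?_
    rw [← mul_sub, norm_mul, Complex.norm_real, Real.norm_of_nonneg hε]
    gcongr
  have bκ2 : ‖κ ^ 2‖ ≤ k ^ 2 := by rw [norm_pow]; gcongr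
  have bκ2' : ‖κ' ^ 2‖ ≤ k ^ 2 := by rw [norm_pow]; gcongr
  have bdiff : ‖κ ^ 2 - κ' ^ 2‖ ≤ 2 * k * d := by
    rw [sq_sub_sq, norm_mul]
    exact mul_le_mul ((norm_add_le _ _).trans (by linarith)) hd1 (norm_nonneg _) (by linarith)
  have bdiff0 : ‖κ ^ 2 - κ₀ ^ 2‖ ≤ 2 * k * η := by
    rw [sq_sub_sq, norm_mul]
    exact mul_le_mul ((norm_add_le _ _).trans (by linarith)) hκ (norm_nonneg _) (by linarith)
  have bNV : ‖N V‖ ≤ l * 2 := by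
    have := hN V 0
    rw [hN0, sub_zero, sub_zero] at this
    exact this.trans (by gcongr)
  have bNUV : ‖N U - N V‖ ≤ l * d := (hN U V).trans (by gcongr)
  have bt : ‖(t : ℂ)‖ ≤ t := by rw [Complex.norm_real, Real.norm_of_nonneg ht]
  -- The first three terms come from varying the frequency in T and are small with ε, the next three
  -- carry the factor t, and the last three are quadratic errors of κ²KU, small with η.
  have e : (bifurcationMap T N φ ε t (κ, U) - bifurcationMap T N φ ε t (κ', V) -
      linearization K φ κ₀ ((κ, U) - (κ', V))) =
      (0, -(κ ^ 2 • (A - K) (U - V) + (κ ^ 2 - κ' ^ 2) • (A - K) V + κ' ^ 2 • (A - A') V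
        + (t * κ ^ 2) • A (N U - N V) + (t * (κ ^ 2 - κ' ^ 2)) • A (N V)
        + (t * κ' ^ 2) • (A - A') (N V) + (κ ^ 2 - κ₀ ^ 2) • K (U - V)
        + ((κ - κ') * (κ + κ' - 2 * κ₀)) • K V + (2 * κ₀ * (κ - κ')) • K (V - φ))) := by
    rw [linearization_apply]
    refine Prod.ext ?_ ?_
    · simp [bifurcationMap]
    · simp only [bifurcationMap, Prod.snd_sub, Prod.fst_sub, map_sub, map_add, map_smul,
        sub_apply, ← hA, ← hA']
      module
  rw [e, Prod.norm_mk, norm_zero, norm_neg, max_eq_right (norm_nonneg _)]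
  have b1 := norm_smul_apply_le bκ2 bAK hd2
  have b2 := norm_smul_apply_le bdiff bAK hV2
  have b3 := norm_smul_apply_le bκ2' bAA hV2
  have b4 := norm_smul_apply_le (c := t * κ ^ 2) (α := t * k ^ 2)
    (by rw [norm_mul]; exact mul_le_mul bt bκ2 (norm_nonneg _) ht) bA bNUV
  have b5 := norm_smul_apply_le (c := t * (κ ^ 2 - κ' ^ 2)) (α := t * (2 * k * d))
    (by rw [norm_mul]; exact mul_le_mul bt bdiff (norm_nonneg _) ht) bA bNV
  have b6 := norm_smul_apply_le (c := t * κ' ^ 2) (α := t * k ^ 2)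
    (by rw [norm_mul]; exact mul_le_mul bt bκ2' (norm_nonneg _) ht) bAA bNV
  have b7 := norm_smul_apply_le bdiff0 bK hd2
  have b8 := norm_smul_apply_le (c := (κ - κ') * (κ + κ' - 2 * κ₀)) (α := d * (2 * η))
    (by
      rw [norm_mul]
      refine mul_le_mul hd1 ?_ (norm_nonneg _) hd0
      rw [show κ + κ' - 2 * κ₀ = (κ - κ₀) + (κ' - κ₀) by ring]
      exact (norm_add_le _ _).trans (by linarith)) bK hV2
  have b9 := norm_smul_apply_le (c := 2 * κ₀ * (κ - κ')) (α := 2 * k * d)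
    (by
      rw [norm_mul, norm_mul, Complex.norm_ofNat]
      exact mul_le_mul (by linarith) hd1 (norm_nonneg _) (by linarith)) bK hV
  have hε1 : ε ≤ 1 := le_trans (le_mul_of_one_le_right hε hk1) hεk
  refine le_trans ?_ (sum_le_bifurcationConst hC (by linarith) hl hε hε1 ht hη hd0)
  refine (norm_add_le _ _).trans (add_le_add ?_ b9)
  refine (norm_add_le _ _).trans (add_le_add ?_ b8)
  refine (norm_add_le _ _).trans (add_le_add ?_ b7)
  refine (norm_add_le _ _).trans (add_le_add ?_ b6)
  refine (norm_add_le _ _).trans (add_le_add ?_ b5)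
  refine (norm_add_le _ _).trans (add_le_add ?_ b4)
  refine (norm_add_le _ _).trans (add_le_add ?_ b3)
  exact (norm_add_le _ _).trans (add_le_add b1 b2)

theorem norm_bifurcationMap_base_le {T : ℂ → H →L[ℂ] H} {N : H → H} {φ : H} {κ₀ lam : ℂ} {C k l : ℝ}
    (hlip : ∀ ω ω', ‖ω‖ ≤ 1 → ‖ω'‖ ≤ 1 → ‖T ω - T ω'‖ ≤ C * ‖ω - ω'‖)
    (hbd : ∀ ω, ‖ω‖ ≤ 1 → ‖T ω‖ ≤ C) (hk : ‖κ₀‖ + 1 ≤ k)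
    (hN : ∀ U V, ‖N U - N V‖ ≤ l * ‖U - V‖) (hN0 : N 0 = 0) (hφ : ‖φ‖ = 1)
    (hl : κ₀ ^ 2 * lam = 1) (hKφ : T 0 φ = lam • φ)
    {ε t : ℝ} (hε : 0 ≤ ε) (hεk : ε * k ≤ 1) (ht : 0 ≤ t) :
    ‖bifurcationMap T N φ ε t (κ₀, φ) - (1, 0)‖ ≤ (k ^ 3 * C + k ^ 2 * C * l) * (ε + t) := by
  have hC : 0 ≤ C := (norm_nonneg _).trans (hbd 0 (by simp))
  have hk1 : 1 ≤ k := le_trans (by linarith [norm_nonneg κ₀]) hk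
  have bκ : ‖κ₀‖ ≤ k := by linarith
  have bκ2 : ‖κ₀ ^ 2‖ ≤ k ^ 2 := by rw [norm_pow]; gcongr
  have hω : ‖(ε : ℂ) * κ₀‖ ≤ 1 := by
    rw [norm_mul, Complex.norm_real, Real.norm_of_nonneg hε]
    exact (mul_le_mul_of_nonneg_left bκ hε).trans hεk
  have bA : ‖T (ε * κ₀) - T 0‖ ≤ C * (ε * k) := by
    refine (hlip _ _ hω (by simp)).trans ?_
    rw [sub_zero, norm_mul, Complex.norm_real, Real.norm_of_nonneg hε]
    gcongr
  have bN : ‖N φ‖ ≤ l := by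
    have := hN φ 0
    rwa [hN0, sub_zero, sub_zero, hφ, mul_one] at this
  have hl0 : 0 ≤ l := (norm_nonneg _).trans bN
  have e : bifurcationMap T N φ ε t (κ₀, φ) - (1, 0) =
      (0, -(κ₀ ^ 2 • (T (ε * κ₀) - T 0) φ + (t * κ₀ ^ 2) • T (ε * κ₀) (N φ))) := by
    refine Prod.ext ?_ ?_
    · simp [bifurcationMap, inner_self_eq_norm_sq_to_K, hφ]
    · have h1 : φ = κ₀ ^ 2 • T 0 φ := by rw [hKφ, smul_smul, hl, one_smul]
      simp only [bifurcationMap, Prod.snd_sub, map_add, map_smul, sub_apply]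
      nth_rewrite 1 [h1]
      module
  rw [e, Prod.norm_mk, norm_zero, norm_neg, max_eq_right (norm_nonneg _)]
  have b1 := norm_smul_apply_le bκ2 bA hφ.le
  have b2 := norm_smul_apply_le (c := t * κ₀ ^ 2) (α := t * k ^ 2)
    (by
      rw [norm_mul, Complex.norm_real, Real.norm_of_nonneg ht]
      gcongr) (hbd _ hω) bN
  refine ((norm_add_le _ _).trans (add_le_add b1 b2)).trans ?_
  have p1 : 0 ≤ k ^ 3 * C * t := by positivity
  have p2 : 0 ≤ k ^ 2 * C * l * ε := by positivity
  nlinarith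

/-- The map is a perturbation of its invertible linearization with Lipschitz constant c below 1/ν,
hence injective on the η₀-ball and open with explicit radii. The uniqueness radius η₀ is fixed
before η, so existence in arbitrarily small balls also gives convergence of the solution as ε, t →
0. -/
theorem exists_unique_bifurcation [CompleteSpace H] {T : ℂ → H →L[ℂ] H} {N : H → H} {φ : H}
    {κ₀ lam : ℂ} {C k l : ℝ}
    (hlip : ∀ ω ω', ‖ω‖ ≤ 1 → ‖ω'‖ ≤ 1 → ‖T ω - T ω'‖ ≤ C * ‖ω - ω'‖)
    (hbd : ∀ ω, ‖ω‖ ≤ 1 → ‖T ω‖ ≤ C) (hk : ‖κ₀‖ + 1 ≤ k)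
    (hN : ∀ U V, ‖N U - N V‖ ≤ l * ‖U - V‖) (hN0 : N 0 = 0) (hφ : ‖φ‖ = 1) (hl0 : 0 ≤ l)
    (hl : κ₀ ^ 2 * lam = 1) (hKφ : T 0 φ = lam • φ) (L : (ℂ × H) ≃L[ℂ] (ℂ × H))
    (hL : (L : ℂ × H →L[ℂ] ℂ × H) = linearization (T 0) φ κ₀) :
    ∃ η₀, 0 < η₀ ∧ η₀ ≤ 1 ∧ ∀ η, 0 < η → η ≤ η₀ → ∃ s > 0, ∀ ε t : ℝ, 0 ≤ ε → ε < s → 0 ≤ t →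
      t < s → (∃ x, ‖x - (κ₀, φ)‖ ≤ η ∧ bifurcationMap T N φ ε t x = (1, 0)) ∧
        ∀ x y, ‖x - (κ₀, φ)‖ ≤ η₀ → ‖y - (κ₀, φ)‖ ≤ η₀ → bifurcationMap T N φ ε t x = (1, 0) →
          bifurcationMap T N φ ε t y = (1, 0) → x = y := by
  have hC : 0 ≤ C := (norm_nonneg _).trans (hbd 0 (by simp))
  have hk1 : 1 ≤ k := le_trans (by linarith [norm_nonneg κ₀]) hk
  set Q := bifurcationConst C k l with hQ
  have hQ0 : 0 ≤ Q := by rw [hQ, bifurcationConst]; positivity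
  set P := k ^ 3 * C + k ^ 2 * C * l with hP
  have hP0 : 0 ≤ P := by positivity
  set ν : ℝ := max 1 ‖(L.symm : ℂ × H →L[ℂ] ℂ × H)‖ with hν
  have hν1 : 1 ≤ ν := le_max_left _ _
  have hLinv : ∀ z, ‖z‖ ≤ ν * ‖linearization (T 0) φ κ₀ z‖ := fun z => by
    have h1 : L z = linearization (T 0) φ κ₀ z := by rw [← hL]; rfl
    have h2 := (L.symm : ℂ × H →L[ℂ] ℂ × H).le_opNorm (L z)
    rw [ContinuousLinearEquiv.coe_coe, L.symm_apply_apply, h1] at h2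
    exact h2.trans (by gcongr; exact le_max_right _ _)
  let S : (linearization (T 0) φ κ₀).NonlinearRightInverse :=
    { toFun := L.symm
      nnnorm := ⟨ν, by linarith⟩
      bound' := fun y => ((L.symm : ℂ × H →L[ℂ] ℂ × H).le_opNorm y).trans
        (mul_le_mul_of_nonneg_right (le_max_right _ _) (norm_nonneg _))
      right_inv' := fun y => by
        rw [← hL]
        exact L.apply_symm_apply y }
  -- Half of 1/ν: the image of the η-ball then contains a ball of radius (1/ν - c)η = cη, and two
  -- solutions satisfy ‖x - y‖ ≤ ‖x - y‖/2.
  set c : ℝ := 1 / (2 * ν) with hc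
  have hc0 : 0 < c := by positivity
  have hcν : ν * c = 1 / 2 := by rw [hc]; field_simp
  have hcν' : ν⁻¹ - c = c := by rw [hc]; field_simp; norm_num
  have h3 : 0 < c / (3 * (Q + 1)) := by positivity
  -- Each of η₀, ε and t takes at most a third of the budget Q(η₀ + ε + t) ≤ c.
  refine ⟨min 1 (c / (3 * (Q + 1))), lt_min one_pos h3, min_le_left _ _, fun η hη hη0 => ?_⟩
  set η₀ := min 1 (c / (3 * (Q + 1))) with hη₀
  have hη₀1 : η₀ ≤ 1 := min_le_left _ _
  have hη₀Q : η₀ ≤ c / (3 * (Q + 1)) := min_le_right _ _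
  -- The bound 1/k keeps the frequencies εκ in the unit disc, the second serves the Lipschitz
  -- budget, and the third makes the residual at (κ₀, φ) at most cη.
  refine ⟨min (1 / k) (min (c / (3 * (Q + 1))) (c * η / (2 * (P + 1)))), by positivity,
    fun ε t hε hεs ht hts => ?_⟩
  have hεk : ε * k ≤ 1 := by
    have := (le_div_iff₀ (by linarith : (0 : ℝ) < k)).1 (hεs.le.trans (min_le_left _ _))
    exact this
  have e1 := hεs.le.trans ((min_le_right _ _).trans (min_le_left _ _))
  have e2 := hεs.le.trans ((min_le_right _ _).trans (min_le_right _ _))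
  have t1 := hts.le.trans ((min_le_right _ _).trans (min_le_left _ _))
  have t2 := hts.le.trans ((min_le_right _ _).trans (min_le_right _ _))
  have hsum : Q * (η₀ + ε + t) ≤ c := by
    have h4 : η₀ + ε + t ≤ c / (Q + 1) := by
      have : c / (3 * (Q + 1)) * 3 = c / (Q + 1) := by field_simp
      linarith
    have h5 : (η₀ + ε + t) * (Q + 1) ≤ c := (le_div_iff₀ (by positivity)).1 h4
    have : 0 ≤ η₀ + ε + t := by linarith
    nlinarith
  have hbase : P * (ε + t) ≤ c * η := by
    have h4 : ε + t ≤ c * η / (P + 1) := by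
      have : c * η / (2 * (P + 1)) * 2 = c * η / (P + 1) := by field_simp
      linarith
    have h5 : (ε + t) * (P + 1) ≤ c * η := (le_div_iff₀ (by positivity)).1 h4
    nlinarith
  have happ : ApproximatesLinearOn (bifurcationMap T N φ ε t) (linearization (T 0) φ κ₀)
      (Metric.closedBall (κ₀, φ) η₀) ⟨c, hc0.le⟩ := fun x hx y hy => by
    rw [mem_closedBall_iff_norm] at hx hy
    refine (norm_bifurcationMap_sub_le hlip hbd hk hN hN0 hφ hl0 hε hεk ht (by linarith) hη₀1 hx
      hy).trans ?_
    exact mul_le_mul_of_nonneg_right hsum (norm_nonneg _)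
  constructor
  · have hsurj := happ.surjOn_closedBall_of_nonlinearRightInverse S hη.le
      (Metric.closedBall_subset_closedBall hη0)
    have hmem : ((1, 0) : ℂ × H) ∈ Metric.closedBall (bifurcationMap T N φ ε t (κ₀, φ))
        (((S.nnnorm : ℝ)⁻¹ - c) * η) := by
      rw [mem_closedBall_iff_norm, norm_sub_rev]
      refine (norm_bifurcationMap_base_le hlip hbd hk hN hN0 hφ hl hKφ hε hεk ht).trans ?_
      refine hbase.trans (le_of_eq ?_)
      rw [show (S.nnnorm : ℝ) = ν from rfl, hcν']
    obtain ⟨x, hx, hx'⟩ := hsurj hmem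
    exact ⟨x, mem_closedBall_iff_norm.1 hx, hx'⟩
  · intro x y hx hy hGx hGy
    have h4 := happ x (mem_closedBall_iff_norm.2 hx) y (mem_closedBall_iff_norm.2 hy)
    rw [hGx, hGy, sub_self, zero_sub, norm_neg] at h4
    have h5 : ‖x - y‖ ≤ ν * (c * ‖x - y‖) := (hLinv (x - y)).trans (mul_le_mul_of_nonneg_left h4 (by linarith))
    rw [← mul_assoc, hcν] at h5
    have h6 : ‖x - y‖ = 0 := by linarith [norm_nonneg (x - y)]
    exact sub_eq_zero.1 (norm_eq_zero.1 h6)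

end

/-! ### The truncated Kerr nonlinearity -/

/-- The cubic nonlinearity `|z|² z` with `|z|` truncated at `M`. -/
def truncatedCubic (M : ℝ) (z : ℂ) : ℂ := ((min ‖z‖ M ^ 2 : ℝ) : ℂ) * z

theorem truncatedCubic_eq {M : ℝ} {z : ℂ} (h : ‖z‖ ≤ M) :
    truncatedCubic M z = ((‖z‖ ^ 2 : ℝ) : ℂ) * z := by
  rw [truncatedCubic, min_eq_left h]

theorem truncatedCubic_zero (M : ℝ) : truncatedCubic M 0 = 0 := by simp [truncatedCubic]

/-- With p, q the truncated moduli, the difference is p²(z - w) + (p² - q²)w. The ordering handles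
the second term: if ‖w‖ exceeds M, so does ‖z‖, and p = q. -/
theorem norm_truncatedCubic_sub_le_of_le {M : ℝ} (hM : 0 ≤ M) {z w : ℂ} (h : ‖w‖ ≤ ‖z‖) :
    ‖truncatedCubic M z - truncatedCubic M w‖ ≤ 3 * M ^ 2 * ‖z - w‖ := by
  set p := min ‖z‖ M with hp
  set q := min ‖w‖ M with hq
  have hp0 : 0 ≤ p := le_min (norm_nonneg _) hM
  have hq0 : 0 ≤ q := le_min (norm_nonneg _) hM
  have hpM : p ≤ M := min_le_right _ _
  have hqM : q ≤ M := min_le_right _ _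
  have hpq : |p - q| ≤ ‖z - w‖ :=
    ((abs_min_sub_min_le_max ‖z‖ M ‖w‖ M).trans (by simp [abs_norm_sub_norm_le]))
  have e : truncatedCubic M z - truncatedCubic M w =
      ((p ^ 2 : ℝ) : ℂ) * (z - w) + (((p - q) * (p + q) : ℝ) : ℂ) * w := by
    rw [truncatedCubic, truncatedCubic, ← hp, ← hq]
    push_cast
    ring
  have h2 : |p - q| * ‖w‖ ≤ M * ‖z - w‖ := by
    rcases le_total ‖w‖ M with hw | hw
    · rw [mul_comm]
      exact mul_le_mul hw hpq (abs_nonneg _) hM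
    · rw [hp, hq, min_eq_right hw, min_eq_right (hw.trans h), sub_self, abs_zero, zero_mul]
      positivity
  rw [e]
  refine (norm_add_le _ _).trans ?_
  rw [norm_mul, norm_mul, Complex.norm_real, Complex.norm_real, Real.norm_eq_abs, Real.norm_eq_abs,
    abs_of_nonneg (sq_nonneg p), abs_mul, abs_of_nonneg (add_nonneg hp0 hq0)]
  have h3 : p ^ 2 * ‖z - w‖ ≤ M ^ 2 * ‖z - w‖ := by gcongr
  have h4 : |p - q| * (p + q) * ‖w‖ ≤ M * ‖z - w‖ * (2 * M) := by
    rw [mul_right_comm]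
    exact mul_le_mul h2 (by linarith) (by linarith) (by positivity)
  nlinarith

theorem lipschitzWith_truncatedCubic {M : ℝ} (hM : 0 ≤ M) :
    LipschitzWith ⟨3 * M ^ 2, by positivity⟩ (truncatedCubic M) := by
  refine LipschitzWith.of_dist_le_mul fun z w => ?_
  rw [dist_eq_norm, dist_eq_norm]
  rcases le_total ‖w‖ ‖z‖ with h | h
  · exact norm_truncatedCubic_sub_le_of_le hM h
  · rw [norm_sub_rev, norm_sub_rev z w]
    exact norm_truncatedCubic_sub_le_of_le hM h

/-- The truncated cubic nonlinearity on `L²(D)`. -/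
def cubicOp (D : Set E3) (M : ℝ) (hM : 0 ≤ M) (f : L2 D) : L2 D :=
  (lipschitzWith_truncatedCubic hM).compLp (truncatedCubic_zero M) f

theorem cubicOp_ae {D : Set E3} {M : ℝ} (hM : 0 ≤ M) (f : L2 D) :
    cubicOp D M hM f =ᵐ[volume.restrict D] fun x => truncatedCubic M (f x) :=
  (lipschitzWith_truncatedCubic hM).coeFn_compLp (truncatedCubic_zero M) f

theorem norm_cubicOp_sub_le {D : Set E3} {M : ℝ} (hM : 0 ≤ M) (f g : L2 D) :
    ‖cubicOp D M hM f - cubicOp D M hM g‖ ≤ 3 * M ^ 2 * ‖f - g‖ :=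
  (lipschitzWith_truncatedCubic hM).norm_compLp_sub_le (truncatedCubic_zero M) f g

theorem cubicOp_zero (D : Set E3) {M : ℝ} (hM : 0 ≤ M) : cubicOp D M hM 0 = 0 :=
  (lipschitzWith_truncatedCubic hM).compLp_zero (truncatedCubic_zero M)

theorem norm_cubicOp_le {D : Set E3} {M : ℝ} (hM : 0 ≤ M) (f : L2 D) :
    ‖cubicOp D M hM f‖ ≤ M ^ 2 * ‖f‖ := by
  refine Lp.norm_le_mul_norm_of_ae_le_mul ?_
  filter_upwards [cubicOp_ae hM f] with x hx
  rw [hx, truncatedCubic, norm_mul, Complex.norm_real, Real.norm_eq_abs, abs_of_nonneg (sq_nonneg _)]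
  gcongr
  exact min_le_right _ _

/-! ### Symmetry of the branch -/

theorem l2Inner_comp_reflect {D : Set E3} (hD : IsReflectInvariant D) (f g : E3 → ℂ) :
    l2Inner D f (fun x => g (reflect x)) = l2Inner D (fun x => f (reflect x)) g := by
  rw [l2Inner, l2Inner, ← hD.setIntegral_comp]
  simp only [reflect_reflect]

theorem l2Inner_const_mul (D : Set E3) (f g : E3 → ℂ) (c : ℂ) :
    l2Inner D f (fun x => c * g x) = c * l2Inner D f g := by
  rw [l2Inner, l2Inner, ← integral_const_mul]
  congr 1 with x
  ring

theorem l2Inner_congr {D : Set E3} {f f' g g' : E3 → ℂ} (hf : f =ᵐ[volume.restrict D] f')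
    (hg : g =ᵐ[volume.restrict D] g') : l2Inner D f g = l2Inner D f' g' := by
  refine integral_congr_ae ?_
  filter_upwards [hf, hg] with x h1 h2
  rw [h1, h2]

theorem IsResonantState.comp_reflect {D : Set E3} (hD : IsReflectInvariant D) {τ : ℝ} {ω : ℂ}
    {u : E3 → ℂ} (h : IsResonantState D τ ω u) :
    IsResonantState D τ ω fun x => u (reflect x) := by
  refine ⟨hD.memH2_comp h.memH2, fun h0 => h.nontrivial ?_, ?_⟩
  · have := hD.ae_comp h0
    simpa only [reflect_reflect] using this
  · filter_upwards [hD.ae_comp h.lippmannSchwinger] with x hx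
    rw [hx, ← volumePotential_comp_reflect hD]

/-- The reflected state is a resonant state at the same frequency, equally near, with amplitude of
the same modulus. Uniqueness makes it a phase times u, and pairing with φ identifies the phase as s.
The conjugate in the hypothesis offsets the conjugate-linear slot of `l2Inner`. -/
theorem IsResonantBranch.ae_comp_reflect {D : Set E3} (hD : IsReflectInvariant D) {lam : ℝ}
    {φ : E3 → ℂ} {δ ρ : ℝ} {ω : ℝ → ℝ → ℂ} {u : ℝ → ℝ → E3 → ℂ}
    (h : IsResonantBranch D lam φ δ ρ ω u) {a τ : ℝ} (ha : (a, τ) ∈ paramRegion δ) {s : ℂ}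
    (hs : ‖s‖ = 1) (hφ : (fun x => φ (reflect x)) =ᵐ[volume.restrict D] fun x => conj s * φ x) :
    (fun x => u a τ (reflect x)) =ᵐ[volume.restrict D] fun x => s * u a τ x := by
  have h1 : l2Inner D φ (fun x => u a τ (reflect x)) = s * a := by
    rw [l2Inner_comp_reflect hD, l2Inner_congr hφ (ae_eq_refl _), ← h.amplitude a τ ha, l2Inner,
      l2Inner, ← integral_const_mul]
    congr 1 with x
    rw [map_mul, Complex.conj_conj, mul_assoc]
  have ha0 : 0 < a := ha.1
  have hne : (a : ℂ) ≠ 0 := Complex.ofReal_ne_zero.2 ha0.ne'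
  obtain ⟨-, θ, hθ⟩ := h.unique a τ ha (ω a τ) _ ((h.resonant a τ ha).comp_reflect hD)
    ⟨(h.near a τ ha).1, hD.h2Norm_comp_lt (h.resonant a τ ha).memH2 (h.near a τ ha).2⟩
    (by rw [h1, norm_mul, hs, one_mul, Complex.norm_real, Real.norm_of_nonneg ha0.le])
  rw [l2Inner_congr (ae_eq_refl _) hθ, l2Inner_const_mul, h.amplitude a τ ha] at h1
  rwa [mul_right_cancel₀ hne h1] at hθ

theorem IsResonantBranch.isEvenOn {D : Set E3} (hD : IsReflectInvariant D) {lam : ℝ}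
    {φ : E3 → ℂ} {δ ρ : ℝ} {ω : ℝ → ℝ → ℂ} {u : ℝ → ℝ → E3 → ℂ}
    (h : IsResonantBranch D lam φ δ ρ ω u) {a τ : ℝ} (ha : (a, τ) ∈ paramRegion δ)
    (hφ : IsEvenOn D φ) : IsEvenOn D (u a τ) := by
  have := h.ae_comp_reflect hD ha (s := 1) (by simp) (by simpa [IsEvenOn] using hφ)
  simpa [IsEvenOn] using this

theorem IsResonantBranch.isOddOn {D : Set E3} (hD : IsReflectInvariant D) {lam : ℝ}
    {φ : E3 → ℂ} {δ ρ : ℝ} {ω : ℝ → ℝ → ℂ} {u : ℝ → ℝ → E3 → ℂ}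
    (h : IsResonantBranch D lam φ δ ρ ω u) {a τ : ℝ} (ha : (a, τ) ∈ paramRegion δ)
    (hφ : IsOddOn D φ) : IsOddOn D (u a τ) := by
  have := h.ae_comp_reflect hD ha (s := -1) (by simp) (by simpa [IsOddOn] using hφ)
  simpa [IsOddOn] using this

/-! ### Existence and uniqueness of the small-amplitude branch -/

/-- Smallness of a state says nothing about its normalization U, so closeness of U to φ has to come
from the equation. The linearization at (0, U - φ) equals a remainder of size (small)·‖U‖, and ‖U‖ ≤
1 + ‖U - φ‖ lets the unknown be absorbed on the left. -/
theorem norm_sub_le_of_eq_smul {H : Type*} [NormedAddCommGroup H] [InnerProductSpace ℂ H]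
    {T : ℂ → H →L[ℂ] H} {φ U q : H} {κ₀ lam κ ω : ℂ} {C k r e s ν η : ℝ}
    (hlip : ∀ ω ω', ‖ω‖ ≤ 1 → ‖ω'‖ ≤ 1 → ‖T ω - T ω'‖ ≤ C * ‖ω - ω'‖)
    (hbd : ∀ ω, ‖ω‖ ≤ 1 → ‖T ω‖ ≤ C) (hk : ‖κ₀‖ + 1 ≤ k) (hφ : ‖φ‖ = 1)
    (hl : κ₀ ^ 2 * lam = 1) (hKφ : T 0 φ = lam • φ)
    (hLinv : ∀ z, ‖z‖ ≤ ν * ‖linearization (T 0) φ κ₀ z‖) (hν : 0 ≤ ν)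
    (hr : ‖κ - κ₀‖ ≤ r) (hr1 : r ≤ 1) (hω : ‖ω‖ ≤ e) (he1 : e ≤ 1) (hq : ‖q‖ ≤ s * ‖U‖)
    (hU : U = κ ^ 2 • T ω (U + q)) (hin : inner ℂ φ U = 1) (hη0 : 0 ≤ η)
    (hη1 : η ≤ 1)
    (hsmall : ν * (2 * k * r * C + k ^ 2 * (C * e) + k ^ 2 * (C * s)) ≤ η / 2) : ‖U - φ‖ ≤ η := by
  have hκ : ‖κ‖ ≤ k := by
    have := norm_le_norm_add_norm_sub' κ κ₀
    linarith
  have hκ2 : ‖κ ^ 2‖ ≤ k ^ 2 := by rw [norm_pow]; gcongr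
  have hC : 0 ≤ C := (norm_nonneg _).trans (hbd 0 (by simp))
  have hr0 : 0 ≤ r := (norm_nonneg _).trans hr
  have hdiff : ‖κ ^ 2 - κ₀ ^ 2‖ ≤ 2 * k * r := by
    rw [sq_sub_sq, norm_mul]
    exact mul_le_mul ((norm_add_le _ _).trans (by linarith)) hr (norm_nonneg _)
      (by linarith [norm_nonneg κ])
  have hA : ‖T ω - T 0‖ ≤ C * e := by
    refine (hlip _ _ (hω.trans he1) (by simp)).trans ?_
    rw [sub_zero]
    gcongr
  have hlin : linearization (T 0) φ κ₀ (0, U - φ) = (0, (κ ^ 2 - κ₀ ^ 2) • T 0 U +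
      κ ^ 2 • (T ω - T 0) U + κ ^ 2 • T ω q) := by
    rw [linearization_apply]
    refine Prod.ext ?_ ?_
    · simp [hin, inner_self_eq_norm_sq_to_K, hφ]
    · have h1 : φ = κ₀ ^ 2 • T 0 φ := by rw [hKφ, smul_smul, hl, one_smul]
      have h2 : U - φ = κ ^ 2 • T ω (U + q) - κ₀ ^ 2 • T 0 φ := by rw [← h1, ← hU]
      dsimp only
      rw [h2, ← h2]
      simp only [map_add, sub_apply, map_sub] at h2 ⊢
      rw [h2]
      module
  have h3 := hLinv (0, U - φ)
  rw [hlin, Prod.norm_mk, Prod.norm_mk, norm_zero, max_eq_right (norm_nonneg _),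
    max_eq_right (norm_nonneg _)] at h3
  have b1 := norm_smul_apply_le hdiff (hbd 0 (by simp)) (le_refl ‖U‖)
  have b2 := norm_smul_apply_le hκ2 hA (le_refl ‖U‖)
  have b3 := norm_smul_apply_le hκ2 (hbd ω (hω.trans he1)) hq
  have h4 : ‖(κ ^ 2 - κ₀ ^ 2) • T 0 U + κ ^ 2 • (T ω - T 0) U + κ ^ 2 • T ω q‖ ≤
      (2 * k * r * C + k ^ 2 * (C * e) + k ^ 2 * (C * s)) * ‖U‖ := by
    refine (norm_add₃_le).trans ?_
    linarith
  have h5 : ‖U - φ‖ ≤ η / 2 * ‖U‖ := by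
    refine h3.trans ((mul_le_mul_of_nonneg_left h4 hν).trans ?_)
    rw [← mul_assoc]
    gcongr
  have h6 : ‖U‖ ≤ 1 + ‖U - φ‖ := by
    have := norm_le_norm_add_norm_sub' U φ
    rwa [hφ] at this
  have h7 : η / 2 * ‖U‖ ≤ η / 2 * (1 + ‖U - φ‖) := by gcongr
  have h8 : η * ‖U - φ‖ ≤ ‖U - φ‖ := mul_le_of_le_one_left (norm_nonneg _) hη1
  linarith

theorem volumePotential_congr {D : Set E3} (ω : ℂ) {f g : E3 → ℂ} (h : f =ᵐ[volume.restrict D] g)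
    (x : E3) : volumePotential D ω f x = volumePotential D ω g x := by
  refine integral_congr_ae ?_
  filter_upwards [h] with y hy
  rw [hy]

theorem volumePotential_const_mul (D : Set E3) (ω c : ℂ) (f : E3 → ℂ) (x : E3) :
    volumePotential D ω (fun y => c * f y) x = c * volumePotential D ω f x := by
  rw [volumePotential, volumePotential, ← integral_const_mul]
  congr 1 with y
  ring

theorem kerr_mul (p z : ℂ) : kerr (p * z) = p * (z + ((‖p‖ ^ 2 * ‖z‖ ^ 2 : ℝ) : ℂ) * z) := by
  rw [kerr, norm_mul, mul_pow]
  ring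

theorem l2Inner_eq_inner {D : Set E3} {φ : E3 → ℂ} (hφ : MemLp φ 2 (volume.restrict D))
    (U : L2 D) : l2Inner D φ U = inner ℂ (hφ.toLp φ) U := by
  rw [L2.inner_def, l2Inner]
  refine integral_congr_ae ?_
  filter_upwards [hφ.coeFn_toLp] with x hx
  rw [hx]
  exact mul_comm _ _

/-! ### Passage between resonant states and solutions of the rescaled problem. -/

section

variable {D : Set E3} [IsFiniteMeasure (volume.restrict D)] {R : ℝ}

/-- One application of the smoothing of the potential. The resulting bound does not depend on how q
was truncated, so it can itself serve as the truncation level. -/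
theorem ae_norm_le_of_eq_smul {C k : ℝ} {κ ω : ℂ} {U q : L2 D}
    (hsup : ∀ ω : ℂ, ‖ω‖ ≤ 1 → ∀ f : L2 D,
      ∀ᵐ x ∂volume.restrict D, ‖potentialCLM D R ω f x‖ ≤ C * ‖f‖)
    (hC : 0 ≤ C) (hκ : ‖κ‖ ≤ k) (hω : ‖ω‖ ≤ 1) (hU : U = κ ^ 2 • potentialCLM D R ω (U + q))
    (hq : ‖q‖ ≤ ‖U‖) (hU2 : ‖U‖ ≤ 2) : ∀ᵐ x ∂volume.restrict D, ‖U x‖ ≤ k ^ 2 * (C * 4) := by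
  have h1 : U =ᵐ[volume.restrict D] (κ ^ 2 • potentialCLM D R ω (U + q) : L2 D) :=
    Eventually.of_forall fun x => congrArg (fun V : L2 D => V x) hU
  filter_upwards [h1, Lp.coeFn_smul (κ ^ 2) (potentialCLM D R ω (U + q)), hsup ω hω (U + q)]
    with x h2 h3 h4
  rw [h2, h3, Pi.smul_apply, norm_smul, norm_pow]
  have h5 : ‖U + q‖ ≤ 4 := (norm_add_le _ _).trans (by linarith)
  have h6 : ‖potentialCLM D R ω (U + q) x‖ ≤ C * 4 := h4.trans (by gcongr)
  gcongr

/-- Undoes the scaling: τω² = κ², and the a priori bound on U turns the truncated cubic into the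
Kerr term. The condition a²M² ≤ 1 is what makes the cubic contribution at most ‖U‖. -/
theorem isResonantState_of_bifurcationMap (hDR : D ⊆ Metric.closedBall 0 R) (hDm : MeasurableSet D)
    {φ : E3 → ℂ} (hφ : MemLp φ 2 (volume.restrict D)) {C k M B a τ : ℝ} (hM : 0 ≤ M)
    (hsup : ∀ ω : ℂ, ‖ω‖ ≤ 1 → ∀ f : L2 D,
      ∀ᵐ x ∂volume.restrict D, ‖potentialCLM D R ω f x‖ ≤ C * ‖f‖) (hC : 0 ≤ C)
    (hB : ∀ ω : ℂ, ‖ω‖ ≤ 1 → ∀ f : L2 D, MemH2 D (potentialCLM D R ω f) ∧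
      h2Norm D (potentialCLM D R ω f) ≤ B * ‖f‖) (hB0 : 0 ≤ B)
    (hMk : k ^ 2 * (C * 4) ≤ M) (ha : 0 < a) (hτ : 0 < τ) (haM : a ^ 2 * M ^ 2 ≤ 1)
    {κ : ℂ} {U : L2 D} (hκ : ‖κ‖ ≤ k) (hω : ‖(((√τ)⁻¹ : ℝ) : ℂ) * κ‖ ≤ 1) (hU2 : ‖U‖ ≤ 2)
    (hG : bifurcationMap (potentialCLM D R) (cubicOp D M hM) (hφ.toLp φ) (√τ)⁻¹ (a ^ 2) (κ, U) =
      (1, 0)) :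
    IsResonantState D τ ((((√τ)⁻¹ : ℝ) : ℂ) * κ) (fun x => (a : ℂ) * U x) ∧
      l2Inner D φ (fun x => (a : ℂ) * U x) = a ∧
      h2Norm D (fun x => (a : ℂ) * U x) ≤ B * (k ^ 2 * 4) * a := by
  set ω : ℂ := (((√τ)⁻¹ : ℝ) : ℂ) * κ with hωdef
  set q : L2 D := ((a ^ 2 : ℝ) : ℂ) • cubicOp D M hM U with hqdef
  have hin : inner ℂ (hφ.toLp φ) U = 1 := congrArg Prod.fst hG
  have hU : U = κ ^ 2 • potentialCLM D R ω (U + q) := sub_eq_zero.1 (congrArg Prod.snd hG)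
  have hq : ‖q‖ ≤ ‖U‖ := by
    rw [hqdef, norm_smul, Complex.norm_real, Real.norm_of_nonneg (sq_nonneg a)]
    calc a ^ 2 * ‖cubicOp D M hM U‖ ≤ a ^ 2 * (M ^ 2 * ‖U‖) := by
          gcongr
          exact norm_cubicOp_le hM U
      _ = a ^ 2 * M ^ 2 * ‖U‖ := (mul_assoc _ _ _).symm
      _ ≤ ‖U‖ := mul_le_of_le_one_left (norm_nonneg _) haM
  have hUM := ae_norm_le_of_eq_smul hsup hC hκ hω hU hq hU2
  have hτ0 : (((√τ : ℝ)) : ℂ) ≠ 0 := Complex.ofReal_ne_zero.2 (Real.sqrt_pos.2 hτ).ne'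
  have hτω : (τ : ℂ) * ω ^ 2 = κ ^ 2 := by
    have h1 : (τ : ℂ) = ((√τ : ℝ) : ℂ) ^ 2 := by rw [← Complex.ofReal_pow, Real.sq_sqrt hτ.le]
    rw [h1, hωdef, Complex.ofReal_inv]
    field_simp
  have hkerr : (fun y => kerr ((a : ℂ) * U y)) =ᵐ[volume.restrict D]
      fun y => (a : ℂ) * (U + q : L2 D) y := by
    filter_upwards [hUM, Lp.coeFn_add U q, Lp.coeFn_smul ((a ^ 2 : ℝ) : ℂ) (cubicOp D M hM U),
      cubicOp_ae hM U] with y h1 h2 h3 h4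
    rw [kerr_mul, h2, Pi.add_apply, hqdef, h3, Pi.smul_apply, h4,
      truncatedCubic_eq (h1.trans hMk), smul_eq_mul, Complex.norm_real,
      Real.norm_of_nonneg ha.le, Complex.ofReal_mul]
    ring
  have hl : l2Inner D φ (fun x => (a : ℂ) * U x) = a := by
    rw [l2Inner_const_mul, l2Inner_eq_inner hφ, hin, mul_one]
  have hUae : (fun x => (a : ℂ) * U x) =ᵐ[volume.restrict D]
      potentialCLM D R ω (((a : ℂ) * κ ^ 2) • (U + q)) := by
    rw [map_smul, mul_smul, ← hU]
    exact (Lp.coeFn_smul (a : ℂ) U).symm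
  obtain ⟨h2, h2B⟩ := hB ω hω (((a : ℂ) * κ ^ 2) • (U + q))
  refine ⟨⟨h2.congr hUae.symm, fun h0 => ?_, ?_⟩, hl, ?_⟩
  · rw [l2Inner_congr (ae_eq_refl _) h0] at hl
    simp only [l2Inner, mul_zero, integral_zero] at hl
    exact ha.ne (by exact_mod_cast hl)
  · filter_upwards [hUae, potentialCLM_ae hDR hDm ω (((a : ℂ) * κ ^ 2) • (U + q))] with x h3 h4
    rw [h3, h4, hτω, volumePotential_congr ω hkerr, volumePotential_const_mul,
      volumePotential_congr ω (Lp.coeFn_smul ((a : ℂ) * κ ^ 2) (U + q))]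
    exact (volumePotential_const_mul D ω _ _ x).trans (by ring)
  · rw [h2Norm_congr hUae]
    refine h2B.trans ?_
    have h5 : ‖U + q‖ ≤ 4 := (norm_add_le _ _).trans (by linarith)
    have h6 : ‖((a : ℂ) * κ ^ 2) • (U + q)‖ ≤ a * k ^ 2 * 4 := by
      rw [norm_smul, norm_mul, Complex.norm_real, Real.norm_of_nonneg ha.le, norm_pow]
      gcongr
    calc B * ‖((a : ℂ) * κ ^ 2) • (U + q)‖ ≤ B * (a * k ^ 2 * 4) := by gcongr
      _ = B * (k ^ 2 * 4) * a := by ring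

/-- The converse scaling: v is divided by its amplitude p = ⟨φ, v⟩ = e^{iθ}a, and the phase drops
out because the Kerr term is gauge equivariant. -/
theorem IsResonantState.exists_normalized (hDR : D ⊆ Metric.closedBall 0 R) (hDm : MeasurableSet D)
    {φ : E3 → ℂ} (hφ : MemLp φ 2 (volume.restrict D)) {σ a τ : ℝ} {ω : ℂ} {v : E3 → ℂ}
    (hv : IsResonantState D τ ω v) (hτ : 0 < τ) (ha : 0 < a) (hva : ‖l2Inner D φ v‖ = a)
    (hσ : 0 ≤ σ) (hvσ : ∀ᵐ x ∂volume.restrict D, ‖v x‖ ≤ σ) :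
    ∃ (U q : L2 D) (θ : ℝ),
      (v =ᵐ[volume.restrict D] fun x => Complex.exp (Complex.I * θ) * ((a : ℂ) * U x)) ∧
      inner ℂ (hφ.toLp φ) U = 1 ∧
      U = (((√τ : ℝ) : ℂ) * ω) ^ 2 • potentialCLM D R ω (U + q) ∧
      ‖q‖ ≤ σ ^ 2 * ‖U‖ ∧
      q =ᵐ[volume.restrict D] fun x => ((a ^ 2 : ℝ) : ℂ) * (((‖U x‖ ^ 2 : ℝ) : ℂ) * U x) := by
  have hL := hv.memH2.memLp
  set θ := (l2Inner D φ v).arg with hθ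
  set p : ℂ := Complex.exp (Complex.I * θ) * a with hp
  have hpn : ‖p‖ = a := by
    rw [hp, norm_mul, mul_comm Complex.I, Complex.norm_exp_ofReal_mul_I, one_mul,
      Complex.norm_real, Real.norm_of_nonneg ha.le]
  have hp0 : p ≠ 0 := norm_ne_zero_iff.1 (by rw [hpn]; exact ha.ne')
  have hpl : l2Inner D φ v = p := by
    rw [hp, ← hva, mul_comm, mul_comm Complex.I]
    exact (Complex.norm_mul_exp_arg_mul_I _).symm
  set U : L2 D := p⁻¹ • hL.toLp v with hU
  have hUv : ∀ᵐ x ∂volume.restrict D, v x = p * U x := by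
    filter_upwards [hL.coeFn_toLp, Lp.coeFn_smul p⁻¹ (hL.toLp v)] with x h1 h2
    rw [hU, h2, Pi.smul_apply, h1, smul_eq_mul, mul_inv_cancel_left₀ hp0]
  have hUσ : ∀ᵐ x ∂volume.restrict D, ‖U x‖ ≤ σ / a := by
    filter_upwards [hUv, hvσ] with x h1 h2
    rw [h1, norm_mul, hpn] at h2
    rwa [le_div_iff₀' ha]
  have hσa : 0 ≤ σ / a := by positivity
  -- The level σ/a is never exceeded by U, so it only serves to place |U|²U in L². The factor a²
  -- turns (σ/a)² into σ², a bound independent of a.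
  set q : L2 D := ((a ^ 2 : ℝ) : ℂ) • cubicOp D (σ / a) hσa U with hq
  have hqae : q =ᵐ[volume.restrict D]
      fun x => ((a ^ 2 : ℝ) : ℂ) * (((‖U x‖ ^ 2 : ℝ) : ℂ) * U x) := by
    filter_upwards [hUσ, Lp.coeFn_smul ((a ^ 2 : ℝ) : ℂ) (cubicOp D (σ / a) hσa U),
      cubicOp_ae hσa U] with x h1 h2 h3
    rw [hq, h2, Pi.smul_apply, h3, truncatedCubic_eq h1, smul_eq_mul]
  refine ⟨U, q, θ, ?_, ?_, ?_, ?_, hqae⟩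
  · filter_upwards [hUv] with x h1
    rw [h1, hp, mul_assoc]
  · rw [← l2Inner_eq_inner hφ]
    have h1 : l2Inner D φ v = p * l2Inner D φ U := by
      rw [← l2Inner_const_mul]
      exact l2Inner_congr (ae_eq_refl _) hUv
    rw [hpl] at h1
    exact mul_left_cancel₀ hp0 (by rw [← h1, mul_one])
  · have hkerr : (fun y => kerr (v y)) =ᵐ[volume.restrict D] fun y => p * (U + q : L2 D) y := by
      filter_upwards [hUv, Lp.coeFn_add U q, hqae] with y h1 h2 h3
      rw [h1, kerr_mul, h2, Pi.add_apply, h3, hpn, Complex.ofReal_mul]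
      ring
    refine Lp.ext ?_
    filter_upwards [hUv, hv.lippmannSchwinger, potentialCLM_ae hDR hDm ω (U + q),
      Lp.coeFn_smul ((((√τ : ℝ) : ℂ) * ω) ^ 2) (potentialCLM D R ω (U + q))] with x h1 h2 h3 h4
    rw [h4, Pi.smul_apply, h3, smul_eq_mul]
    rw [h1, volumePotential_congr ω hkerr, volumePotential_const_mul] at h2
    have h5 : (τ : ℂ) = ((√τ : ℝ) : ℂ) ^ 2 := by rw [← Complex.ofReal_pow, Real.sq_sqrt hτ.le]
    rw [h5] at h2
    refine mul_left_cancel₀ hp0 (h2.trans ?_)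
    ring
  · rw [hq, norm_smul, Complex.norm_real, Real.norm_of_nonneg (sq_nonneg a)]
    calc a ^ 2 * ‖cubicOp D (σ / a) hσa U‖ ≤ a ^ 2 * ((σ / a) ^ 2 * ‖U‖) := by
          gcongr
          exact norm_cubicOp_le hσa U
      _ = σ ^ 2 * ‖U‖ := by field_simp

end

theorem eventually_small_params {s : ℝ} (hs : 0 < s) :
    ∀ᶠ p : ℝ × ℝ in 𝓝[>] 0 ×ˢ atTop, p ∈ paramRegion s ∧ p.1 ^ 2 < s ∧ (√p.2)⁻¹ < s := by
  have h1 : ∀ᶠ a : ℝ in 𝓝[>] 0, 0 < a ∧ a < s / 2 ∧ a ^ 2 < s := by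
    have h2 : Tendsto (fun a : ℝ => a ^ 2) (𝓝[>] 0) (𝓝 0) := by
      have : Tendsto (fun a : ℝ => a ^ 2) (𝓝 0) (𝓝 (0 ^ 2)) := (continuous_pow 2).tendsto 0
      rw [zero_pow two_ne_zero] at this
      exact this.mono_left nhdsWithin_le_nhds
    filter_upwards [self_mem_nhdsWithin, nhdsWithin_le_nhds (Iio_mem_nhds (half_pos hs)),
      h2.eventually_lt_const hs] with a h3 h4 h5
    exact ⟨h3, h4, h5⟩
  have h2 : ∀ᶠ τ : ℝ in atTop, 0 < τ ∧ τ⁻¹ < s / 2 ∧ (√τ)⁻¹ < s := by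
    filter_upwards [eventually_gt_atTop 0, tendsto_inv_atTop_zero.eventually_lt_const (half_pos hs),
      (tendsto_inv_atTop_zero.comp Real.tendsto_sqrt_atTop).eventually_lt_const hs] with τ h3 h4 h5
    exact ⟨h3, h4, h5⟩
  filter_upwards [h1.prod_mk h2] with p ⟨⟨h3, h4, h5⟩, h6, h7, h8⟩
  exact ⟨⟨h3, h6, by linarith⟩, h5, h8⟩

section

variable {D : Set E3} [IsFiniteMeasure (volume.restrict D)] {R : ℝ}

theorem IsSimpleEigenvalue.exists_eq_smul (hDR : D ⊆ Metric.closedBall 0 R) (hDm : MeasurableSet D)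
    {lam : ℝ} {φ : E3 → ℂ} (hs : IsSimpleEigenvalue D lam) (hφ : IsNormalizedEigenfunction D lam φ)
    (ψ : L2 D) (hψ : potentialCLM D R 0 ψ = (lam : ℂ) • ψ) : ∃ c : ℂ, ψ = c • hφ.memLp.toLp φ := by
  rcases eq_or_ne ψ 0 with rfl | h0
  · exact ⟨0, by rw [zero_smul]⟩
  have hn : ((‖ψ‖ : ℝ) : ℂ) ≠ 0 := Complex.ofReal_ne_zero.2 (norm_ne_zero_iff.2 h0)
  set χ : L2 D := (((‖ψ‖ : ℝ) : ℂ))⁻¹ • ψ with hχ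
  have hχ1 : ‖χ‖ = 1 := by
    rw [hχ, norm_smul, norm_inv, Complex.norm_real, norm_norm,
      inv_mul_cancel₀ (norm_ne_zero_iff.2 h0)]
  have hχK : potentialCLM D R 0 χ = (lam : ℂ) • χ := by rw [hχ, map_smul, hψ, smul_comm]
  obtain ⟨c, hc⟩ := hs.2 _ _ hφ (isNormalizedEigenfunction_of_apply hDR hDm hχ1 hχK)
  refine ⟨(‖ψ‖ : ℂ) * c, ?_⟩
  have h1 : χ = c • hφ.memLp.toLp φ := by
    refine Lp.ext ?_
    filter_upwards [hc, Lp.coeFn_smul c (hφ.memLp.toLp φ), hφ.memLp.coeFn_toLp] with x h2 h3 h4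
    rw [h2, h3, Pi.smul_apply, h4, smul_eq_mul]
  rw [mul_smul, ← h1, hχ, smul_smul, mul_inv_cancel₀ hn, one_smul]

-- The constants are fixed in the order C, k, M, η₀, ρ, s, δ: ρ makes every competitor fall into the
-- uniqueness ball of radius η₀, and δ makes the parameters small enough for the solutions to exist
-- and to be ρ-near.
set_option maxHeartbeats 1000000 in
theorem exists_resonantBranch (hDR : D ⊆ Metric.closedBall 0 R) (hDm : MeasurableSet D)
    (hDb : Bornology.IsBounded D) {lam : ℝ} {φ : E3 → ℂ} (hs : IsSimpleEigenvalue D lam)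
    (hφ : IsNormalizedEigenfunction D lam φ) :
    ∃ δ > 0, ∃ ρ > 0, ∃ (ω : ℝ → ℝ → ℂ) (u : ℝ → ℝ → E3 → ℂ),
      IsResonantBranch D lam φ δ ρ ω u := by
  have hlam := hφ.pos hDR hDm
  set Φ := hφ.memLp.toLp φ with hΦ
  have hΦ1 : ‖Φ‖ = 1 := hφ.norm_toLp
  have hKΦ : potentialCLM D R 0 Φ = (lam : ℂ) • Φ := hφ.apply_toLp hDR hDm
  set κ₀ : ℂ := (((√lam)⁻¹ : ℝ) : ℂ) with hκ₀
  have hl : κ₀ ^ 2 * (lam : ℂ) = 1 := by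
    rw [hκ₀, ← Complex.ofReal_pow, inv_pow, Real.sq_sqrt hlam.le, ← Complex.ofReal_mul,
      inv_mul_cancel₀ hlam.ne', Complex.ofReal_one]
  obtain ⟨C₁, hC₁, hlip₁⟩ := exists_lipschitz_potentialCLM D R
  obtain ⟨C₂, hC₂, hsup₂⟩ := exists_sup_bound_potentialCLM D R
  obtain ⟨B, hB0, hB⟩ := exists_h2_bound hDR hDm
  set C := max C₁ C₂ with hCdef
  have hC : 0 ≤ C := hC₁.trans (le_max_left _ _)
  have hlip : ∀ ω ω' : ℂ, ‖ω‖ ≤ 1 → ‖ω'‖ ≤ 1 →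
      ‖potentialCLM D R ω - potentialCLM D R ω'‖ ≤ C * ‖ω - ω'‖ := fun ω ω' h h' =>
    (hlip₁ ω ω' h h').trans (mul_le_mul_of_nonneg_right (le_max_left _ _) (norm_nonneg _))
  have hsup : ∀ ω : ℂ, ‖ω‖ ≤ 1 → ∀ f : L2 D,
      ∀ᵐ x ∂volume.restrict D, ‖potentialCLM D R ω f x‖ ≤ C * ‖f‖ := fun ω h f => by
    filter_upwards [(hsup₂ ω h f).1] with x hx
    exact hx.trans (mul_le_mul_of_nonneg_right (le_max_right _ _) (norm_nonneg _))
  have hbd : ∀ ω : ℂ, ‖ω‖ ≤ 1 → ‖potentialCLM D R ω‖ ≤ C := fun ω h =>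
    (ContinuousLinearMap.opNorm_le_bound _ hC₂ fun f => (hsup₂ ω h f).2).trans (le_max_right _ _)
  set k := ‖κ₀‖ + 1 with hk
  have hk1 : 1 ≤ k := by rw [hk]; linarith [norm_nonneg κ₀]
  have hk0 : 0 < k := by linarith
  set M := k ^ 2 * (C * 4) with hMdef
  have hM : 0 ≤ M := by positivity
  obtain ⟨L, hL⟩ := exists_linearization_equiv
    (isCompactOperator_convCLM hDb hDm (memLp_helmholtzKernel R 0))
    (isSymmetric_potentialCLM_zero D R) hΦ1 hl hKΦ (hs.exists_eq_smul hDR hDm hφ)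
  rw [← potentialCLM] at hL
  set ν := ‖(L.symm : ℂ × L2 D →L[ℂ] ℂ × L2 D)‖ with hνdef
  have hν : 0 ≤ ν := norm_nonneg _
  have hLinv : ∀ z, ‖z‖ ≤ ν * ‖linearization (potentialCLM D R 0) Φ κ₀ z‖ := fun z => by
    have h1 : L z = linearization (potentialCLM D R 0) Φ κ₀ z := by rw [← hL]; rfl
    have h2 := (L.symm : ℂ × L2 D →L[ℂ] ℂ × L2 D).le_opNorm (L z)
    rwa [ContinuousLinearEquiv.coe_coe, L.symm_apply_apply, h1] at h2
  obtain ⟨η₀, hη₀, hη₀1, hbif⟩ := exists_unique_bifurcation (N := cubicOp D M hM) hlip hbd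
    (le_refl k) (norm_cubicOp_sub_le hM) (cubicOp_zero D hM) hΦ1 (by positivity) hl hKΦ L hL
  have hsob : 0 ≤ sobolevConst := norm_nonneg _
  -- Em bounds the remainder coefficient in `norm_sub_le_of_eq_smul` when κ is within ρ ≤ m, |ω| ≤ m
  -- and the relative size of the cubic term is at most sobolevConst·m; then νEm ≤ η₀/6.
  set E := 2 * k * C + k ^ 2 * C + k ^ 2 * C * sobolevConst + 1 with hE
  have hE0 : 0 < E := by positivity
  set m := η₀ / (6 * (ν + 1) * E) with hm
  have hm0 : 0 < m := by positivity
  -- The middle bound makes the Sobolev bound σ on competitors at most 1, so that σ² ≤ σ and the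
  -- cubic term is at most ‖U‖.
  set ρ := min η₀ (min (1 / (sobolevConst + 1)) m) with hρ
  have hρ0 : 0 < ρ := by positivity
  have hρη : ρ ≤ η₀ := min_le_left _ _
  have hρm : ρ ≤ m := (min_le_right _ _).trans (min_le_right _ _)
  have hσ1 : sobolevConst * ρ ≤ 1 := by
    have h1 : ρ ≤ 1 / (sobolevConst + 1) := (min_le_right _ _).trans (min_le_left _ _)
    rw [le_div_iff₀ (by positivity)] at h1
    linarith
  have hσ0 : 0 ≤ sobolevConst * ρ := by positivity
  have hsmall : ν * (2 * k * ρ * C + k ^ 2 * (C * m) + k ^ 2 * (C * (sobolevConst * ρ) ^ 2)) ≤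
      η₀ / 2 := by
    have h1 : (sobolevConst * ρ) ^ 2 ≤ sobolevConst * m := by
      rw [sq]
      exact (mul_le_of_le_one_left hσ0 hσ1).trans (by gcongr)
    have h2 : 2 * k * ρ * C + k ^ 2 * (C * m) + k ^ 2 * (C * (sobolevConst * ρ) ^ 2) ≤ E * m := by
      have h3 : 2 * k * ρ * C ≤ 2 * k * m * C := by gcongr
      have h4 : k ^ 2 * (C * (sobolevConst * ρ) ^ 2) ≤ k ^ 2 * (C * (sobolevConst * m)) := by gcongr
      rw [hE]
      linarith
    have h3 : (ν + 1) * (E * m) = η₀ / 6 := by rw [hm]; field_simp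
    have h4 : 0 ≤ E * m := by positivity
    have h5 := mul_le_mul_of_nonneg_left h2 hν
    linarith
  -- Half of ρ, so that the constructed frequency is strictly ρ-near.
  obtain ⟨s, hs0, hsol⟩ := hbif (ρ / 2) (half_pos hρ0) (by linarith)
  set s' := min s (min (m / k) (1 / k)) with hs'
  have hs'0 : 0 < s' := by positivity
  -- The square is needed because δ bounds 1/τ while ε = 1/√τ. The bounds 1 and s give a² < s, 1/(M
  -- + 1) gives aM ≤ 1, and the last makes the H² norm less than ρ.
  set δ := min (s' ^ 2) (min 1 (min s (min (1 / (M + 1)) (ρ / (B * (k ^ 2 * 4) + 1))))) with hδ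
  have hδ0 : 0 < δ := by positivity
  have hε0 : ∀ τ : ℝ, 0 ≤ (√τ)⁻¹ := fun τ => inv_nonneg.2 (Real.sqrt_nonneg τ)
  have hpar : ∀ a τ, (a, τ) ∈ paramRegion δ → 0 < a ∧ 0 < τ ∧ (√τ)⁻¹ < s ∧ (√τ)⁻¹ * k ≤ m ∧
      (√τ)⁻¹ * k ≤ 1 ∧ a ^ 2 < s ∧ a ^ 2 * M ^ 2 ≤ 1 ∧ B * (k ^ 2 * 4) * a < ρ := by
    rintro a τ ⟨ha, hτ, hlt⟩
    simp only at ha hτ hlt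
    have hτi : 0 < τ⁻¹ := inv_pos.2 hτ
    have haδ : a < δ := by linarith
    have hτδ : τ⁻¹ < δ := by linarith
    have hε : (√τ)⁻¹ < s' := by
      refine lt_of_pow_lt_pow_left₀ 2 hs'0.le ?_
      rw [inv_pow, Real.sq_sqrt hτ.le]
      exact hτδ.trans_le (min_le_left _ _)
    have h1 : a < 1 := haδ.trans_le ((min_le_right _ _).trans (min_le_left _ _))
    have h2 : a < s := haδ.trans_le ((min_le_right _ _).trans ((min_le_right _ _).trans
      (min_le_left _ _)))
    have h3 : a < 1 / (M + 1) := haδ.trans_le ((min_le_right _ _).trans ((min_le_right _ _).trans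
      ((min_le_right _ _).trans (min_le_left _ _))))
    have h4 : a < ρ / (B * (k ^ 2 * 4) + 1) := haδ.trans_le ((min_le_right _ _).trans
      ((min_le_right _ _).trans ((min_le_right _ _).trans (min_le_right _ _))))
    rw [lt_div_iff₀ (by positivity)] at h3 h4
    refine ⟨ha, hτ, hε.trans_le (min_le_left _ _), ?_, ?_, ?_, ?_, by linarith⟩
    · exact (le_div_iff₀ hk0).1 (hε.le.trans ((min_le_right _ _).trans (min_le_left _ _)))
    · exact (le_div_iff₀ hk0).1 (hε.le.trans ((min_le_right _ _).trans (min_le_right _ _)))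
    · rw [sq]
      exact (mul_le_of_le_one_left ha.le h1.le).trans_lt h2
    · rw [← mul_pow]
      exact pow_le_one₀ (by positivity) (by linarith)
  -- Total in (a, τ), with the default 0 outside the region, so that a branch can be chosen as a
  -- function.
  have hex : ∀ a τ, ∃ x : ℂ × L2 D, (a, τ) ∈ paramRegion δ → ‖x - (κ₀, Φ)‖ ≤ ρ / 2 ∧
      bifurcationMap (potentialCLM D R) (cubicOp D M hM) Φ (√τ)⁻¹ (a ^ 2) x = (1, 0) := by
    intro a τ
    by_cases h : (a, τ) ∈ paramRegion δ
    · obtain ⟨ha, hτ, h1, -, -, h2, -⟩ := hpar a τ h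
      obtain ⟨x, hx⟩ := (hsol _ _ (hε0 τ) h1 (sq_nonneg a) h2).1
      exact ⟨x, fun _ => hx⟩
    · exact ⟨0, fun h' => absurd h' h⟩
  choose X hX using hex
  have hκk : ∀ κ : ℂ, ‖κ - κ₀‖ ≤ ρ → ‖κ‖ ≤ k := fun κ h => by
    have := norm_le_norm_add_norm_sub' κ κ₀
    rw [hk]
    linarith
  have hU2 : ∀ U : L2 D, ‖U - Φ‖ ≤ η₀ → ‖U‖ ≤ 2 := fun U h => by
    have := norm_le_norm_add_norm_sub' U Φ
    linarith
  have hωε : ∀ (τ : ℝ) (κ : ℂ), ‖κ‖ ≤ k → ‖(((√τ)⁻¹ : ℝ) : ℂ) * κ‖ ≤ (√τ)⁻¹ * k := fun τ κ h => by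
    rw [norm_mul, Complex.norm_real, Real.norm_of_nonneg (hε0 τ)]
    exact mul_le_mul_of_nonneg_left h (hε0 τ)
  have hX1 : ∀ a τ, (a, τ) ∈ paramRegion δ → ‖(X a τ).1 - κ₀‖ ≤ ρ / 2 := fun a τ h =>
    (norm_fst_le (X a τ - (κ₀, Φ))).trans (hX a τ h).1
  have hX2 : ∀ a τ, (a, τ) ∈ paramRegion δ → ‖(X a τ).2 - Φ‖ ≤ ρ / 2 := fun a τ h =>
    (norm_snd_le (X a τ - (κ₀, Φ))).trans (hX a τ h).1
  have hscale : ∀ τ : ℝ, 0 < τ → ∀ κ : ℂ, ((√τ : ℝ) : ℂ) * ((((√τ)⁻¹ : ℝ) : ℂ) * κ) = κ :=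
    fun τ hτ κ => by
      rw [← mul_assoc, ← Complex.ofReal_mul, mul_inv_cancel₀ (Real.sqrt_pos.2 hτ).ne',
        Complex.ofReal_one, one_mul]
  have hmain : ∀ a τ, (a, τ) ∈ paramRegion δ →
      IsResonantState D τ ((((√τ)⁻¹ : ℝ) : ℂ) * (X a τ).1) (fun x => (a : ℂ) * (X a τ).2 x) ∧
      l2Inner D φ (fun x => (a : ℂ) * (X a τ).2 x) = a ∧
      h2Norm D (fun x => (a : ℂ) * (X a τ).2 x) ≤ B * (k ^ 2 * 4) * a := fun a τ h => by
    obtain ⟨ha, hτ, -, -, h1, -, h2, -⟩ := hpar a τ h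
    have h3 := hκk _ ((hX1 a τ h).trans (by linarith))
    exact isResonantState_of_bifurcationMap hDR hDm hφ.memLp hM hsup hC hB hB0 (le_refl M) ha hτ h2
      h3 ((hωε τ _ h3).trans h1) (hU2 _ ((hX2 a τ h).trans (by linarith))) (hX a τ h).2
  refine ⟨δ, hδ0, ρ, hρ0, fun a τ => (((√τ)⁻¹ : ℝ) : ℂ) * (X a τ).1,
    fun a τ x => (a : ℂ) * (X a τ).2 x, fun a τ h => (hmain a τ h).1, fun a τ h => (hmain a τ h).2.1,
    fun a τ h => ⟨?_, ?_⟩, ?_, ?_, ?_⟩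
  · obtain ⟨-, hτ, -⟩ := hpar a τ h
    rw [hscale τ hτ]
    exact (hX1 a τ h).trans_lt (by linarith)
  · obtain ⟨-, -, -, -, -, -, -, h1⟩ := hpar a τ h
    exact (hmain a τ h).2.2.trans_lt h1
  · intro a τ h ω' v hv hnear hva
    obtain ⟨ha, hτ, h1, h2, h3, h4, h5, -⟩ := hpar a τ h
    obtain ⟨U, q, θ, hvU, hin, hU, hq, hqae⟩ := hv.exists_normalized hDR hDm hφ.memLp hτ ha hva hσ0
      (hv.memH2.ae_norm_le hnear.2)
    set κ : ℂ := ((√τ : ℝ) : ℂ) * ω' with hκ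
    have hκρ : ‖κ - κ₀‖ ≤ ρ := hnear.1.le
    have hω' : ω' = (((√τ)⁻¹ : ℝ) : ℂ) * κ := by
      rw [hκ, ← mul_assoc, ← Complex.ofReal_mul, inv_mul_cancel₀ (Real.sqrt_pos.2 hτ).ne',
        Complex.ofReal_one, one_mul]
    have hωk : ‖ω'‖ ≤ (√τ)⁻¹ * k := by
      rw [hω']
      exact hωε τ κ (hκk κ hκρ)
    have hωm : ‖ω'‖ ≤ min m 1 := le_min (hωk.trans h2) (hωk.trans h3)
    have hUη : ‖U - Φ‖ ≤ η₀ := by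
      refine norm_sub_le_of_eq_smul hlip hbd (le_refl k) hΦ1 hl hKΦ hLinv hν hκρ (hρη.trans hη₀1)
        hωm (min_le_right _ _) hq hU hin hη₀.le hη₀1 (le_trans ?_ hsmall)
      gcongr
      exact min_le_left _ _
    have hqU : ‖q‖ ≤ ‖U‖ :=
      hq.trans (mul_le_of_le_one_left (norm_nonneg _) (pow_le_one₀ hσ0 hσ1))
    have hUM := ae_norm_le_of_eq_smul hsup hC (hκk κ hκρ) (hωk.trans h3) hU hqU (hU2 U hUη)
    -- The a priori bound on U holds for the competitor too, so its true cubic term agrees with the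
    -- truncated one and it solves the same rescaled problem.
    have hqN : q = ((a ^ 2 : ℝ) : ℂ) • cubicOp D M hM U := by
      refine Lp.ext ?_
      filter_upwards [hUM, hqae, cubicOp_ae hM U,
        Lp.coeFn_smul ((a ^ 2 : ℝ) : ℂ) (cubicOp D M hM U)] with x e1 e2 e3 e4
      rw [e2, e4, Pi.smul_apply, e3, truncatedCubic_eq e1, smul_eq_mul]
    have hG : bifurcationMap (potentialCLM D R) (cubicOp D M hM) Φ (√τ)⁻¹ (a ^ 2) (κ, U) = (1, 0) := by
      refine Prod.ext hin ?_
      show U - κ ^ 2 • potentialCLM D R ((((√τ)⁻¹ : ℝ) : ℂ) * κ)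
        (U + ((a ^ 2 : ℝ) : ℂ) • cubicOp D M hM U) = 0
      rw [← hω', ← hqN, ← hU, sub_self]
    have heq := (hsol _ _ (hε0 τ) h1 (sq_nonneg a) h4).2 (κ, U) (X a τ)
      (max_le (hκρ.trans hρη) hUη) ((hX a τ h).1.trans (by linarith)) hG (hX a τ h).2
    rw [← heq]
    exact ⟨hω', θ, hvU⟩
  · rw [Metric.tendsto_nhds]
    intro e he
    -- For smaller parameters a solution exists in a smaller ball; uniqueness in the η₀-ball
    -- identifies it with the chosen one.
    obtain ⟨s₁, hs₁, hsol₁⟩ := hbif (min (e / 2) (ρ / 2)) (by positivity)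
      ((min_le_right _ _).trans (by linarith))
    filter_upwards [eventually_small_params hδ0, eventually_small_params hs₁] with p h1 h2
    have h3 : (p.1, p.2) ∈ paramRegion δ := h1.1
    obtain ⟨hsolx, huniq⟩ := hsol₁ _ _ (hε0 p.2) h2.2.2 (sq_nonneg p.1) h2.2.1
    obtain ⟨x, hx, hGx⟩ := hsolx
    have heq := huniq x (X p.1 p.2) (hx.trans ((min_le_right _ _).trans (by linarith)))
      ((hX _ _ h3).1.trans (by linarith)) hGx (hX _ _ h3).2
    rw [hscale p.2 h1.1.2.1, dist_eq_norm, ← heq]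
    exact ((norm_fst_le (x - (κ₀, Φ))).trans (hx.trans (min_le_left _ _))).trans_lt (by linarith)
  · have hlim : Tendsto (fun p : ℝ × ℝ => B * (k ^ 2 * 4) * p.1) (𝓝[>] 0 ×ˢ atTop) (𝓝 0) := by
      have h1 : Tendsto (fun p : ℝ × ℝ => p.1) (𝓝[>] 0 ×ˢ atTop) (𝓝 0) :=
        tendsto_fst.mono_right nhdsWithin_le_nhds
      simpa using h1.const_mul (B * (k ^ 2 * 4))
    refine squeeze_zero' (Eventually.of_forall fun p => h2Norm_nonneg D _) ?_ hlim
    filter_upwards [eventually_small_params hδ0] with p h1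
    exact (hmain p.1 p.2 h1.1).2.2

end

/-! ### The dimer -/

theorem IsParticle.isOpen_dimer {D₀ : Set E3} (h : IsParticle D₀) (L : ℝ) : IsOpen (dimer D₀ L) := by
  refine IsOpen.union ?_ ?_
  · exact (Homeomorph.addRight (shift (-L))).isOpenMap _ h.isOpen
  · exact (Homeomorph.addRight (shift L)).isOpenMap _
      (reflectIso.toHomeomorph.isOpenMap _ h.isOpen)

theorem IsParticle.isBounded_dimer {D₀ : Set E3} (h : IsParticle D₀) (L : ℝ) :
    Bornology.IsBounded (dimer D₀ L) := by
  refine Bornology.IsBounded.union ?_ ?_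
  · exact (LipschitzWith.of_dist_le_mul (K := 1) fun x y => by simp).isBounded_image h.isBounded
  · refine (LipschitzWith.of_dist_le_mul (K := 1) fun x y => by simp).isBounded_image ?_
    exact reflectIso.lipschitz.isBounded_image h.isBounded

theorem IsParticle.volume_dimer_ne_zero {D₀ : Set E3} (h : IsParticle D₀) (L : ℝ) :
    volume (dimer D₀ L) ≠ 0 := by
  obtain ⟨x, hx⟩ := h.isConnected.nonempty
  exact (h.isOpen_dimer L).measure_ne_zero volume ⟨_, Or.inl ⟨x, hx, rfl⟩⟩

end DimerResonance

end

/-! ### Conclusion for the symmetric dimer. -/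

open DimerResonance in
theorem mainTheorem11 (D₀ : Set E3) (L : ℝ) (hD₀ : IsParticle D₀)
    (hD : HasC1Boundary (dimer D₀ L)) :
    -- eigenfunctions of simple eigenvalues are even or odd
    (∀ (lam : ℝ) (φ : E3 → ℂ), IsSimpleEigenvalue (dimer D₀ L) lam →
      IsNormalizedEigenfunction (dimer D₀ L) lam φ →
        IsEvenOn (dimer D₀ L) φ ∨ IsOddOn (dimer D₀ L) φ) ∧
    -- the largest eigenvalue is simple, with a positive even normalized eigenfunction
    (∃ lam₀ : ℝ, IsGreatest {lam | IsEigenvalue (dimer D₀ L) lam} lam₀ ∧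
      IsSimpleEigenvalue (dimer D₀ L) lam₀ ∧
      ∃ φ₀ : E3 → ℝ, ContinuousOn φ₀ (closure (dimer D₀ L)) ∧
        IsNormalizedEigenfunction (dimer D₀ L) lam₀ (fun x => (φ₀ x : ℂ)) ∧
        (∀ x ∈ dimer D₀ L, 0 < φ₀ x) ∧ ∀ x ∈ dimer D₀ L, φ₀ (reflect x) = φ₀ x) ∧
    -- the small-amplitude nonlinear branch exists and has the symmetry of the eigenfunction
    (∀ (lam : ℝ) (φ : E3 → ℂ), IsSimpleEigenvalue (dimer D₀ L) lam →
      IsNormalizedEigenfunction (dimer D₀ L) lam φ →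
        (∃ δ > 0, ∃ ρ > 0, ∃ (ω : ℝ → ℝ → ℂ) (u : ℝ → ℝ → E3 → ℂ),
          IsResonantBranch (dimer D₀ L) lam φ δ ρ ω u) ∧
        ∀ (δ ρ : ℝ) (ω : ℝ → ℝ → ℂ) (u : ℝ → ℝ → E3 → ℂ),
          IsResonantBranch (dimer D₀ L) lam φ δ ρ ω u →
            ∀ a τ, (a, τ) ∈ paramRegion δ →
              (IsEvenOn (dimer D₀ L) φ → IsEvenOn (dimer D₀ L) (u a τ)) ∧
              (IsOddOn (dimer D₀ L) φ → IsOddOn (dimer D₀ L) (u a τ))) := by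
  have hDo := hD₀.isOpen_dimer L
  have hDb := hD₀.isBounded_dimer L
  have hD0 := hD₀.volume_dimer_ne_zero L
  have hDm := hDo.measurableSet
  have hDr : IsReflectInvariant (dimer D₀ L) := fun _ hx => reflect_mem_dimer hx
  obtain ⟨R, hDR⟩ := hDb.subset_closedBall 0
  have : MeasureTheory.IsFiniteMeasure (MeasureTheory.volume.restrict (dimer D₀ L)) :=
    ⟨by simpa using hDb.measure_lt_top⟩
  refine ⟨fun lam φ hs hφ => isEvenOn_or_isOddOn hDr hs hφ, ?_, fun lam φ hs hφ =>
    ⟨exists_resonantBranch hDR hDm hDb hs hφ, fun δ ρ ω u h a τ ha =>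
      ⟨h.isEvenOn hDr ha, h.isOddOn hDr ha⟩⟩⟩
  obtain ⟨h1, h2, φ₀, hc, hφ₀, hpos⟩ := exists_ground_state hDR hDm hDb hD0
  exact ⟨_, h1, h2, φ₀, hc.continuousOn, hφ₀, hpos,
    reflect_eq_of_pos_eigenfunction hDr hDo hD0 h2 hc hφ₀ hpos⟩
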